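/- **Setting.** Let $1<\gamma\le 5/3$, $\theta=(\gamma-1)/2$, $p(\rho)=\rho^\gamma/\gamma$. For $u=(\rho,m)$ with $\rho>0$ put $v=m/\rho$, $z(u)=v-\rho^\theta/\theta$, $w(u)=v+\rho^\theta/\theta$, $\lambda_1=v-\rho^\theta$, $\lambda_2=v+\rho^\theta$, $f(u)=(m,m^2/\rho+p(\rho))$; at the vacuum $u=(0,0)$ put $v=z=w=0$. The state with invariants $z\le w$ is $\rho=(\theta(w-z)/2)^{1/\theta}$, $m=\rho(w+z)/2$. Let $A\in C^2(\mathbf R)$ be positive and, for some $X>0$, constant on $(X,\infty)$ and constant on $(-\infty,-X)$; let $a=-A'/A$. Let $b\in C^1(\mathbf R)$ be nonnegative, integrable and uniformly continuous (e.g. compactly supported), with $$|a|\le\mu b,\qquad B:=\max\Big\{\int_0^\infty b,\int_{-\infty}^0 b\Big\}\le\tfrac12\log\tfrac1\sigma,$$ $$\mu=\frac{(1-\theta)^2}{\theta(1+\theta-2\sqrt\theta)},\qquad \sigma=\frac{1-\theta}{(1-\sqrt\theta)(2\sqrt{\theta+1}+\sqrt\theta-1)}.$$ Let $M\ge0$,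 $1<\delta<1/(2\theta)$, and let $\tfrac12<\alpha<1$, $0<\beta<\alpha$ satisfy $\tfrac12+\tfrac\beta2<\alpha<1-2\beta$, $\beta<2/(\gamma+5)$, $(9-3\gamma)\beta/2<\alpha$. The mesh lengths $\Delta x,\Delta t>0$ satisfy $\Delta x/\Delta t=2Me^{B}$. The initial datum $u_0=(\rho_0,m_0)\in L^\infty(\mathbf R)$ satisfies, for a.e. $x$, $\rho_0\ge0$, $m_0=0$ where $\rho_0=0$, $z(u_0(x))\ge -Me^{-\int_0^xb}$ and $w(u_0(x))\le Me^{\int_0^xb}$. **The modified Godunov scheme.** *Nodes.* Put $u^\Delta(x,-0)=u_0(x)$, and let $E_j^n$ be the mean of $u^\Delta(\cdot,n\Delta t-0)$ over $[(j-\frac12)\Delta x,(j+\frac12)\Delta x]$. If the density of $E_j^n$ is $<(\Delta x)^\delta$, put $u_j^n=(0,0)$; otherwise $u_j^n$ is the state with invariants $z_j^n=\max\{z(E_j^n),-Me^{-\int_0^{j\Delta x}b}\}$ and $w_j^n=\min\{w(E_j^n),Me^{\int_0^{j\Delta x}b}\}$. *Notation in the cell* $j\Delta x\le x<(j+1)\Delta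 x$, $n\Delta t\le t<(n+1)\Delta t$: $u_L=u_j^n$, $u_R=u_{j+1}^n$, $x_c=(j+\frac12)\Delta x$, $\tau=t-n\Delta t$; $u_M$ is the middle state (possibly the vacuum) of the Riemann problem $(u_L,u_R)$ for $\rho_t+m_x=0$, $m_t+(m^2/\rho+p)_x=0$. $\mathcal U(x,x_d,u_d)$ is the state with invariants $z(u_d)e^{-\int_{x_d}^xb}$, $w(u_d)e^{\int_{x_d}^xb}$. A "1-jump" ("2-jump") of speed $s$ between two non-vacuum states is a pair satisfying the Rankine–Hugoniot conditions and belonging to the first (second) family: $s=v_l-S(\rho_r,\rho_l)$ (resp. $s=v_r+S(\rho_l,\rho_r)$), $S(\rho,\rho_0)=\sqrt{\rho(p(\rho)-p(\rho_0))/(\rho_0(\rho-\rho_0))}$, $S(\rho_0,\rho_0)=\sqrt{p'(\rho_0)}$; entropy admissibility is not required. The *fractional step* replaces a value $\bar u$ at $x$ by the state with invariants $$\bar z-\{a\bar v\bar\rho^\theta-b\lambda_1(\bar u)\bar z\}\tau,\qquad \bar w+\{a\bar v\bar\rho^\theta-b\lambda_2(\bar u)\bar w\}\tau .$$ *Fan*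 $R_1^\Delta(z_e)(u_L)$: with $z_L=z(u_L)$ let $p=\max\{\lfloor(z_e-z_L)/(\Delta x)^\alpha\rfloor+1,2\}$, $z_k^*=z_L+(k-1)(\Delta x)^\alpha$ for $k<p$, $z_p^*=z_e$; $u_1=u_L$, $x_1=j\Delta x$, $\bar u_k(x)=\mathcal U(x,x_k,u_k)$; successively $\sigma_{k+1}>\sigma_k$ (for $k\ge2$) and $u_{k+1}$ are such that $z(u_{k+1})=z^*_{k+1}$ and $\bar u_k(x_{k+1}),u_{k+1}$ form a 1-jump of speed $\sigma_{k+1}$, where $x_{k+1}=x_c+\sigma_{k+1}\Delta t/2$ lies in the cell. The block $\bar u_k$ occupies the sector between the rays $x=x_c+\sigma_k\tau$ and $x=x_c+\sigma_{k+1}\tau$. Fans $R_2^\Delta$ are obtained by the reflection $(x,m,a)\to(-x,-m,-a)$. *Away from the vacuum* ($\rho_M>(\Delta x)^\beta$): on the left put the blocks $\bar u_1,\dots,\bar u_{p-1}$ of the fan from $u_L$ aiming at $z_e=z(u_M)$ ($p=2$ if the 1-wave is a shock); on the right, by reflection, those of the fan from $u_R$ aiming at $w(u_M)$; between the rays $x=x_c+\sigma_p^\diamond\tau$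 and $x=x_c+\sigma_s^\diamond\tau$ put $\mathcal U(x,x_c,u_M^\diamond)$. Here $\sigma^\diamond_p<\sigma^\diamond_s$, these speeds are strictly ordered with respect to those of the adjacent fan rays, the points $x_c+\sigma^\diamond_p\Delta t/2$ and $x_c+\sigma^\diamond_s\Delta t/2$ lie in the cell, and at them the adjacent blocks form a 1-jump of speed $\sigma_p^\diamond$, resp. a 2-jump of speed $\sigma_s^\diamond$. Apply the fractional step to get $u^\Delta$. *Near the vacuum* ($\rho_M\le(\Delta x)^\beta$): let $L_j=-Me^{-\int_0^{(j+1)\Delta x}b}$. If $\rho_L>0$ and the 1-wave is a rarefaction ($\rho_M\le\rho_L$), define $u_L^*$, $\lambda_L^*$ and $u^\Delta$ for $x\le x_c+\lambda_L^*\tau$ as follows. (1) If $\rho_L>2(\Delta x)^\beta$: use the complete fan (blocks $\bar u_1,\dots,\bar u_p$) from $u_L$ to the value of $z$ taken at density $2(\Delta x)^\beta$ on $w=w(u_L)$, with the fractional step; $\lambda_L^*=\lambda_1(u_p)$, and $u_L^*$ has invariants $\max\{z(u_p),L_j\}$, $w(u_L)$. (2) If $\rho_L\le2(\Delta x)^\beta$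 and $z(u_L)\ge L_j$: $u^\Delta=u_L^*=u_L$, $\lambda_L^*=\lambda_1(u_L)$. (3) If $\rho_L\le2(\Delta x)^\beta$ and $z(u_L)<L_j$: use $\bar z=z(u_L)e^{-\int_{j\Delta x}^xb}$, $\bar w=w(u_L)e^{-\int_{j\Delta x}^xb}$, then the fractional step with $+b\lambda_2\bar w$ in place of $-b\lambda_2\bar w$ in the second bracket; $u_L^*$ is the value of $(\bar z,\bar w)$ at a point of the cell where $\bar z=L_j$, and $\lambda_L^*=\lambda_1(u_L^*)$. Otherwise $u_L^*=u_L$ and there is no left part. The right side ($\rho_R>0$, $\rho_M\le\rho_R$) is treated by reflection. In the rest of the cell $u^\Delta$ is the Riemann solution $(u_L^*,u_R^*)$ issued from $x=x_c$ at time $n\Delta t$. **Theorem.** Fix $\gamma,A,X,b,M,\alpha,\beta,\delta$ as above. There is a function $o(\Delta x)$ with $o(\Delta x)/\Delta x\to0$ as $\Delta x\to0^+$, depending only on these fixed data (not on $u_0$, $u^\Delta$, $n$ or $x$), such that for all sufficiently small $\Delta x$ (in the same sense), for every admissible $u_0$, every approximate solution $u^\Delta$ built from $u_0$ by the scheme,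 all $n\in\mathbf Z_{\ge0}$ and all $x\in\mathbf R$, the left limits in time of $z^\Delta=z(u^\Delta)$ and $w^\Delta=w(u^\Delta)$ at $(x,(n+1)\Delta t)$ exist and $$-Me^{-\int_0^xb(y)\,dy}-o(\Delta x)\le z^\Delta(x,(n+1)\Delta t-0),\qquad w^\Delta(x,(n+1)\Delta t-0)\le Me^{\int_0^xb(y)\,dy}+o(\Delta x).$$ -/

import Mathlib

open Real Filter Topology MeasureTheory Asymptotics

namespace NozzleFlow

noncomputable section

/-- A gas state `u = (ρ, m)`: density and momentum.  The vacuum is `(0, 0)`. -/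
abbrev State := ℝ × ℝ

/-- Velocity `v = m / ρ`; at the vacuum it is `0` by convention. -/
def vel (u : State) : ℝ := u.2 / u.1

/-- Riemann invariant `z = v - ρ^θ / θ`. -/
def zInv (θ : ℝ) (u : State) : ℝ := vel u - u.1 ^ θ / θ

/-- Riemann invariant `w = v + ρ^θ / θ`. -/
def wInv (θ : ℝ) (u : State) : ℝ := vel u + u.1 ^ θ / θ

/-- The state with Riemann invariants `z ≤ w`:
`ρ = (θ (w - z) / 2)^(1/θ)`, `v = (w + z) / 2`, `m = ρ v`. -/
def ofZW (θ z w : ℝ) : State :=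
  ((θ * (w - z) / 2) ^ (1 / θ), (θ * (w - z) / 2) ^ (1 / θ) * ((w + z) / 2))

/-- First characteristic speed `v - ρ^θ`. -/
def lam1 (θ : ℝ) (u : State) : ℝ := vel u - u.1 ^ θ

/-- Second characteristic speed `v + ρ^θ`. -/
def lam2 (θ : ℝ) (u : State) : ℝ := vel u + u.1 ^ θ

/-- Pressure `p(ρ) = ρ^γ / γ`. -/
def pressure (γ r : ℝ) : ℝ := r ^ γ / γ

/-- Flux `f(u) = (m, m² / ρ + p(ρ))`. -/
def flux (γ : ℝ) (u : State) : State := (u.2, u.2 ^ 2 / u.1 + pressure γ u.1)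

/-- `S(ρ, ρ₀)`, equal to `√p'(ρ₀)` on the diagonal. -/
def shockS (γ r r₀ : ℝ) : ℝ :=
  if r = r₀ then √(r₀ ^ (γ - 1))
  else √(r * (pressure γ r - pressure γ r₀) / (r₀ * (r - r₀)))

/-- Reflection `x ↦ -x` acts on states by changing the sign of the momentum.  It exchanges the two
characteristic families: `z` becomes `-w`, `w` becomes `-z`. -/
def flipState (u : State) : State := (u.1, -u.2)

/-- The Rankine-Hugoniot conditions for left state `ul`, right state `ur` and speed `s`. -/
def RankineHugoniot (γ s : ℝ) (ul ur : State) : Prop :=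
  flux γ ur - flux γ ul = s • (ur - ul)

/-- `ul` (left) and `ur` (right) are non-vacuum states joined by a jump of the first family (a
1-shock, a 1-rarefaction shock, or the trivial jump) of speed `s`.  The Rankine-Hugoniot conditions
with `ρ_r ≠ ρ_l` force `s = v_l ± S(ρ_r, ρ_l)`; the minus sign selects the first family. -/
def OneJump (γ s : ℝ) (ul ur : State) : Prop :=
  0 < ul.1 ∧ 0 < ur.1 ∧ RankineHugoniot γ s ul ur ∧ s = vel ul - shockS γ ur.1 ul.1

/-- Jumps of the second family (2-shocks and 2-rarefaction shocks): reflections of jumps of the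
first family. -/
def TwoJump (γ s : ℝ) (ul ur : State) : Prop :=
  OneJump γ (-s) (flipState ur) (flipState ul)

/-! ### The Riemann problem for the homogeneous system -/

/-- Velocity, as a function of the density `r`, along the forward 1-wave curve issuing from the
left state `ul`: the rarefaction curve `w = w(ul)` for `r ≤ ρ_l`, the shock curve for `r > ρ_l`. -/
def waveVel (γ θ : ℝ) (ul : State) (r : ℝ) : ℝ :=
  if r ≤ ul.1 then vel ul + (ul.1 ^ θ - r ^ θ) / θ
  else vel ul
    - √(1 / (r * ul.1) * ((pressure γ r - pressure γ ul.1) / (r - ul.1))) * (r - ul.1)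

/-- Self-similar profile (in `ξ = x / t`) of the 1-wave that joins `ul` to the state of density `r`
on its forward 1-wave curve.  For `r = 0` this is the complete rarefaction ending in the vacuum. -/
def oneWave (γ θ : ℝ) (ul : State) (r ξ : ℝ) : State :=
  if ul.1 < r then
    if ξ < vel ul - shockS γ r ul.1 then ul else (r, r * waveVel γ θ ul r)
  else if ξ < lam1 θ ul then ul
  else if ξ < waveVel γ θ ul r - r ^ θ then
    -- inside the rarefaction fan: `w = w(ul)` and `v - ρ^θ = ξ`
    ((θ * (wInv θ ul - ξ) / (1 + θ)) ^ (1 / θ),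
      (θ * (wInv θ ul - ξ) / (1 + θ)) ^ (1 / θ) * ((ξ + θ * wInv θ ul) / (1 + θ)))
  else (r, r * waveVel γ θ ul r)

/-- `r` is the density of the middle state of the Riemann problem `(ul, ur)`: the intersection of
the forward 1-wave curve of `ul` with the backward 2-wave curve of `ur` if there is one, otherwise
`r = 0` (the middle state is the vacuum). -/
def IsMiddleDensity (γ θ : ℝ) (ul ur : State) (r : ℝ) : Prop :=
  (0 < ul.1 ∧ 0 < ur.1 ∧ 0 < r ∧ waveVel γ θ ul r = -waveVel γ θ (flipState ur) r) ∨
  (r = 0 ∧ (ul.1 = 0 ∨ ur.1 = 0 ∨ wInv θ ul ≤ zInv θ ur))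

/-- Self-similar profile of the Riemann solution `(ul, ur)` with middle density `r`: the 1-wave to
the left of the velocity of the middle state, the 2-wave to the right of it. -/
def riemannProfile (γ θ : ℝ) (ul ur : State) (r ξ : ℝ) : State :=
  if ur.1 = 0 ∨ (0 < ul.1 ∧ ξ < waveVel γ θ ul r) then oneWave γ θ ul r ξ
  else flipState (oneWave γ θ (flipState ur) r (-ξ))

/-- The Riemann solution `(ul, ur)` at time `τ ≥ 0` and at signed distance `y` from the initial
discontinuity. -/
def riemannSol (γ θ : ℝ) (ul ur : State) (r y τ : ℝ) : State :=
  if τ = 0 then (if y < 0 then ul else ur) else riemannProfile γ θ ul ur r (y / τ)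

/-! ### The modified Godunov scheme -/

/-- The data of the scheme: adiabatic exponent `γ`, the functions `a` and `b`, the bound `M`, the
exponents `α, β, δ` and the mesh lengths `dx, dt`. -/
structure Scheme where
  γ : ℝ
  a : ℝ → ℝ
  b : ℝ → ℝ
  M : ℝ
  α : ℝ
  β : ℝ
  δ : ℝ
  dx : ℝ
  dt : ℝ

namespace Scheme

variable (P : Scheme)

/-- `θ = (γ - 1) / 2`. -/
def θ : ℝ := (P.γ - 1) / 2

/-- The scheme data seen after the reflection `x ↦ -x` (`a = -A'/A` changes sign). -/
def flip : Scheme := { P with a := fun x => -P.a (-x), b := fun x => P.b (-x) }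

/-- Midpoint `(j + 1/2) dx` of the cell `j dx ≤ x < (j+1) dx`. -/
def mid (j : ℤ) : ℝ := ((j : ℝ) + 1 / 2) * P.dx

/-- `x` lies in the closed cell `[j dx, (j+1) dx]`. -/
def InCell (j : ℤ) (x : ℝ) : Prop := (j : ℝ) * P.dx ≤ x ∧ x ≤ ((j : ℝ) + 1) * P.dx

/-- The building block `𝒰(x, x_d, u_d)`:
`z(x) = z_d exp(-∫_{x_d}^x b)`, `w(x) = w_d exp(∫_{x_d}^x b)`. -/
def steady (x xd : ℝ) (ud : State) : State :=
  ofZW P.θ (zInv P.θ ud * exp (-∫ y in xd..x, P.b y)) (wInv P.θ ud * exp (∫ y in xd..x, P.b y))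

/-- The fractional step: corrects the value `u` at the point `x` after time `τ` in the step. -/
def fracStep (x τ : ℝ) (u : State) : State :=
  ofZW P.θ
    (zInv P.θ u - (P.a x * vel u * u.1 ^ P.θ - P.b x * lam1 P.θ u * zInv P.θ u) * τ)
    (wInv P.θ u + (P.a x * vel u * u.1 ^ P.θ - P.b x * lam2 P.θ u * wInv P.θ u) * τ)

/-- The fractional step used near the vacuum for blocks in which both invariants decay. -/
def fracStepVac (x τ : ℝ) (u : State) : State :=
  ofZW P.θ
    (zInv P.θ u - (P.a x * vel u * u.1 ^ P.θ - P.b x * lam1 P.θ u * zInv P.θ u) * τ)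
    (wInv P.θ u + (P.a x * vel u * u.1 ^ P.θ + P.b x * lam2 P.θ u * wInv P.θ u) * τ)

/-- Number `max {[[(z_end - z_l) / dx^α]] + 1, 2}` of states in a 1-rarefaction fan (it is `2` if
`z_end ≤ z_l`, so in particular when the 1-wave is a shock). -/
def fanSize (zl zend : ℝ) : ℕ := (max (⌊(zend - zl) / P.dx ^ P.α⌋ + 1) 2).toNat

/-- Prescribed values `z_k^*` of `z` in a 1-rarefaction fan, `1 ≤ k ≤ p`. -/
def fanZ (zl zend : ℝ) (k : ℕ) : ℝ :=
  if k = P.fanSize zl zend then zend else zl + ((k : ℝ) - 1) * P.dx ^ P.α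

/-- The base points `x_1 = j dx`, `x_k = (j + 1/2) dx + σ_k dt / 2` for `k ≥ 2`. -/
def fanNode (j : ℤ) (s : ℕ → ℝ) (k : ℕ) : ℝ :=
  if k = 1 then (j : ℝ) * P.dx else P.mid j + s k * P.dt / 2

/-- The block `ū_k(x) = 𝒰(x, x_k, u_k)` of a fan. -/
def fanBlock (j : ℤ) (s : ℕ → ℝ) (U : ℕ → State) (k : ℕ) (x : ℝ) : State :=
  P.steady x (P.fanNode j s k) (U k)

/-- `U 1, …, U q` and the ray speeds `s 2 < … < s q` are the first `q` states and the speeds of the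
approximate 1-rarefaction wave in the cell `j` that starts from `ul` and aims at `z = zend`:
`z(u_{k+1}) = z_{k+1}^*`, and the Rankine-Hugoniot conditions of the first family hold between
`ū_k(x_{k+1})` and `u_{k+1}`, where `x_{k+1}` is the position of the ray at the middle time. -/
def IsFan (j : ℤ) (ul : State) (zend : ℝ) (q : ℕ) (s : ℕ → ℝ) (U : ℕ → State) : Prop :=
  U 1 = ul ∧
  ∀ k : ℕ, 1 ≤ k → k + 1 ≤ q →
    zInv P.θ (U (k + 1)) = P.fanZ (zInv P.θ ul) zend (k + 1) ∧
    P.InCell j (P.fanNode j s (k + 1)) ∧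
    OneJump P.γ (s (k + 1)) (P.fanBlock j s U k (P.fanNode j s (k + 1))) (U (k + 1)) ∧
    (2 ≤ k → s k < s (k + 1))

end Scheme

/-- The largest `k ≤ q` with `k ≥ 2` and `s k * τ ≤ y`, and `1` if there is none: the number of the
sector that contains the point at distance `y` from the midpoint of the cell at time `τ`. -/
def fanIndex (s : ℕ → ℝ) (y τ : ℝ) : ℕ → ℕ
  | 0 => 1
  | k + 1 => if 1 ≤ k ∧ s (k + 1) * τ ≤ y then k + 1 else fanIndex s y τ k

namespace Scheme

variable (P : Scheme)

/-- The piecewise function made of the first `q` blocks of a fan, separated by its rays. -/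
def fanBar (j : ℤ) (s : ℕ → ℝ) (U : ℕ → State) (q : ℕ) (x τ : ℝ) : State :=
  P.fanBlock j s U (fanIndex s (x - P.mid j) τ q) x

/-- The approximate solution `V x τ` in the cell `j` away from the vacuum, where `r` is the density
of the middle state `u_M` of the Riemann problem `(ul, ur)`.
On the left, the first `p - 1` blocks of the fan from `ul` towards `z(u_M)` (only the block of `ul`
if the 1-wave is a shock); on the right, by reflection, the same for `ur` and `w(u_M)`; between
them the block of a state `uM`, attached on its left by a jump of the first family of speed `s1`
and on its right by a jump of the second family of speed `s2`, both at the middle time of the step,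
with base points in the cell.  Then the fractional step is applied. -/
def RegularCell (j : ℤ) (ul ur : State) (r : ℝ) (V : ℝ → ℝ → State) : Prop :=
  ∃ (pl pr : ℕ) (sl sr : ℕ → ℝ) (Ul Ur : ℕ → State) (s1 s2 : ℝ) (uM : State),
    pl = P.fanSize (zInv P.θ ul) (waveVel P.γ P.θ ul r - r ^ P.θ / P.θ) ∧
    pr = P.fanSize (zInv P.θ (flipState ur))
      (waveVel P.γ P.θ (flipState ur) r - r ^ P.θ / P.θ) ∧
    P.IsFan j ul (waveVel P.γ P.θ ul r - r ^ P.θ / P.θ) (pl - 1) sl Ul ∧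
    P.flip.IsFan (-j - 1) (flipState ur)
      (waveVel P.γ P.θ (flipState ur) r - r ^ P.θ / P.θ) (pr - 1) sr Ur ∧
    0 < uM.1 ∧
    s1 < s2 ∧ (3 ≤ pl → sl (pl - 1) < s1) ∧ (3 ≤ pr → s2 < -sr (pr - 1)) ∧
    P.InCell j (P.mid j + s1 * P.dt / 2) ∧ P.InCell j (P.mid j + s2 * P.dt / 2) ∧
    OneJump P.γ s1 (P.fanBlock j sl Ul (pl - 1) (P.mid j + s1 * P.dt / 2))
      (P.steady (P.mid j + s1 * P.dt / 2) (P.mid j) uM) ∧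
    TwoJump P.γ s2 (P.steady (P.mid j + s2 * P.dt / 2) (P.mid j) uM)
      (flipState (P.flip.fanBlock (-j - 1) sr Ur (pr - 1) (-(P.mid j + s2 * P.dt / 2)))) ∧
    ∀ x τ : ℝ, (j : ℝ) * P.dx ≤ x → x < ((j : ℝ) + 1) * P.dx → 0 ≤ τ → τ < P.dt →
      V x τ = P.fracStep x τ
        (if x - P.mid j < s1 * τ then P.fanBar j sl Ul (pl - 1) x τ
         else if x - P.mid j < s2 * τ then P.steady x (P.mid j) uM
         else flipState (P.flip.fanBar (-j - 1) sr Ur (pr - 1) (-x) τ))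

/-- `L_j = -M exp(-∫_0^{(j+1) dx} b)`. -/
def lowerL (j : ℤ) : ℝ := -P.M * exp (-∫ y in (0 : ℝ)..(((j : ℝ) + 1) * P.dx), P.b y)

/-- Near the vacuum a nontrivial 1-rarefaction side is modified: `u_l` is replaced by `uS`, and on
the left of the ray of speed `c` the approximate solution is `W`.  Here `ul` is not the vacuum.
* `ρ_l > 2 dx^β`: a full fan from `ul` to the value of `z` at density `2 dx^β` on `w = w(ul)`
  (with the last block continued up to the ray of speed `λ₁(u_p)`), corrected by the fractional
  step; `uS` is the last state with `w` reset to `w(ul)` and `z` raised to at least `L_j`.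
* `ρ_l ≤ 2 dx^β` and `z(ul) ≥ L_j`: no change.
* `ρ_l ≤ 2 dx^β` and `z(ul) < L_j`: both invariants decay until `z` reaches `L_j`. -/
def VacuumSide (j : ℤ) (ul uS : State) (c : ℝ) (W : ℝ → ℝ → State) : Prop :=
  (2 * P.dx ^ P.β < ul.1 ∧
    ∃ (zend : ℝ) (p : ℕ) (s : ℕ → ℝ) (U : ℕ → State),
      zend = wInv P.θ ul - 2 * ((2 * P.dx ^ P.β) ^ P.θ / P.θ) ∧
      p = P.fanSize (zInv P.θ ul) zend ∧
      P.IsFan j ul zend p s U ∧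
      uS = ofZW P.θ (max (zInv P.θ (U p)) (P.lowerL j)) (wInv P.θ ul) ∧
      c = lam1 P.θ (U p) ∧
      ∀ x τ : ℝ, W x τ = P.fracStep x τ (P.fanBar j s U p x τ)) ∨
  (ul.1 ≤ 2 * P.dx ^ P.β ∧ P.lowerL j ≤ zInv P.θ ul ∧
    uS = ul ∧ c = lam1 P.θ ul ∧ ∀ x τ : ℝ, W x τ = ul) ∨
  (ul.1 ≤ 2 * P.dx ^ P.β ∧ zInv P.θ ul < P.lowerL j ∧
    ∃ x4 : ℝ, P.InCell j x4 ∧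
      zInv P.θ ul * exp (-∫ y in ((j : ℝ) * P.dx)..x4, P.b y) = P.lowerL j ∧
      uS = ofZW P.θ (zInv P.θ ul * exp (-∫ y in ((j : ℝ) * P.dx)..x4, P.b y))
        (wInv P.θ ul * exp (-∫ y in ((j : ℝ) * P.dx)..x4, P.b y)) ∧
      c = lam1 P.θ uS ∧
      ∀ x τ : ℝ, W x τ = P.fracStepVac x τ
        (ofZW P.θ (zInv P.θ ul * exp (-∫ y in ((j : ℝ) * P.dx)..x, P.b y))
          (wInv P.θ ul * exp (-∫ y in ((j : ℝ) * P.dx)..x, P.b y))))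

open scoped Classical in
/-- The approximate solution `V x τ` in the cell `j` near the vacuum, where `r` is the density of
the middle state of the Riemann problem `(ul, ur)`.  A side is modified if its wave is a
rarefaction from a non-vacuum state; the right side is treated by reflection.  In the remaining
sector the approximate solution is the Riemann solution `(ulS, urS)` itself. -/
def VacuumCell (j : ℤ) (ul ur : State) (r : ℝ) (V : ℝ → ℝ → State) : Prop :=
  ∃ (ulS urS : State) (cl cr r' : ℝ) (Wl Wr : ℝ → ℝ → State),
    ((0 < ul.1 ∧ r ≤ ul.1) → P.VacuumSide j ul ulS cl Wl) ∧
    (¬(0 < ul.1 ∧ r ≤ ul.1) → ulS = ul) ∧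
    ((0 < ur.1 ∧ r ≤ ur.1) →
      P.flip.VacuumSide (-j - 1) (flipState ur) (flipState urS) cr Wr) ∧
    (¬(0 < ur.1 ∧ r ≤ ur.1) → urS = ur) ∧
    IsMiddleDensity P.γ P.θ ulS urS r' ∧
    ∀ x τ : ℝ, (j : ℝ) * P.dx ≤ x → x < ((j : ℝ) + 1) * P.dx → 0 ≤ τ → τ < P.dt →
      V x τ =
        if (0 < ul.1 ∧ r ≤ ul.1) ∧ x - P.mid j ≤ cl * τ then Wl x τ
        else if (0 < ur.1 ∧ r ≤ ur.1) ∧ -(x - P.mid j) ≤ cr * τ then flipState (Wr (-x) τ)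
        else riemannSol P.γ P.θ ulS urS r' (x - P.mid j) τ

/-- The approximate solution in the cell `j dx ≤ x < (j+1) dx` during one time step, as a function
of `x` and of the time `τ` elapsed in the step, for the states `ul`, `ur` at the two ends. -/
def CellSolution (j : ℤ) (ul ur : State) (V : ℝ → ℝ → State) : Prop :=
  ∃ r : ℝ, IsMiddleDensity P.γ P.θ ul ur r ∧
    (P.dx ^ P.β < r → P.RegularCell j ul ur r V) ∧
    (r ≤ P.dx ^ P.β → P.VacuumCell j ul ur r V)

/-- The trace `u(x, n dt - 0)`; for `n = 0` it is the initial datum. -/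
def trace (u₀ : ℝ → State) (u : ℝ → ℝ → State) (n : ℕ) (x : ℝ) : State :=
  if n = 0 then u₀ x else limUnder (𝓝[<] ((n : ℝ) * P.dt)) (u x)

/-- The cell average `E_j^n(u)`. -/
def average (u₀ : ℝ → State) (u : ℝ → ℝ → State) (n : ℕ) (j : ℤ) : State :=
  (1 / P.dx * ∫ x in (((j : ℝ) - 1 / 2) * P.dx)..(((j : ℝ) + 1 / 2) * P.dx),
      (P.trace u₀ u n x).1,
   1 / P.dx * ∫ x in (((j : ℝ) - 1 / 2) * P.dx)..(((j : ℝ) + 1 / 2) * P.dx),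
      (P.trace u₀ u n x).2)

/-- The node state `u_j^n`: the vacuum if the average density is below `dx^δ`; otherwise the average
with its Riemann invariants cut off at the bounds of the invariant region. -/
def nodeState (u₀ : ℝ → State) (u : ℝ → ℝ → State) (n : ℕ) (j : ℤ) : State :=
  if (P.average u₀ u n j).1 < P.dx ^ P.δ then (0, 0)
  else ofZW P.θ
    (max (zInv P.θ (P.average u₀ u n j))
      (-P.M * exp (-∫ y in (0 : ℝ)..((j : ℝ) * P.dx), P.b y)))
    (min (wInv P.θ (P.average u₀ u n j))
      (P.M * exp (∫ y in (0 : ℝ)..((j : ℝ) * P.dx), P.b y)))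

/-- `u x t` (`t ≥ 0`) is an approximate solution built by the modified Godunov scheme from the
initial datum `u₀`. -/
def IsApproxSolution (u₀ : ℝ → State) (u : ℝ → ℝ → State) : Prop :=
  ∀ (n : ℕ) (j : ℤ),
    P.CellSolution j (P.nodeState u₀ u n j) (P.nodeState u₀ u n (j + 1))
      (fun x τ => u x ((n : ℝ) * P.dt + τ))

end Scheme

/-- The constant `μ`. -/
def muConst (θ : ℝ) : ℝ := (1 - θ) ^ 2 / (θ * (1 + θ - 2 * √θ))

/-- The constant `σ`. -/
def sigmaConst (θ : ℝ) : ℝ := (1 - θ) / ((1 - √θ) * (2 * √(θ + 1) + √θ - 1))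

/-- `max {∫_0^∞ b, ∫_{-∞}^0 b}`. -/
def halfMass (b : ℝ → ℝ) : ℝ := max (∫ x in Set.Ioi (0 : ℝ), b x) (∫ x in Set.Iic (0 : ℝ), b x)

/-- Admissible initial data: `u₀ ∈ L^∞`, `ρ₀ ≥ 0`, no momentum in the vacuum, and the Riemann
invariants in the generalized invariant region, almost everywhere. -/
def AdmissibleData (θ M : ℝ) (b : ℝ → ℝ) (u₀ : ℝ → State) : Prop :=
  MemLp u₀ ⊤ volume ∧
  ∀ᵐ x : ℝ, 0 ≤ (u₀ x).1 ∧ ((u₀ x).1 = 0 → (u₀ x).2 = 0) ∧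
    -M * exp (-∫ y in (0 : ℝ)..x, b y) ≤ zInv θ (u₀ x) ∧
    wInv θ (u₀ x) ≤ M * exp (∫ y in (0 : ℝ)..x, b y)

end

end NozzleFlow

open NozzleFlow

namespace NozzleFlow

noncomputable section

/-! The bounds are those of an invariant region, and each ingredient of the scheme leaves this
region by at most O(dx^(1+β/3)) in one time step. Since the node values are cut off exactly at the
bounds, every step starts afresh and nothing accumulates. Reflection turns the lower bound of z into
the upper bound of w, so most estimates are made on one side only.

Source term. Along a block 𝒰 the products z·exp(∫b) and w·exp(-∫b) are constant, so the blocks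
follow the bounds exactly. In the fractional step, `source_le` shows that the increment of w is
nonpositive if w ≥ 0 and -zσ ≤ w: for w + z ≥ 0 the defect is a perfect square, which is the origin
of μ, and for w + z < 0 it is a difference of two squares, which is the origin of σ. The bound on
the mass of b gives exp(2B)σ ≤ 1, so the condition holds on the boundary of the region. `upper_step`
extends this, by a Lipschitz argument, to the states inside and to states slightly outside.

Jumps. Between two densities the velocity jumps by √(Δp·Δ(1/ρ)), which by Cauchy-Schwarz is at least
the change along a rarefaction (`rarefaction_le_jumpVel`) and exceeds it at third order only
(`jumpVel_le`). Hence a compressive 1-jump lowers w, and an expansive one raises w by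
O((Δρ^θ)³/ρ^(2θ)). A fan has O(dx^(-α)) jumps of size O(dx^α), at densities with ρ^θ at least of
order dx^(βθ), so its total error is O(dx^(2α-2βθ)), which is O(dx^(1+β/3)) (`fan_bounds`).

Middle state. It is known only through one jump at each of two points. If its density were far below
that of the Riemann middle state, the jump from the left would make its velocity too large and the
jump from the right would make it too small (`LeftPart.attached_vel`, used from both sides in
`middle_leftLimit`). So an expansive jump into it has strength O(√dx) at most, and the cube of this
is harmless (`LeftPart.attached_upper`).

Near the vacuum. The modified states u_L^*, u_R^* lie in the box given by the lower bound at the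
right end of the cell and the upper bound at its left end, the strictest values in the cell, and
Riemann solutions do not leave such boxes (`vacuumSide_props`, `riemannSol_leftLimit`).

Averages. The invariants are not linear in (ρ, m), but the induction only needs lo·ρ ≤ m ≤ hi·ρ,
which survives integration (`nodeState_data`). The cut-off does the rest, and the threshold dx^δ
keeps the node values away from the vacuum. -/

/-- The modulus of the velocity jump across a discontinuity between the densities `a` and `b`. -/
def jumpVel (γ a b : ℝ) : ℝ := √((pressure γ a - pressure γ b) * (1 / b - 1 / a))

/-! ### Integral estimates for the velocity jump between two densities. -/

lemma jumpVel_nonneg (γ a b : ℝ) : 0 ≤ jumpVel γ a b := Real.sqrt_nonneg _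

lemma notMem_uIcc_zero {a b : ℝ} (hb : 0 < b) (hab : b ≤ a) : (0 : ℝ) ∉ Set.uIcc b a := by
  rw [Set.uIcc_of_le hab]; intro h; exact absurd h.1 (not_le.mpr hb)

lemma intervalIntegrable_rpow_pos {a b : ℝ} (r : ℝ) (hb : 0 < b) (hab : b ≤ a) :
    IntervalIntegrable (fun s : ℝ => s ^ r) volume b a :=
  intervalIntegral.intervalIntegrable_rpow (Or.inr (notMem_uIcc_zero hb hab))

lemma pressure_sub_eq_integral {γ θ : ℝ} (a b : ℝ) (hγ : γ = 1 + 2 * θ) (hθ : 0 < θ) : pressure γ a - pressure γ b = ∫ s in b..a, s ^ (2 * θ) := by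
  rw [integral_rpow (Or.inl (by linarith))]
  simp only [pressure, hγ]
  rw [add_comm (2 * θ) 1]; ring

lemma inv_sub_inv_eq_integral {a b : ℝ} (hb : 0 < b) (hab : b ≤ a) :
    1 / b - 1 / a = ∫ s in b..a, s ^ (-2 : ℝ) := by
  rw [integral_rpow (Or.inr ⟨by norm_num, notMem_uIcc_zero hb hab⟩)]
  norm_num
  rw [Real.rpow_neg_one, Real.rpow_neg_one]; ring

lemma rarefaction_eq_integral {θ : ℝ} (a b : ℝ) (hθ : 0 < θ) :
    (a ^ θ - b ^ θ) / θ = ∫ s in b..a, s ^ (θ - 1) := by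
  rw [integral_rpow (Or.inl (by linarith))]
  simp

lemma pressure_sub_nonneg {γ θ a b : ℝ} (hγ : γ = 1 + 2 * θ) (hθ : 0 < θ) (hb : 0 < b)
    (hab : b ≤ a) : 0 ≤ pressure γ a - pressure γ b := by
  rw [pressure_sub_eq_integral a b hγ hθ]
  exact intervalIntegral.integral_nonneg hab fun s hs => Real.rpow_nonneg (hb.le.trans hs.1) _

lemma inv_sub_inv_nonneg {a b : ℝ} (hb : 0 < b) (hab : b ≤ a) : 0 ≤ 1 / b - 1 / a :=
  sub_nonneg.mpr (one_div_le_one_div_of_le hb hab)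

lemma pressure_sub_le {γ θ a b : ℝ} (hγ : γ = 1 + 2 * θ) (hθ : 0 < θ) (hb : 0 < b)
    (hab : b ≤ a) : pressure γ a - pressure γ b ≤ (a ^ θ) ^ 2 * (a - b) := by
  have ha : 0 < a := hb.trans_le hab
  rw [pressure_sub_eq_integral a b hγ hθ]
  have h := intervalIntegral.integral_mono_on hab
    (intervalIntegrable_rpow_pos (2 * θ) hb hab)
    (intervalIntegrable_const (c := (a ^ θ) ^ 2)) (fun s hs => by
      rw [← Real.rpow_natCast, ← Real.rpow_mul ha.le]
      rw [show θ * ((2 : ℕ) : ℝ) = 2 * θ by push_cast; ring]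
      exact Real.rpow_le_rpow (hb.le.trans hs.1) hs.2 (by linarith))
  simpa [mul_comm] using h

lemma le_pressure_sub {γ θ a b : ℝ} (hγ : γ = 1 + 2 * θ) (hθ : 0 < θ) (hb : 0 < b)
    (hab : b ≤ a) : (b ^ θ) ^ 2 * (a - b) ≤ pressure γ a - pressure γ b := by
  rw [pressure_sub_eq_integral a b hγ hθ]
  have h := intervalIntegral.integral_mono_on hab
    (intervalIntegrable_const (c := (b ^ θ) ^ 2))
    (intervalIntegrable_rpow_pos (2 * θ) hb hab) (fun s hs => by
      rw [← Real.rpow_natCast, ← Real.rpow_mul hb.le]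
      rw [show θ * ((2 : ℕ) : ℝ) = 2 * θ by push_cast; ring]
      exact Real.rpow_le_rpow hb.le hs.1 (by linarith))
  simpa [mul_comm] using h

/-- Along a discontinuity the velocity changes by at least as much as along the rarefaction. -/
lemma rarefaction_le_jumpVel {γ θ a b : ℝ} (hγ : γ = 1 + 2 * θ) (hθ : 0 < θ) (hb : 0 < b)
    (hab : b ≤ a) : (a ^ θ - b ^ θ) / θ ≤ jumpVel γ a b := by
  have ha : 0 < a := hb.trans_le hab
  set L := (a ^ θ - b ^ θ) / θ with hL
  have hL0 : 0 ≤ L := div_nonneg (sub_nonneg.mpr (Real.rpow_le_rpow hb.le hab hθ.le)) hθ.le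
  set Pd := pressure γ a - pressure γ b with hP
  set T := 1 / b - 1 / a with hT
  have hP0 : 0 ≤ Pd := pressure_sub_nonneg hγ hθ hb hab
  have hT0 : 0 ≤ T := inv_sub_inv_nonneg hb hab
  -- Cauchy-Schwarz for ∫ s^θ·s⁻¹, in the form ∫ (c·s^θ - s⁻¹)² ≥ 0 for every c.
  have key : ∀ c : ℝ, 0 ≤ c ^ 2 * Pd + T - 2 * c * L := by
    intro c
    have h1 := intervalIntegrable_rpow_pos (2 * θ) hb hab
    have h2 := intervalIntegrable_rpow_pos (-2) hb hab
    have h3 := intervalIntegrable_rpow_pos (θ - 1) hb hab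
    rw [hP, hT, hL, pressure_sub_eq_integral a b hγ hθ, inv_sub_inv_eq_integral hb hab,
      rarefaction_eq_integral a b hθ, ← intervalIntegral.integral_const_mul,
      ← intervalIntegral.integral_const_mul,
      ← intervalIntegral.integral_add (h1.const_mul _) h2,
      ← intervalIntegral.integral_sub ((h1.const_mul _).add h2) (h3.const_mul _)]
    refine intervalIntegral.integral_nonneg hab fun s hs => ?_
    have hs0 : 0 < s := hb.trans_le hs.1
    have e1 : s ^ (2 * θ) = (s ^ θ) ^ 2 := by
      rw [← Real.rpow_natCast, ← Real.rpow_mul hs0.le]; congr 1; push_cast; ring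
    have e2 : s ^ (-2 : ℝ) = (s⁻¹) ^ 2 := by
      rw [Real.rpow_neg hs0.le]; norm_num
    have e3 : s ^ (θ - 1) = s ^ θ * s⁻¹ := by
      rw [Real.rpow_sub hs0, Real.rpow_one]; rfl
    rw [e1, e2, e3]
    nlinarith [sq_nonneg (c * s ^ θ - s⁻¹)]
  rcases hL0.eq_or_lt with h0 | h0
  · rw [← h0]; exact jumpVel_nonneg _ _ _
  · apply Real.le_sqrt_of_sq_le
    rcases hP0.eq_or_lt with hp | hp
    · exfalso
      -- If the pressure difference vanished, the expression would be affine in c; this c gives it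
      -- the value -1.
      have := key ((T + 1) / (2 * L))
      rw [← hp] at this
      have e : 2 * ((T + 1) / (2 * L)) * L = T + 1 := by field_simp
      nlinarith
    · have := key (L / Pd)
      have e : (L / Pd) ^ 2 * Pd + T - 2 * (L / Pd) * L = T - L ^ 2 / Pd := by
        field_simp; ring
      rw [e, sub_nonneg, div_le_iff₀ hp] at this
      linarith

/-- A reverse Cauchy-Schwarz (Kantorovich) bound for the velocity jump. -/
lemma jumpVel_mul_le {γ θ a b : ℝ} (hγ : γ = 1 + 2 * θ) (hθ : 0 < θ) (hb : 0 < b)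
    (hab : b ≤ a) :
    2 * (a ^ ((θ + 1) / 2) * b ^ ((θ + 1) / 2)) * jumpVel γ a b ≤
      ((a ^ ((θ + 1) / 2)) ^ 2 + (b ^ ((θ + 1) / 2)) ^ 2) * ((a ^ θ - b ^ θ) / θ) := by
  have ha : 0 < a := hb.trans_le hab
  set L := (a ^ θ - b ^ θ) / θ with hL
  have hL0 : 0 ≤ L := div_nonneg (sub_nonneg.mpr (Real.rpow_le_rpow hb.le hab hθ.le)) hθ.le
  set Pd := pressure γ a - pressure γ b with hP
  set T := 1 / b - 1 / a with hT
  set x := a ^ ((θ + 1) / 2) with hx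
  set y := b ^ ((θ + 1) / 2) with hy
  have hx0 : 0 < x := Real.rpow_pos_of_pos ha _
  have hy0 : 0 < y := Real.rpow_pos_of_pos hb _
  have hP0 : 0 ≤ Pd := pressure_sub_nonneg hγ hθ hb hab
  have hT0 : 0 ≤ T := inv_sub_inv_nonneg hb hab
  -- With F = s^(θ+1) between y² and x², integrate (F - y²)(x² - F)·s⁻² ≥ 0. The claim then follows
  -- from 4·Pd·(x²y²T) ≤ (Pd + x²y²T)².
  have key : Pd + x ^ 2 * y ^ 2 * T ≤ (x ^ 2 + y ^ 2) * L := by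
    have h1 := intervalIntegrable_rpow_pos (2 * θ) hb hab
    have h2 := intervalIntegrable_rpow_pos (-2) hb hab
    have h3 := intervalIntegrable_rpow_pos (θ - 1) hb hab
    rw [hP, hT, hL, pressure_sub_eq_integral a b hγ hθ, inv_sub_inv_eq_integral hb hab,
      rarefaction_eq_integral a b hθ, ← intervalIntegral.integral_const_mul,
      ← intervalIntegral.integral_const_mul,
      ← intervalIntegral.integral_add h1 (h2.const_mul _)]
    refine intervalIntegral.integral_mono_on hab (h1.add (h2.const_mul _)) (h3.const_mul _)
      fun s hs => ?_
    have hs0 : 0 < s := hb.trans_le hs.1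
    have e1 : s ^ (2 * θ) = (s ^ θ) ^ 2 := by
      rw [← Real.rpow_natCast, ← Real.rpow_mul hs0.le]; congr 1; push_cast; ring
    have e2 : s ^ (-2 : ℝ) = (s⁻¹) ^ 2 := by
      rw [Real.rpow_neg hs0.le]; norm_num
    have e3 : s ^ (θ - 1) = s ^ θ * s⁻¹ := by
      rw [Real.rpow_sub hs0, Real.rpow_one]; rfl
    rw [e1, e2, e3]
    have sq : ∀ r : ℝ, 0 < r → (r ^ ((θ + 1) / 2)) ^ 2 = r ^ θ * r := by
      intro r hr
      rw [← Real.rpow_natCast, ← Real.rpow_mul hr.le,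
        show (θ + 1) / 2 * ((2 : ℕ) : ℝ) = θ + 1 by push_cast; ring, Real.rpow_add hr, Real.rpow_one]
    have hm : y ^ 2 ≤ s ^ θ * s := by
      rw [← sq s hs0]
      exact pow_le_pow_left₀ hy0.le (Real.rpow_le_rpow hb.le hs.1 (by linarith)) 2
    have hM : s ^ θ * s ≤ x ^ 2 := by
      rw [← sq s hs0]
      exact pow_le_pow_left₀ (Real.rpow_nonneg hs0.le _)
        (Real.rpow_le_rpow hs0.le hs.2 (by linarith)) 2
    have hu : s ^ θ = (s ^ θ * s) * s⁻¹ := by field_simp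
    have hi : 0 < s⁻¹ := inv_pos.mpr hs0
    set F := s ^ θ * s
    rw [hu]
    have := mul_nonneg (mul_nonneg (sub_nonneg.mpr hm) (sub_nonneg.mpr hM)) (sq_nonneg s⁻¹)
    nlinarith
  have hsq : jumpVel γ a b ^ 2 = Pd * T := Real.sq_sqrt (mul_nonneg hP0 hT0)
  have hR : 0 ≤ (x ^ 2 + y ^ 2) * L := by positivity
  refine abs_le_of_sq_le_sq' ?_ hR |>.2
  have h4 : (2 * (x * y) * jumpVel γ a b) ^ 2 = 4 * (Pd * (x ^ 2 * y ^ 2 * T)) := by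
    rw [mul_pow, hsq]; ring
  have h5 : (Pd + x ^ 2 * y ^ 2 * T) ^ 2 ≤ ((x ^ 2 + y ^ 2) * L) ^ 2 :=
    pow_le_pow_left₀ (by positivity) key 2
  rw [h4]
  nlinarith [sq_nonneg (Pd - x ^ 2 * y ^ 2 * T)]

/-- Chord of a convex power between the points 1 and 2. -/
lemma one_add_rpow_le {k e : ℝ} (hk : 1 ≤ k) (he : 0 ≤ e) (he1 : e ≤ 1) :
    (1 + e) ^ k ≤ 1 + (2 ^ k - 1) * e := by
  have h := (convexOn_rpow hk).2 (show (1 : ℝ) ∈ Set.Ici 0 by simp)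
    (show (2 : ℝ) ∈ Set.Ici 0 by simp) (show 0 ≤ 1 - e by linarith) he (by ring)
  simp only [smul_eq_mul, Real.one_rpow] at h
  have e1 : (1 - e) * 1 + e * 2 = 1 + e := by ring
  rw [e1] at h; linarith

lemma rpow_quot_le {k x y : ℝ} (hk : 1 ≤ k) (hy : 0 < y) (hxy : y ≤ x) (hx2 : x ≤ 2 * y) :
    (x / y) ^ k ≤ 1 + (2 ^ k - 1) * ((x - y) / y) := by
  have h := one_add_rpow_le hk (e := (x - y) / y) (div_nonneg (by linarith) hy.le)
    (by rw [div_le_one hy]; linarith)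
  rwa [show 1 + (x - y) / y = x / y by field_simp; ring] at h

/-- The deviation from the rarefaction curve is of third order. -/
lemma jumpVel_le {γ θ a b : ℝ} (hγ : γ = 1 + 2 * θ) (hθ : 0 < θ) (hθ1 : θ ≤ 1) (hb : 0 < b)
    (hab : b ≤ a) (h2 : a ^ θ ≤ 2 * b ^ θ) :
    jumpVel γ a b ≤ (a ^ θ - b ^ θ) / θ +
      (2 ^ ((θ + 1) / (2 * θ)) - 1) ^ 2 / (2 * θ) * ((a ^ θ - b ^ θ) ^ 3 / (b ^ θ) ^ 2) := by
  have ha : 0 < a := hb.trans_le hab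
  have hm := jumpVel_mul_le hγ hθ hb hab
  set x := a ^ θ with hx
  set y := b ^ θ with hy
  have hx0 : 0 < x := Real.rpow_pos_of_pos ha _
  have hy0 : 0 < y := Real.rpow_pos_of_pos hb _
  have hyx : y ≤ x := Real.rpow_le_rpow hb.le hab hθ.le
  -- In the variable ρ^θ the power ρ^((θ+1)/2) is the k-th power. With q = (x/y)^k the Kantorovich
  -- bound has the factor (q + 1/q)/2 = 1 + (q-1)²/(2q), and q - 1 is linear in (x-y)/y by
  -- convexity.
  set k := (θ + 1) / (2 * θ) with hk
  have hk1 : 1 ≤ k := by rw [hk, le_div_iff₀ (by linarith)]; linarith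
  have hkx : a ^ ((θ + 1) / 2) = x ^ k := by
    rw [hx, ← Real.rpow_mul ha.le]; congr 1; rw [hk]; field_simp
  have hky : b ^ ((θ + 1) / 2) = y ^ k := by
    rw [hy, ← Real.rpow_mul hb.le]; congr 1; rw [hk]; field_simp
  rw [hkx, hky] at hm
  set q := (x / y) ^ k with hq
  have hq1 : 1 ≤ q := Real.one_le_rpow (by rw [le_div_iff₀ hy0]; linarith) (by linarith)
  have hqle := rpow_quot_le hk1 hy0 hyx h2
  have hxq : x ^ k = q * y ^ k := by
    rw [hq, Real.div_rpow hx0.le hy0.le]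
    field_simp
  have hyk : 0 < y ^ k := Real.rpow_pos_of_pos hy0 _
  rw [hxq] at hm
  have hL0 : 0 ≤ (x - y) / θ := div_nonneg (by linarith) hθ.le
  have hm' : 2 * q * jumpVel γ a b ≤ (q ^ 2 + 1) * ((x - y) / θ) := by
    have : (y ^ k) ^ 2 * (2 * q * jumpVel γ a b) ≤ (y ^ k) ^ 2 * ((q ^ 2 + 1) * ((x - y) / θ)) := by
      nlinarith
    exact le_of_mul_le_mul_left this (by positivity)
  set D := (2 ^ k - 1) * ((x - y) / y) with hD
  have hD2 : (q - 1) ^ 2 ≤ D ^ 2 := pow_le_pow_left₀ (by linarith) (by linarith) 2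
  have h3 : jumpVel γ a b ≤ (x - y) / θ * (1 + D ^ 2 / 2) := by
    have h4 : (q ^ 2 + 1) * ((x - y) / θ) ≤ 2 * q * ((x - y) / θ * (1 + D ^ 2 / 2)) := by
      have : q ^ 2 + 1 ≤ 2 * q * (1 + D ^ 2 / 2) := by nlinarith [sq_nonneg D]
      nlinarith
    have : 2 * q * jumpVel γ a b ≤ 2 * q * ((x - y) / θ * (1 + D ^ 2 / 2)) := hm'.trans h4
    exact le_of_mul_le_mul_left this (by linarith)
  refine h3.trans (le_of_eq ?_)
  rw [hD]; field_simp

/-- Differences of pressure and of specific volume add up, so this is Cauchy-Schwarz in the plane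
for the vectors (√P1, √P2) and (√T1, √T2). -/
lemma jumpVel_superadditive {γ θ a b d : ℝ} (hγ : γ = 1 + 2 * θ) (hθ : 0 < θ) (hd : 0 < d)
    (hdb : d ≤ b) (hba : b ≤ a) : jumpVel γ a b + jumpVel γ b d ≤ jumpVel γ a d := by
  have hb : 0 < b := hd.trans_le hdb
  have p1 := pressure_sub_nonneg hγ hθ hb hba
  have p2 := pressure_sub_nonneg hγ hθ hd hdb
  have t1 := inv_sub_inv_nonneg hb hba
  have t2 := inv_sub_inv_nonneg hd hdb
  have e : (pressure γ a - pressure γ d) * (1 / d - 1 / a) =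
      ((pressure γ a - pressure γ b) + (pressure γ b - pressure γ d)) *
        ((1 / b - 1 / a) + (1 / d - 1 / b)) := by ring
  unfold jumpVel
  rw [e]
  set P1 := pressure γ a - pressure γ b
  set P2 := pressure γ b - pressure γ d
  set T1 := 1 / b - 1 / a
  set T2 := 1 / d - 1 / b
  rw [Real.sqrt_mul p1, Real.sqrt_mul p2]
  apply Real.le_sqrt_of_sq_le
  have := Real.sq_sqrt p1
  have := Real.sq_sqrt p2
  have := Real.sq_sqrt t1
  have := Real.sq_sqrt t2
  set x1 := √P1
  set x2 := √P2
  set y1 := √T1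
  set y2 := √T2
  have : (P1 + P2) * (T1 + T2) = (x1 ^ 2 + x2 ^ 2) * (y1 ^ 2 + y2 ^ 2) := by simp only [*]
  rw [this]
  nlinarith [sq_nonneg (x1 * y2 - x2 * y1)]

lemma shockS_of_lt {γ a d : ℝ} (h : d < a) :
    shockS γ a d = √(a * (pressure γ a - pressure γ d) / (d * (a - d))) := by
  rw [shockS, if_neg h.ne']

lemma jumpVel_eq_shockS {γ θ a d : ℝ} (hγ : γ = 1 + 2 * θ) (hθ : 0 < θ) (hd : 0 < d) (h : d < a) :
    jumpVel γ a d = shockS γ a d * ((a - d) / a) := by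
  have ha : 0 < a := hd.trans h
  have hp := pressure_sub_nonneg hγ hθ hd h.le
  have h1 : 0 ≤ (a - d) / a := div_nonneg (by linarith) ha.le
  rw [shockS_of_lt h, jumpVel]
  conv_rhs => rw [← Real.sqrt_sq h1, ← Real.sqrt_mul (div_nonneg (mul_nonneg ha.le hp)
    (mul_nonneg hd.le (by linarith)))]
  congr 1
  have : a - d ≠ 0 := by linarith
  field_simp

lemma jumpVel_eq_shockS' {γ θ a d : ℝ} (hγ : γ = 1 + 2 * θ) (hθ : 0 < θ) (hd : 0 < d) (h : d < a) :
    jumpVel γ a d = shockS γ d a * ((a - d) / d) := by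
  have ha : 0 < a := hd.trans h
  have hp := pressure_sub_nonneg hγ hθ hd h.le
  have h1 : 0 ≤ (a - d) / d := div_nonneg (by linarith) hd.le
  have h3 : d * (pressure γ d - pressure γ a) / (a * (d - a)) =
      d * (pressure γ a - pressure γ d) / (a * (a - d)) := by
    rw [show d * (pressure γ d - pressure γ a) = -(d * (pressure γ a - pressure γ d)) by ring,
      show a * (d - a) = -(a * (a - d)) by ring, neg_div_neg_eq]
  rw [shockS, if_neg h.ne, jumpVel, h3]
  conv_rhs => rw [← Real.sqrt_sq h1, ← Real.sqrt_mul (div_nonneg (mul_nonneg hd.le hp)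
    (mul_nonneg ha.le (by linarith)))]
  congr 1
  have : a - d ≠ 0 := by linarith
  field_simp

lemma le_shockS {γ θ a d : ℝ} (hγ : γ = 1 + 2 * θ) (hθ : 0 < θ) (hd : 0 < d) (h : d < a) :
    d ^ θ ≤ shockS γ a d := by
  have ha : 0 < a := hd.trans h
  rw [shockS_of_lt h]
  apply Real.le_sqrt_of_sq_le
  have := le_pressure_sub hγ hθ hd h.le
  rw [le_div_iff₀ (mul_pos hd (by linarith))]
  have h2 : 0 ≤ pressure γ a - pressure γ d := pressure_sub_nonneg hγ hθ hd h.le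
  nlinarith

/-- The Lax inequality at the state behind a compressive jump. -/
lemma shockS_lt {γ θ d a : ℝ} (hγ : γ = 1 + 2 * θ) (hθ : 0 < θ) (hd : 0 < d) (h : d < a) :
    shockS γ d a < a ^ θ := by
  have ha : 0 < a := hd.trans h
  have h3 : d * (pressure γ d - pressure γ a) / (a * (d - a)) =
      d * (pressure γ a - pressure γ d) / (a * (a - d)) := by
    rw [show d * (pressure γ d - pressure γ a) = -(d * (pressure γ a - pressure γ d)) by ring,
      show a * (d - a) = -(a * (a - d)) by ring, neg_div_neg_eq]
  have hx : 0 < a ^ θ := Real.rpow_pos_of_pos ha _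
  rw [shockS, if_neg h.ne, h3, Real.sqrt_lt' hx, div_lt_iff₀ (mul_pos ha (by linarith))]
  have := pressure_sub_le hγ hθ hd h.le
  have h4 : 0 < (a ^ θ) ^ 2 * (a - d) := mul_pos (by positivity) (by linarith)
  nlinarith

/-- Dependence of the shock strength on the state ahead of the shock, in terms of the changes of
pressure and specific volume. -/
lemma jumpVel_sub_le {γ θ a b d : ℝ} (hγ : γ = 1 + 2 * θ) (hθ : 0 < θ)
    (hd : 0 < d) (hdb : d ≤ b) (hba : b ≤ a) (hda : d < a) :
    jumpVel γ a d - jumpVel γ a b ≤ (pressure γ b - pressure γ d) / (d * shockS γ a d) +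
      shockS γ a d * d * (1 / d - 1 / b) := by
  have hb : 0 < b := hd.trans_le hdb
  have ha : 0 < a := hb.trans_le hba
  have hSpos : 0 < shockS γ a d := (Real.rpow_pos_of_pos hd θ).trans_le (le_shockS hγ hθ hd hda)
  have hJS : jumpVel γ a d = shockS γ a d * ((a - d) / a) := jumpVel_eq_shockS hγ hθ hd hda
  have hJ2 : jumpVel γ a d ^ 2 = (pressure γ a - pressure γ d) * (1 / d - 1 / a) :=
    Real.sq_sqrt (mul_nonneg (pressure_sub_nonneg hγ hθ hd hda.le) (inv_sub_inv_nonneg hd hda.le))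
  have hj2 : jumpVel γ a b ^ 2 = (pressure γ a - pressure γ b) * (1 / b - 1 / a) :=
    Real.sq_sqrt (mul_nonneg (pressure_sub_nonneg hγ hθ hb hba) (inv_sub_inv_nonneg hb hba))
  have hj0 : 0 ≤ jumpVel γ a b := jumpVel_nonneg _ _ _
  have hP10 := pressure_sub_nonneg hγ hθ hd hdb
  have hT10 := inv_sub_inv_nonneg hd hdb
  have hTpos : 0 < 1 / d - 1 / a := sub_pos.mpr (one_div_lt_one_div_of_lt hd hda)
  have e1 : pressure γ a - pressure γ b =
    (pressure γ a - pressure γ d) - (pressure γ b - pressure γ d) := by ring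
  have e2 : 1 / b - 1 / a = (1 / d - 1 / a) - (1 / d - 1 / b) := by ring
  have had : a - d ≠ 0 := by linarith
  -- The product d·S is the mass flux through the jump: it is the ratio of the pressure difference
  -- to J and of J to the difference of specific volume.
  have hTJ : 1 / d - 1 / a = jumpVel γ a d / (d * shockS γ a d) := by
    rw [hJS]; field_simp
  rw [e1, e2] at hj2
  generalize pressure γ a - pressure γ d = Pd at *
  generalize pressure γ b - pressure γ d = P1 at *
  generalize 1 / d - 1 / a = T at *
  generalize 1 / d - 1 / b = T1 at *
  generalize jumpVel γ a b = j at *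
  have hJ0 : 0 < jumpVel γ a d := by rw [hJS]; exact mul_pos hSpos (div_pos (by linarith) ha)
  clear hJS
  generalize jumpVel γ a d = J at *
  generalize shockS γ a d = S at *
  have hPJ : Pd = J * (S * d) := by
    have : Pd = J ^ 2 / T := by rw [hJ2]; field_simp
    rw [this, hTJ]; field_simp
  rcases le_or_gt J j with h | h
  · have : 0 ≤ P1 / (d * S) + S * d * T1 := by positivity
    linarith
  · have h5 : (J - j) * J ≤ (P1 / (d * S) + S * d * T1) * J := by
      have e3 : (P1 / (d * S) + S * d * T1) * J = P1 * T + Pd * T1 := by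
        rw [hPJ, hTJ]; field_simp
      rw [e3]
      -- J² - j² = Pd·T - (Pd - P1)(T - T1), where the mixed term P1·T1 has the good sign. Then
      -- divide by J + j ≥ J.
      have h6 : J ^ 2 - j ^ 2 ≤ P1 * T + Pd * T1 := by
        rw [hJ2, hj2]; nlinarith [mul_nonneg hP10 hT10]
      nlinarith [mul_nonneg hj0 (sub_pos.mpr h).le]
    exact le_of_mul_le_mul_right h5 hJ0

/-- Dependence of the shock strength on the density ahead of the shock. -/
lemma jumpVel_stability {γ θ a b d : ℝ} (hγ : γ = 1 + 2 * θ) (hθ : 0 < θ) (hθ1 : θ ≤ 1)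
    (hd : 0 < d) (hdb : d ≤ b) (hba : b ≤ a) (hda : d < a) (h2 : b ^ θ ≤ 2 * d ^ θ) :
    jumpVel γ a d ≤ jumpVel γ a b + 4 * (2 ^ (1 / θ) - 1) * (b ^ θ - d ^ θ) +
      shockS γ a d * ((2 ^ (1 / θ) - 1) * ((b ^ θ - d ^ θ) / d ^ θ)) := by
  have hb : 0 < b := hd.trans_le hdb
  have hmain := jumpVel_sub_le hγ hθ hd hdb hba hda
  have hSy : d ^ θ ≤ shockS γ a d := le_shockS hγ hθ hd hda
  have hP1le : pressure γ b - pressure γ d ≤ (b ^ θ) ^ 2 * (b - d) := pressure_sub_le hγ hθ hd hdb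
  have hP10 := pressure_sub_nonneg hγ hθ hd hdb
  have hk1 : 1 ≤ 1 / θ := by rw [le_div_iff₀ hθ]; linarith
  have hy0 : 0 < d ^ θ := Real.rpow_pos_of_pos hd _
  have hx0 : 0 < b ^ θ := Real.rpow_pos_of_pos hb _
  have hyx : d ^ θ ≤ b ^ θ := Real.rpow_le_rpow hd.le hdb hθ.le
  -- A relative change of density is controlled by the relative change of ρ^θ, because ρ is its
  -- power 1/θ ≥ 1.
  have hbd : (b - d) / d ≤ (2 ^ (1 / θ) - 1) * ((b ^ θ - d ^ θ) / d ^ θ) := by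
    have hq := rpow_quot_le hk1 hy0 hyx h2
    have : (b ^ θ / d ^ θ) ^ (1 / θ) = b / d := by
      rw [← Real.div_rpow hb.le hd.le, ← Real.rpow_mul (div_pos hb hd).le]
      rw [mul_one_div_cancel hθ.ne', Real.rpow_one]
    rw [this] at hq
    have : b / d = 1 + (b - d) / d := by field_simp; ring
    linarith
  have hN0 : 0 ≤ (2 : ℝ) ^ (1 / θ) - 1 := by
    have : (1 : ℝ) ≤ 2 ^ (1 / θ) := Real.one_le_rpow (by norm_num) (by linarith)
    linarith
  generalize (2 : ℝ) ^ (1 / θ) - 1 = N at *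
  generalize b ^ θ = x at *
  generalize d ^ θ = y at *
  generalize shockS γ a d = S at *
  generalize pressure γ b - pressure γ d = P1 at *
  have hSpos : 0 < S := hy0.trans_le hSy
  have hA : P1 / (d * S) ≤ 4 * N * (x - y) := by
    have h6 : P1 / (d * S) ≤ x ^ 2 * ((b - d) / d) / y := by
      rw [div_le_iff₀ (by positivity)]
      have : x ^ 2 * ((b - d) / d) / y * (d * S) = x ^ 2 * (b - d) * (S / y) := by field_simp
      rw [this]
      have h7 : 1 ≤ S / y := by rw [le_div_iff₀ hy0]; linarith
      have h8 : 0 ≤ x ^ 2 * (b - d) := mul_nonneg (by positivity) (by linarith)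
      nlinarith
    have h9 : x ^ 2 * ((b - d) / d) / y ≤ (2 * y) ^ 2 * (N * ((x - y) / y)) / y := by
      have h10 : 0 ≤ (b - d) / d := div_nonneg (by linarith) hd.le
      have h11 : x ^ 2 ≤ (2 * y) ^ 2 := pow_le_pow_left₀ hx0.le h2 2
      exact div_le_div_of_nonneg_right (mul_le_mul h11 hbd h10 (by positivity)) hy0.le
    refine h6.trans (h9.trans (le_of_eq ?_))
    field_simp; ring
  have hB : S * d * (1 / d - 1 / b) ≤ S * (N * ((x - y) / y)) := by
    have : S * d * (1 / d - 1 / b) = S * ((b - d) / b) := by field_simp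
    rw [this]
    have : (b - d) / b ≤ (b - d) / d := div_le_div_of_nonneg_left (by linarith) hd hdb
    exact mul_le_mul_of_nonneg_left (this.trans hbd) hSpos.le
  linarith

lemma jumpVel_anti_right {γ θ a b d : ℝ} (hγ : γ = 1 + 2 * θ) (hθ : 0 < θ)
    (hd : 0 < d) (hdb : d ≤ b) (hba : b ≤ a) : jumpVel γ a b ≤ jumpVel γ a d := by
  have := jumpVel_superadditive hγ hθ hd hdb hba
  linarith [jumpVel_nonneg γ b d]

/-! ### Jumps of the first family -/

/-- Conservation of mass in the frame of the jump. With the formula for s in `OneJump` it determines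
the velocity, so the momentum equation is not needed. -/
lemma OneJump.momentum {γ s : ℝ} {ul ur : State} (h : OneJump γ s ul ur) :
    ur.1 * (vel ur - vel ul) = -(vel ul - s) * (ur.1 - ul.1) := by
  obtain ⟨hl, hr, hRH, -⟩ := h
  have h1 : ur.2 - ul.2 = s * (ur.1 - ul.1) := by
    have := congrArg Prod.fst hRH
    simpa [flux] using this
  have el : ul.2 = ul.1 * vel ul := by unfold vel; field_simp
  have er : ur.2 = ur.1 * vel ur := by unfold vel; field_simp
  rw [el, er] at h1
  linarith

lemma OneJump.vel_of_le {γ θ s : ℝ} {ul ur : State} (hγ : γ = 1 + 2 * θ) (hθ : 0 < θ)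
    (h : OneJump γ s ul ur) (hle : ul.1 ≤ ur.1) :
    vel ur = vel ul - jumpVel γ ur.1 ul.1 := by
  have hm := h.momentum
  obtain ⟨hl, hr, hRH, hs⟩ := h
  rcases hle.eq_or_lt with he | hlt
  · have : jumpVel γ ur.1 ul.1 = 0 := by simp [jumpVel, he]
    rw [this]
    have : ur.1 * (vel ur - vel ul) = 0 := by rw [hm, he]; ring
    rcases mul_eq_zero.mp this with h | h <;> linarith
  · rw [jumpVel_eq_shockS hγ hθ hl hlt]
    have hS : vel ul - s = shockS γ ur.1 ul.1 := by rw [hs]; ring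
    rw [hS] at hm
    field_simp
    linarith

lemma OneJump.vel_of_ge {γ θ s : ℝ} {ul ur : State} (hγ : γ = 1 + 2 * θ) (hθ : 0 < θ)
    (h : OneJump γ s ul ur) (hle : ur.1 ≤ ul.1) :
    vel ur = vel ul + jumpVel γ ul.1 ur.1 := by
  have hm := h.momentum
  rcases hle.eq_or_lt with he | hlt
  · have h1 := h.vel_of_le hγ hθ he.ge
    have : jumpVel γ ul.1 ur.1 = 0 := by simp [jumpVel, he]
    have h2 : jumpVel γ ur.1 ul.1 = 0 := by simp [jumpVel, he]
    linarith
  · obtain ⟨hl, hr, hRH, hs⟩ := h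
    rw [jumpVel_eq_shockS' hγ hθ hr hlt]
    have hS : vel ul - s = shockS γ ur.1 ul.1 := by rw [hs]; ring
    rw [hS] at hm
    field_simp
    linarith

/-- Lax: the speed of a compressive 1-jump exceeds the characteristic speed behind it. -/
lemma OneJump.lam1_lt {γ θ s : ℝ} {ul ur : State} (hγ : γ = 1 + 2 * θ) (hθ : 0 < θ)
    (h : OneJump γ s ul ur) (hlt : ul.1 < ur.1) : lam1 θ ur < s := by
  have h1 := h.vel_of_le hγ hθ hlt.le
  have hm := h.momentum
  obtain ⟨hl, hr, hRH, hs⟩ := h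
  rw [jumpVel_eq_shockS' hγ hθ hl hlt] at h1
  have h2 := shockS_lt hγ hθ hl hlt
  -- The mass balance seen from the right state: s is also v_r - S(ρ_l, ρ_r), and this S is less
  -- than ρ_r^θ.
  have hm2 : ul.1 * (vel ur - vel ul) = -(vel ur - s) * (ur.1 - ul.1) := by nlinarith
  have h3 : vel ur - s = shockS γ ul.1 ur.1 := by
    have e : ul.1 * (vel ur - vel ul) = -shockS γ ul.1 ur.1 * (ur.1 - ul.1) := by
      rw [h1]; field_simp; ring
    have h4 : (vel ur - s - shockS γ ul.1 ur.1) * (ur.1 - ul.1) = 0 := by nlinarith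
    rcases mul_eq_zero.mp h4 with h5 | h5 <;> linarith
  unfold lam1
  linarith

/-! ### States and Riemann invariants -/

/-- Nonnegative density, and no momentum in the vacuum. -/
def Physical (u : State) : Prop := 0 ≤ u.1 ∧ (u.1 = 0 → u.2 = 0)

lemma ofZW_fst_pos {θ z w : ℝ} (hθ : 0 < θ) (h : z < w) : 0 < (ofZW θ z w).1 :=
  Real.rpow_pos_of_pos (by have := mul_pos hθ (sub_pos.mpr h); linarith) _

lemma ofZW_rpow {θ z w : ℝ} (hθ : 0 < θ) (h : z < w) :
    (ofZW θ z w).1 ^ θ = θ * (w - z) / 2 := by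
  have : 0 ≤ θ * (w - z) / 2 := by have := mul_pos hθ (sub_pos.mpr h); linarith
  simp only [ofZW]
  rw [← Real.rpow_mul this, one_div_mul_cancel hθ.ne', Real.rpow_one]

lemma vel_ofZW_of_pos {θ z w : ℝ} (h : 0 < (ofZW θ z w).1) : vel (ofZW θ z w) = (w + z) / 2 := by
  simp only [vel, ofZW] at *
  rw [mul_div_cancel_left₀ _ h.ne']

lemma vel_ofZW {θ z w : ℝ} (hθ : 0 < θ) (h : z < w) : vel (ofZW θ z w) = (w + z) / 2 :=
  vel_ofZW_of_pos (ofZW_fst_pos hθ h)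

lemma zInv_ofZW {θ z w : ℝ} (hθ : 0 < θ) (h : z < w) : zInv θ (ofZW θ z w) = z := by
  rw [zInv, vel_ofZW hθ h, ofZW_rpow hθ h]; field_simp; ring

lemma wInv_ofZW {θ z w : ℝ} (hθ : 0 < θ) (h : z < w) : wInv θ (ofZW θ z w) = w := by
  rw [wInv, vel_ofZW hθ h, ofZW_rpow hθ h]; field_simp; ring

/-- Here z > w is allowed. The power of a negative base has no meaning as a density, but it may be
positive, and it is bounded by the power of the modulus. -/
lemma ofZW_rpow_le {θ z w : ℝ} (hθ : 0 < θ) (h : 0 < (ofZW θ z w).1) :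
    (ofZW θ z w).1 ^ θ ≤ θ * |w - z| / 2 := by
  have h1 : (ofZW θ z w).1 ≤ |θ * (w - z) / 2| ^ (1 / θ) :=
    (le_abs_self _).trans (Real.abs_rpow_le_abs_rpow _ _)
  have h2 := Real.rpow_le_rpow h.le h1 hθ.le
  rw [← Real.rpow_mul (abs_nonneg _), one_div_mul_cancel hθ.ne', Real.rpow_one] at h2
  rwa [abs_div, abs_mul, abs_of_pos hθ, abs_two] at h2

lemma vel_eq (θ : ℝ) (u : State) : vel u = (wInv θ u + zInv θ u) / 2 := by
  simp only [wInv, zInv]; ring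

lemma rpow_eq {θ : ℝ} (hθ : θ ≠ 0) (u : State) : u.1 ^ θ = θ * (wInv θ u - zInv θ u) / 2 := by
  simp only [wInv, zInv]; field_simp; ring

lemma zInv_lt_wInv {θ : ℝ} (hθ : 0 < θ) {u : State} (h : 0 < u.1) : zInv θ u < wInv θ u := by
  have := div_pos (Real.rpow_pos_of_pos h θ) hθ
  simp only [wInv, zInv]; linarith

lemma ofZW_physical {θ z w : ℝ} (hθ : 0 < θ) (h : z < w) : Physical (ofZW θ z w) :=
  ⟨(ofZW_fst_pos hθ h).le, fun h0 => absurd h0 (ofZW_fst_pos hθ h).ne'⟩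

@[simp] lemma flipState_fst (u : State) : (flipState u).1 = u.1 := rfl

@[simp] lemma flipState_flipState (u : State) : flipState (flipState u) = u := by
  simp [flipState]

@[simp] lemma vel_flipState (u : State) : vel (flipState u) = -vel u := by
  simp [vel, flipState, neg_div]

@[simp] lemma zInv_flipState (θ : ℝ) (u : State) : zInv θ (flipState u) = -wInv θ u := by
  simp [zInv, wInv]; ring

@[simp] lemma wInv_flipState (θ : ℝ) (u : State) : wInv θ (flipState u) = -zInv θ u := by
  simp [zInv, wInv]; ring

lemma flipState_physical {u : State} (h : Physical u) : Physical (flipState u) :=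
  ⟨h.1, fun h0 => by have := h.2 h0; simp [flipState, this]⟩

/-! ### Limits from the left in time -/

/-- The Riemann invariants of `f` have left limits at `T`, the one of `z` at least `lo` and the one
of `w` at most `hi`, and `f` is physical near `T`. -/
def LeftLimitIn (θ T lo hi : ℝ) (f : ℝ → State) : Prop :=
  (∃ zl wl : ℝ, Tendsto (fun τ => zInv θ (f τ)) (𝓝[<] T) (𝓝 zl) ∧
    Tendsto (fun τ => wInv θ (f τ)) (𝓝[<] T) (𝓝 wl) ∧ lo ≤ zl ∧ wl ≤ hi) ∧
  ∀ᶠ τ in 𝓝[<] T, Physical (f τ)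

lemma LeftLimitIn.mono {θ T lo hi lo' hi' : ℝ} {f : ℝ → State} (h : LeftLimitIn θ T lo hi f)
    (hlo : lo' ≤ lo) (hhi : hi ≤ hi') : LeftLimitIn θ T lo' hi' f := by
  obtain ⟨⟨zl, wl, h1, h2, h3, h4⟩, h5⟩ := h
  exact ⟨⟨zl, wl, h1, h2, hlo.trans h3, h4.trans hhi⟩, h5⟩

lemma LeftLimitIn.congr {θ T lo hi : ℝ} {f g : ℝ → State} (h : LeftLimitIn θ T lo hi f)
    (hfg : ∀ᶠ τ in 𝓝[<] T, g τ = f τ) : LeftLimitIn θ T lo hi g := by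
  obtain ⟨⟨zl, wl, h1, h2, h3, h4⟩, h5⟩ := h
  refine ⟨⟨zl, wl, h1.congr' ?_, h2.congr' ?_, h3, h4⟩, ?_⟩
  · filter_upwards [hfg] with τ hτ; rw [hτ]
  · filter_upwards [hfg] with τ hτ; rw [hτ]
  · filter_upwards [hfg, h5] with τ hτ h; rwa [hτ]

lemma LeftLimitIn.flip {θ T lo hi : ℝ} {f : ℝ → State} (h : LeftLimitIn θ T lo hi f) :
    LeftLimitIn θ T (-hi) (-lo) (fun τ => flipState (f τ)) := by
  obtain ⟨⟨zl, wl, h1, h2, h3, h4⟩, h5⟩ := h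
  refine ⟨⟨-wl, -zl, ?_, ?_, by linarith, by linarith⟩, ?_⟩
  · simpa using h2.neg
  · simpa using h1.neg
  · filter_upwards [h5] with τ hτ using flipState_physical hτ

lemma LeftLimitIn.const {θ T lo hi : ℝ} {u : State} (hu : Physical u) (h1 : lo ≤ zInv θ u)
    (h2 : wInv θ u ≤ hi) : LeftLimitIn θ T lo hi (fun _ => u) :=
  ⟨⟨_, _, tendsto_const_nhds, tendsto_const_nhds, h1, h2⟩, Eventually.of_forall fun _ => hu⟩

lemma LeftLimitIn.ofZW {θ T lo hi zl wl : ℝ} (hθ : 0 < θ) {zf wf : ℝ → ℝ}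
    (hz : Tendsto zf (𝓝[<] T) (𝓝 zl)) (hw : Tendsto wf (𝓝[<] T) (𝓝 wl))
    (hlt : ∀ᶠ τ in 𝓝[<] T, zf τ < wf τ) (h1 : lo ≤ zl) (h2 : wl ≤ hi) :
    LeftLimitIn θ T lo hi (fun τ => ofZW θ (zf τ) (wf τ)) := by
  refine ⟨⟨zl, wl, hz.congr' ?_, hw.congr' ?_, h1, h2⟩, ?_⟩
  · filter_upwards [hlt] with τ h; rw [zInv_ofZW hθ h]
  · filter_upwards [hlt] with τ h; rw [wInv_ofZW hθ h]
  · filter_upwards [hlt] with τ h using ofZW_physical hθ h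

lemma eventually_mem_Ioo {T : ℝ} (hT : 0 < T) : ∀ᶠ τ in 𝓝[<] T, 0 < τ ∧ τ < T := by
  filter_upwards [Ioo_mem_nhdsLT hT] with τ hτ using hτ

/-! ### The algebra of the fractional step -/

/-- The denominator of μ contains 1 + θ - 2√θ = (1 - √θ)², which cancels against (1 - θ)². -/
lemma muConst_mul {θ : ℝ} (h0 : 0 < θ) (h1 : θ < 1) : muConst θ * θ = (1 + √θ) ^ 2 := by
  have hs := Real.sq_sqrt h0.le
  have hs0 : 0 < √θ := Real.sqrt_pos.mpr h0
  have hs1 : √θ < 1 := by rw [Real.sqrt_lt' one_pos]; linarith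
  unfold muConst
  set s := √θ
  rw [← hs]
  have h2 : 1 + s ^ 2 - 2 * s = (1 - s) ^ 2 := by ring
  have h3 : (1 - s) ≠ 0 := by linarith
  rw [h2]
  field_simp
  ring

lemma muConst_nonneg {θ : ℝ} (h0 : 0 < θ) (h1 : θ < 1) : 0 ≤ muConst θ := by
  have := muConst_mul h0 h1
  by_contra h
  push Not at h
  nlinarith [sq_nonneg (1 + √θ)]

/-- This form of σ is the one met in `source_le`: 1/σ is the largest ratio -z/w for which the
difference of squares there is nonnegative. -/
lemma sigmaConst_eq {θ : ℝ} (h0 : 0 < θ) (h1 : θ < 1) :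
    0 < 2 * √(θ + 1) + √θ - 1 ∧ sigmaConst θ * (2 * √(θ + 1) + √θ - 1) = 1 + √θ := by
  have hs := Real.sq_sqrt h0.le
  have hs0 : 0 < √θ := Real.sqrt_pos.mpr h0
  have hs1 : √θ < 1 := by rw [Real.sqrt_lt' one_pos]; linarith
  have hR : 1 ≤ √(θ + 1) := by rw [Real.one_le_sqrt]; linarith
  have hpos : 0 < 2 * √(θ + 1) + √θ - 1 := by linarith
  refine ⟨hpos, ?_⟩
  unfold sigmaConst
  have h3 : (1 - √θ) ≠ 0 := by linarith
  field_simp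
  nlinarith

lemma sigmaConst_pos {θ : ℝ} (h0 : 0 < θ) (h1 : θ < 1) : 0 < sigmaConst θ := by
  obtain ⟨h2, h3⟩ := sigmaConst_eq h0 h1
  have := Real.sqrt_nonneg θ
  by_contra h
  push Not at h
  nlinarith

/-- The inequality that makes the upper bound of `w` invariant under the source term. -/
lemma source_le {θ w z : ℝ} (h0 : 0 < θ) (h1 : θ < 1) (hw : 0 ≤ w) (hz : -z * sigmaConst θ ≤ w) :
    muConst θ * |(w + z) / 2| * (θ * (w - z) / 2) ≤
      ((w + z) / 2 + θ * (w - z) / 2) * w := by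
  obtain ⟨h2, h3⟩ := sigmaConst_eq h0 h1
  have hmu := muConst_mul h0 h1
  have hs := Real.sq_sqrt h0.le
  have hR := Real.sq_sqrt (show 0 ≤ θ + 1 by linarith)
  have hs0 : 0 ≤ √θ := Real.sqrt_nonneg θ
  have hR0 : 0 ≤ √(θ + 1) := Real.sqrt_nonneg _
  have e : muConst θ * |(w + z) / 2| * (θ * (w - z) / 2) =
      (muConst θ * θ) * |(w + z) / 2| * ((w - z) / 2) := by ring
  have hY : -z * (1 + √θ) ≤ w * (2 * √(θ + 1) + √θ - 1) := by
    rw [← h3]; nlinarith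
  rw [e, hmu]
  generalize √(θ + 1) = R at *
  generalize √θ = s at *
  subst hs
  rcases le_or_gt 0 (w + z) with h | h
  · rw [abs_of_nonneg (by linarith)]
    -- Four times the difference of the two sides is exactly this square.
    nlinarith [sq_nonneg ((1 + s) * z + (1 - s) * w)]
  · rw [abs_of_neg (by linarith)]
    -- Four times the difference of the two sides is 4(1+s²)w² - (-z(1+s) + (1-s)w)², with R² = 1 +
    -- s². It factors into the terms of `h5` and `h6`, and `h5` is the hypothesis on σ.
    have h5 : 0 ≤ 2 * R * w - (-z * (1 + s) + (1 - s) * w) := by nlinarith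
    have h7 : 0 ≤ R * w := mul_nonneg hR0 hw
    have h6 : 0 ≤ 2 * R * w + (-z * (1 + s) + (1 - s) * w) := by nlinarith
    have h8 := mul_nonneg h5 h6
    have h9 : (2 * R * w) ^ 2 = 4 * (s ^ 2 + 1) * w ^ 2 := by rw [← hR]; ring
    nlinarith

/-- The source term in terms of the Riemann invariants. -/
def source (θ a b z w : ℝ) : ℝ :=
  a * ((w + z) / 2) * (θ * (w - z) / 2) - b * ((w + z) / 2 + θ * (w - z) / 2) * w

/-- A Lipschitz constant for the fractional step. -/
def stepConst (θ b₁ G W₀ : ℝ) : ℝ :=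
  b₁ * (muConst θ + 2) * G ^ 2 / W₀ + b₁ * (muConst θ + 1) * G * (1 / sigmaConst θ + 1)

lemma abs_source_le {θ a b b₁ z w G : ℝ} (h0 : 0 < θ) (h1 : θ < 1) (hb : 0 ≤ b) (hb₁ : b ≤ b₁)
    (ha : |a| ≤ muConst θ * b) (hz : |z| ≤ G) (hw : |w| ≤ G) :
    |source θ a b z w| ≤ b₁ * (muConst θ + 2) * G ^ 2 := by
  have hmu := muConst_nonneg h0 h1
  have hG : 0 ≤ G := (abs_nonneg z).trans hz
  have hv : |(w + z) / 2| ≤ G := by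
    rw [abs_le] at *; constructor <;> linarith [hz.1, hz.2, hw.1, hw.2]
  have hc : |θ * (w - z) / 2| ≤ G := by
    have h2 : |(w - z) / 2| ≤ G := by
      rw [abs_le] at *; constructor <;> linarith [hz.1, hz.2, hw.1, hw.2]
    rw [mul_div_assoc, abs_mul, abs_of_pos h0]
    nlinarith [abs_nonneg ((w - z) / 2)]
  have hvc : |(w + z) / 2 + θ * (w - z) / 2| ≤ 2 * G := (abs_add_le _ _).trans (by linarith)
  unfold source
  calc _ ≤ |a * ((w + z) / 2) * (θ * (w - z) / 2)| +
        |b * ((w + z) / 2 + θ * (w - z) / 2) * w| := abs_sub _ _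
    _ = |a| * |(w + z) / 2| * |θ * (w - z) / 2| +
        b * |(w + z) / 2 + θ * (w - z) / 2| * |w| := by
      rw [abs_mul, abs_mul, abs_mul, abs_mul, abs_of_nonneg hb]
    _ ≤ (muConst θ * b) * G * G + b * (2 * G) * G := by gcongr
    _ = b * ((muConst θ + 2) * G ^ 2) := by ring
    _ ≤ b₁ * ((muConst θ + 2) * G ^ 2) := by gcongr
    _ = _ := by ring

/-- The growth of w is at most proportional to its distance from the bound W, plus the error η. Thus
a short time step cannot carry w past W by more than O(η), although the source may be positive
inside the region. -/
lemma source_upper {θ a b b₁ z w G W W₀ Z η : ℝ} (h0 : 0 < θ) (h1 : θ < 1) (hb : 0 ≤ b)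
    (hb₁ : b ≤ b₁) (ha : |a| ≤ muConst θ * b) (hz : |z| ≤ G) (hw : |w| ≤ G) (hzw : z ≤ w)
    (hW₀ : 0 < W₀) (hW : W₀ ≤ W) (hZ : -Z * sigmaConst θ ≤ W) (hη : 0 ≤ η) (hzZ : Z - η ≤ z) :
    source θ a b z w ≤ stepConst θ b₁ G W₀ * (max (W - w) 0 + η) := by
  have hmu := muConst_nonneg h0 h1
  have hσ := sigmaConst_pos h0 h1
  have hG : 0 ≤ G := (abs_nonneg z).trans hz
  have hb₁0 : 0 ≤ b₁ := hb.trans hb₁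
  have hm0 : 0 ≤ max (W - w) 0 := le_max_right _ _
  have hk1 : 0 ≤ b₁ * (muConst θ + 2) * G ^ 2 / W₀ := by positivity
  have hk2 : 0 ≤ b₁ * (muConst θ + 1) * G * (1 / sigmaConst θ + 1) := by positivity
  unfold stepConst
  rcases lt_or_ge w 0 with hw0 | hw0
  -- For w < 0 the distance to the bound is at least W₀, so the crude bound of the source suffices.
  · have h2 : W₀ ≤ max (W - w) 0 := le_max_of_le_left (by linarith)
    have h3 := (le_abs_self _).trans (abs_source_le h0 h1 hb hb₁ ha hz hw)
    have h4 : b₁ * (muConst θ + 2) * G ^ 2 = b₁ * (muConst θ + 2) * G ^ 2 / W₀ * W₀ := by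
      field_simp
    rw [h4] at h3
    nlinarith [mul_le_mul_of_nonneg_left h2 hk1, mul_nonneg hk1 hη,
      mul_nonneg hk2 (add_nonneg hm0 hη)]
  · have base : ∀ y, -y * sigmaConst θ ≤ w → y ≤ w → source θ a b y w ≤ 0 := by
      intro y hy hyw
      have h2 := source_le h0 h1 hw0 hy
      have h3 : a * ((w + y) / 2) * (θ * (w - y) / 2) ≤
          muConst θ * b * |(w + y) / 2| * (θ * (w - y) / 2) := by
        have h4 : 0 ≤ θ * (w - y) / 2 := by
          have := mul_nonneg h0.le (sub_nonneg.mpr hyw); linarith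
        refine mul_le_mul_of_nonneg_right ?_ h4
        calc a * ((w + y) / 2) ≤ |a * ((w + y) / 2)| := le_abs_self _
          _ = |a| * |(w + y) / 2| := abs_mul _ _
          _ ≤ _ := by gcongr
      unfold source
      nlinarith [mul_le_mul_of_nonneg_left h2 hb]
    have hnn : 0 ≤ (b₁ * (muConst θ + 2) * G ^ 2 / W₀ +
        b₁ * (muConst θ + 1) * G * (1 / sigmaConst θ + 1)) * (max (W - w) 0 + η) := by positivity
    -- If z is too negative for the sign condition, compare with the critical value y = -w/σ. The
    -- source is nonpositive there and Lipschitz in z, and y - z is controlled because the bounds Z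
    -- and W satisfy the sign condition.
    rcases le_or_gt (-z * sigmaConst θ) w with h | h
    · exact (base z h hzw).trans hnn
    · set y := -(w / sigmaConst θ) with hy
      have hzy : z ≤ y := by
        rw [hy, le_neg, div_le_iff₀ hσ]; linarith
      have hy0 : y ≤ 0 := by rw [hy]; have := div_nonneg hw0 hσ.le; linarith
      have hb0 : source θ a b y w ≤ 0 := by
        refine base y ?_ (hy0.trans hw0)
        rw [hy, neg_neg, div_mul_cancel₀ _ hσ.ne']
      have hdiff : y - z ≤ max (W - w) 0 * (1 / sigmaConst θ) + η := by
        have h5 : -Z ≤ W / sigmaConst θ := by rw [le_div_iff₀ hσ]; exact hZ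
        have h6 : (W - w) / sigmaConst θ ≤ max (W - w) 0 * (1 / sigmaConst θ) := by
          rw [mul_one_div]; gcongr; exact le_max_left _ _
        have h7 : (W - w) / sigmaConst θ = W / sigmaConst θ - w / sigmaConst θ := sub_div _ _ _
        linarith
      have hlip : source θ a b z w - source θ a b y w ≤ b₁ * (muConst θ + 1) * G * (y - z) := by
        have e : source θ a b z w - source θ a b y w =
            (a * θ * (y + z) / 4 + b * (1 - θ) / 2 * w) * (y - z) := by
          unfold source; ring
        rw [e]
        refine mul_le_mul_of_nonneg_right ?_ (sub_nonneg.mpr hzy)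
        have h8 : a * θ * (y + z) / 4 ≤ muConst θ * b₁ * G := by
          have h9 : |y + z| ≤ 2 * G := by
            rw [abs_le] at *; constructor <;> linarith [hz.1]
          calc a * θ * (y + z) / 4 ≤ |a * θ * (y + z) / 4| := le_abs_self _
            _ = |a| * θ * |y + z| / 4 := by
              rw [abs_div, abs_mul, abs_mul, abs_of_pos h0]; norm_num
            _ ≤ (muConst θ * b₁) * 1 * (2 * G) / 4 := by
              have : |a| ≤ muConst θ * b₁ := ha.trans (by gcongr)
              gcongr
            _ ≤ _ := by nlinarith [mul_nonneg (mul_nonneg hmu hb₁0) hG]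
        have h10 : b * (1 - θ) / 2 * w ≤ b₁ * G := by
          have h11 : w ≤ G := (le_abs_self w).trans hw
          have h12 : b * (1 - θ) / 2 ≤ b₁ := by nlinarith
          have h13 : 0 ≤ b * (1 - θ) / 2 := by
            have := mul_nonneg hb (sub_nonneg.mpr h1.le); linarith
          exact mul_le_mul h12 h11 hw0 hb₁0
        linarith
      have h14 : b₁ * (muConst θ + 1) * G * (y - z) ≤
          b₁ * (muConst θ + 1) * G * (1 / sigmaConst θ + 1) * (max (W - w) 0 + η) := by
        have h15 : y - z ≤ (1 / sigmaConst θ + 1) * (max (W - w) 0 + η) := by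
          have : 0 ≤ 1 / sigmaConst θ := by positivity
          have h16 := mul_nonneg this hη
          have e : (1 / sigmaConst θ + 1) * (max (W - w) 0 + η) =
            max (W - w) 0 * (1 / sigmaConst θ) + η + (1 / sigmaConst θ * η + max (W - w) 0) := by
            ring
          rw [e]; linarith
        rw [mul_assoc (b₁ * (muConst θ + 1) * G)]
        exact mul_le_mul_of_nonneg_left h15 (by positivity)
      rw [add_mul]
      linarith [mul_nonneg hk1 (add_nonneg hm0 hη)]

/-- Since τ times the Lipschitz constant is at most 1, the step uses up at most the room left below
W, plus η. The excess η at the start adds to this. -/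
lemma upper_step {θ a b b₁ z w G W W₀ Z η τ : ℝ} (h0 : 0 < θ) (h1 : θ < 1) (hb : 0 ≤ b)
    (hb₁ : b ≤ b₁) (ha : |a| ≤ muConst θ * b) (hz : |z| ≤ G) (hw : |w| ≤ G) (hzw : z ≤ w)
    (hW₀ : 0 < W₀) (hW : W₀ ≤ W) (hZ : -Z * sigmaConst θ ≤ W) (hη : 0 ≤ η) (hzZ : Z - η ≤ z)
    (hwW : w ≤ W + η) (hτ : 0 ≤ τ) (hτ1 : τ * stepConst θ b₁ G W₀ ≤ 1) :
    w + source θ a b z w * τ ≤ W + 2 * η := by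
  have h := source_upper h0 h1 hb hb₁ ha hz hw hzw hW₀ hW hZ hη hzZ
  have h2 : source θ a b z w * τ ≤ max (W - w) 0 + η := by
    have hm : 0 ≤ max (W - w) 0 + η := add_nonneg (le_max_right _ _) hη
    calc source θ a b z w * τ ≤ (stepConst θ b₁ G W₀ * (max (W - w) 0 + η)) * τ :=
          mul_le_mul_of_nonneg_right h hτ
      _ = (τ * stepConst θ b₁ G W₀) * (max (W - w) 0 + η) := by ring
      _ ≤ 1 * (max (W - w) 0 + η) := mul_le_mul_of_nonneg_right hτ1 hm
      _ = _ := one_mul _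
  rcases le_total (W - w) 0 with h3 | h3
  · rw [max_eq_right h3] at h2; linarith
  · rw [max_eq_left h3] at h2; linarith

/-! ### The regime of small mesh lengths and the fractional step. -/

namespace Scheme

/-- `∫_0^x b`. -/
def cumul (P : Scheme) (x : ℝ) : ℝ := ∫ y in (0 : ℝ)..x, P.b y

/-- The lower bound `-M exp(-∫_0^x b)` of `z`. -/
def lower (P : Scheme) (x : ℝ) : ℝ := -P.M * exp (-P.cumul x)

/-- The upper bound `M exp(∫_0^x b)` of `w`. -/
def upper (P : Scheme) (x : ℝ) : ℝ := P.M * exp (P.cumul x)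

/-- The size `dx^(1 + β/3)` of the errors. -/
def errSize (P : Scheme) : ℝ := P.dx ^ (1 + P.β / 3)

end Scheme

/-- A bound for the Riemann invariants. -/
def invBound (M B : ℝ) : ℝ := (M + 1) * exp B

/-- The hypotheses on the data of the scheme, with the mesh size small in terms of `K`. -/
structure Regime (γ M B b₁ K : ℝ) (P : Scheme) : Prop where
  γ_eq : P.γ = γ
  M_eq : P.M = M
  one_lt_γ : 1 < γ
  γ_le : γ ≤ 5 / 3
  M_pos : 0 < M
  b_cont : Continuous P.b
  b_nonneg : ∀ x, 0 ≤ P.b x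
  b_le : ∀ x, P.b x ≤ b₁
  a_le : ∀ x, |P.a x| ≤ muConst P.θ * P.b x
  mass : ∀ x, |P.cumul x| ≤ B
  sigma : exp (2 * B) * sigmaConst P.θ ≤ 1
  dx_pos : 0 < P.dx
  dt_pos : 0 < P.dt
  cfl : P.dx = P.dt * (2 * M * exp B)
  α_gt : 1 / 2 + P.β / 2 < P.α
  α_lt : P.α < 1
  β_pos : 0 < P.β
  β_lt : P.β < 1 / 5
  δ_pos : 0 < P.δ
  one_le_K : 1 ≤ K
  dx_le : P.dx ≤ 1
  -- Every smallness requirement compares two powers of dx through one constant K. Each later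
  -- estimate only asks that K exceed its own threshold, and the thresholds do not depend on the
  -- mesh or on the solution.
  small_dx : K * P.dx ≤ P.dx ^ P.α
  small_sqrt : K * P.dx ^ (1 / 2 : ℝ) ≤ P.dx ^ (P.δ * P.θ)
  small_α : K * P.dx ^ P.α ≤ P.dx ^ (P.β * P.θ)
  small_sqrt' : K * P.dx ^ (1 / 2 : ℝ) ≤ P.dx ^ (P.β * P.θ)
  small_δ : K * P.dx ^ (P.δ * P.θ) ≤ 1
  small_β : K * P.dx ^ (P.β * P.θ) ≤ 1

namespace Regime

variable {γ M B b₁ K : ℝ} {P : Scheme}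

lemma mono {K' : ℝ} (h : Regime γ M B b₁ K P) (h1 : 1 ≤ K') (hK : K' ≤ K) :
    Regime γ M B b₁ K' P := by
  have hd := h.dx_pos
  exact { h with
    one_le_K := h1
    small_dx := (mul_le_mul_of_nonneg_right hK hd.le).trans h.small_dx
    small_sqrt := (mul_le_mul_of_nonneg_right hK (Real.rpow_pos_of_pos hd _).le).trans h.small_sqrt
    small_α := (mul_le_mul_of_nonneg_right hK (Real.rpow_pos_of_pos hd _).le).trans h.small_α
    small_sqrt' := (mul_le_mul_of_nonneg_right hK (Real.rpow_pos_of_pos hd _).le).trans h.small_sqrt'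
    small_δ := (mul_le_mul_of_nonneg_right hK (Real.rpow_pos_of_pos hd _).le).trans h.small_δ
    small_β := (mul_le_mul_of_nonneg_right hK (Real.rpow_pos_of_pos hd _).le).trans h.small_β }

lemma cumul_flip (P : Scheme) (x : ℝ) : P.flip.cumul x = -P.cumul (-x) := by
  simp only [Scheme.cumul, Scheme.flip]
  rw [intervalIntegral.integral_comp_neg (fun y => P.b y), neg_zero,
    intervalIntegral.integral_symm]

lemma lower_flip (P : Scheme) (x : ℝ) : P.flip.lower x = -P.upper (-x) := by
  simp only [Scheme.lower, Scheme.upper, cumul_flip, neg_neg]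
  simp [Scheme.flip]

lemma upper_flip (P : Scheme) (x : ℝ) : P.flip.upper x = -P.lower (-x) := by
  simp only [Scheme.lower, Scheme.upper, cumul_flip]
  simp [Scheme.flip]

lemma flip (h : Regime γ M B b₁ K P) : Regime γ M B b₁ K P.flip where
  γ_eq := h.γ_eq
  M_eq := h.M_eq
  one_lt_γ := h.one_lt_γ
  γ_le := h.γ_le
  M_pos := h.M_pos
  b_cont := h.b_cont.comp continuous_neg
  b_nonneg x := h.b_nonneg (-x)
  b_le x := h.b_le (-x)
  a_le x := by
    have := h.a_le (-x)
    simpa [Scheme.flip, Scheme.θ] using this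
  mass x := by rw [cumul_flip, abs_neg]; exact h.mass (-x)
  sigma := h.sigma
  dx_pos := h.dx_pos
  dt_pos := h.dt_pos
  cfl := h.cfl
  α_gt := h.α_gt
  α_lt := h.α_lt
  β_pos := h.β_pos
  β_lt := h.β_lt
  δ_pos := h.δ_pos
  one_le_K := h.one_le_K
  dx_le := h.dx_le
  small_dx := h.small_dx
  small_sqrt := h.small_sqrt
  small_α := h.small_α
  small_sqrt' := h.small_sqrt'
  small_δ := h.small_δ
  small_β := h.small_β

lemma θ_eq (h : Regime γ M B b₁ K P) : P.θ = (γ - 1) / 2 := by rw [Scheme.θ, h.γ_eq]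

lemma θ_pos (h : Regime γ M B b₁ K P) : 0 < P.θ := by
  rw [h.θ_eq]; linarith [h.one_lt_γ]

lemma θ_le (h : Regime γ M B b₁ K P) : P.θ ≤ 1 / 3 := by
  rw [h.θ_eq]; linarith [h.γ_le]

lemma γ_eq' (_h : Regime γ M B b₁ K P) : P.γ = 1 + 2 * P.θ := by rw [Scheme.θ]; ring

lemma b₁_nonneg (h : Regime γ M B b₁ K P) : 0 ≤ b₁ := (h.b_nonneg 0).trans (h.b_le 0)

lemma B_nonneg (h : Regime γ M B b₁ K P) : 0 ≤ B := (abs_nonneg _).trans (h.mass 0)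

lemma K_pos (h : Regime γ M B b₁ K P) : 0 < K := by linarith [h.one_le_K]

lemma dx_small (h : Regime γ M B b₁ K P) : K * P.dx ≤ 1 :=
  h.small_dx.trans (Real.rpow_le_one h.dx_pos.le h.dx_le (by linarith [h.α_gt, h.β_pos]))

lemma dx_le_sqrt (h : Regime γ M B b₁ K P) : P.dx ≤ P.dx ^ (1 / 2 : ℝ) := by
  conv_lhs => rw [← Real.rpow_one P.dx]
  exact Real.rpow_le_rpow_of_exponent_ge h.dx_pos h.dx_le (by norm_num)

lemma dx_δ (h : Regime γ M B b₁ K P) : K * P.dx ≤ P.dx ^ (P.δ * P.θ) :=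
  (mul_le_mul_of_nonneg_left h.dx_le_sqrt h.K_pos.le).trans h.small_sqrt

lemma dx_β (h : Regime γ M B b₁ K P) : K * P.dx ≤ P.dx ^ (P.β * P.θ) :=
  (mul_le_mul_of_nonneg_left h.dx_le_sqrt h.K_pos.le).trans h.small_sqrt'

lemma errSize_pos (h : Regime γ M B b₁ K P) : 0 < P.errSize := Real.rpow_pos_of_pos h.dx_pos _

lemma errSize_le (h : Regime γ M B b₁ K P) : P.errSize ≤ P.dx := by
  conv_rhs => rw [← Real.rpow_one P.dx]
  exact Real.rpow_le_rpow_of_exponent_ge h.dx_pos h.dx_le (by linarith [h.β_pos])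

lemma errSize_small (h : Regime γ M B b₁ K P) : K * P.errSize ≤ 1 :=
  (mul_le_mul_of_nonneg_left h.errSize_le h.K_pos.le).trans h.dx_small

lemma invBound_pos (h : Regime γ M B b₁ K P) : 0 < invBound M B :=
  mul_pos (by linarith [h.M_pos]) (exp_pos _)

lemma one_le_exp_B (h : Regime γ M B b₁ K P) : 1 ≤ exp B := Real.one_le_exp h.B_nonneg

lemma invBound_ge (h : Regime γ M B b₁ K P) : M * exp B + 1 ≤ invBound M B := by
  unfold invBound; linarith [h.one_le_exp_B]

lemma upper_le (h : Regime γ M B b₁ K P) (x : ℝ) : P.upper x ≤ M * exp B := by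
  unfold Scheme.upper; rw [h.M_eq]
  exact mul_le_mul_of_nonneg_left (exp_le_exp.mpr (abs_le.mp (h.mass x)).2) h.M_pos.le

lemma le_upper (h : Regime γ M B b₁ K P) (x : ℝ) : M * exp (-B) ≤ P.upper x := by
  unfold Scheme.upper; rw [h.M_eq]
  exact mul_le_mul_of_nonneg_left (exp_le_exp.mpr (abs_le.mp (h.mass x)).1) h.M_pos.le

lemma le_lower (h : Regime γ M B b₁ K P) (x : ℝ) : -(M * exp B) ≤ P.lower x := by
  have := h.flip.upper_le (-x)
  rw [upper_flip, neg_neg] at this; linarith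

lemma lower_le (h : Regime γ M B b₁ K P) (x : ℝ) : P.lower x ≤ -(M * exp (-B)) := by
  have := h.flip.le_upper (-x)
  rw [upper_flip, neg_neg] at this; linarith

lemma cumul_sub (h : Regime γ M B b₁ K P) (x y : ℝ) :
    ∫ s in y..x, P.b s = P.cumul x - P.cumul y :=
  (intervalIntegral.integral_interval_sub_left (h.b_cont.intervalIntegrable _ _)
    (h.b_cont.intervalIntegrable _ _)).symm

lemma cumul_mono (h : Regime γ M B b₁ K P) {x y : ℝ} (hxy : x ≤ y) :
    P.cumul x ≤ P.cumul y := by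
  have := h.cumul_sub y x
  have h2 : 0 ≤ ∫ s in x..y, P.b s :=
    intervalIntegral.integral_nonneg hxy fun s _ => h.b_nonneg s
  linarith

lemma lower_mono (h : Regime γ M B b₁ K P) {x y : ℝ} (hxy : x ≤ y) : P.lower x ≤ P.lower y := by
  unfold Scheme.lower; rw [h.M_eq]
  have := exp_le_exp.mpr (neg_le_neg (h.cumul_mono hxy))
  have := mul_le_mul_of_nonneg_left this h.M_pos.le
  linarith

lemma upper_mono (h : Regime γ M B b₁ K P) {x y : ℝ} (hxy : x ≤ y) : P.upper x ≤ P.upper y := by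
  unfold Scheme.upper; rw [h.M_eq]
  exact mul_le_mul_of_nonneg_left (exp_le_exp.mpr (h.cumul_mono hxy)) h.M_pos.le

lemma abs_cumul_sub_le (h : Regime γ M B b₁ K P) (x y : ℝ) :
    |P.cumul x - P.cumul y| ≤ b₁ * |x - y| := by
  rw [← h.cumul_sub]
  have := intervalIntegral.norm_integral_le_of_norm_le_const (a := y) (b := x) (f := P.b) (C := b₁)
    (fun s _ => by rw [Real.norm_eq_abs, abs_of_nonneg (h.b_nonneg s)]; exact h.b_le s)
  simpa using this

lemma abs_sub_le_dx {j : ℤ} {x y : ℝ} (hx : P.InCell j x) (hy : P.InCell j y) :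
    |x - y| ≤ P.dx := by
  rw [abs_le]; constructor <;> linarith [hx.1, hx.2, hy.1, hy.2]

lemma abs_cumul_sub_le_dx (h : Regime γ M B b₁ K P) {j : ℤ} {x y : ℝ} (hx : P.InCell j x)
    (hy : P.InCell j y) : |P.cumul x - P.cumul y| ≤ b₁ * P.dx :=
  (h.abs_cumul_sub_le x y).trans (mul_le_mul_of_nonneg_left (abs_sub_le_dx hx hy) h.b₁_nonneg)

lemma abs_mul_exp_sub_le (h : Regime γ M B b₁ K P) (hK : b₁ ≤ K) {i c G : ℝ}
    (hi : |i| ≤ b₁ * P.dx) (hc : |c| ≤ G) : |c * exp i - c| ≤ 2 * G * b₁ * P.dx := by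
  have hG : 0 ≤ G := (abs_nonneg c).trans hc
  have h1 : b₁ * P.dx ≤ 1 := (mul_le_mul_of_nonneg_right hK h.dx_pos.le).trans h.dx_small
  have h2 := Real.abs_exp_sub_one_le (hi.trans h1)
  have e : c * exp i - c = c * (exp i - 1) := by ring
  rw [e, abs_mul]
  calc |c| * |exp i - 1| ≤ G * (2 * (b₁ * P.dx)) := by gcongr; linarith
    _ = _ := by ring

lemma invCell_left (h : Regime γ M B b₁ K P) (j : ℤ) : P.InCell j ((j : ℝ) * P.dx) :=
  ⟨le_rfl, by have := h.dx_pos; linarith⟩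

lemma invCell_mid (h : Regime γ M B b₁ K P) (j : ℤ) : P.InCell j (P.mid j) := by
  have := h.dx_pos
  constructor <;> unfold Scheme.mid <;> linarith

lemma invCell_flip {j : ℤ} {x : ℝ} (hx : P.InCell j x) : P.flip.InCell (-j - 1) (-x) := by
  obtain ⟨h1, h2⟩ := hx
  constructor <;> simp only [Scheme.flip] <;> push_cast <;> linarith

lemma mid_flip (P : Scheme) (j : ℤ) : P.flip.mid (-j - 1) = -P.mid j := by
  simp only [Scheme.mid, Scheme.flip]; push_cast; ring

/-- The update of z is the reflected update of w: replace (z, w, a) by (-w, -z, -a). One estimate of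
`source` therefore serves both invariants. -/
lemma fracStep_eq {P : Scheme} (h0 : P.θ ≠ 0) (x τ : ℝ) (u : State) : P.fracStep x τ u =
    ofZW P.θ (-(-zInv P.θ u + source P.θ (-P.a x) (P.b x) (-wInv P.θ u) (-zInv P.θ u) * τ))
      (wInv P.θ u + source P.θ (P.a x) (P.b x) (zInv P.θ u) (wInv P.θ u) * τ) := by
  unfold Scheme.fracStep source lam1 lam2
  rw [rpow_eq h0, vel_eq P.θ]
  congr 1 <;> ring

/-- The constant in the change of the invariants during the fractional step. -/
def changeConst (γ M B b₁ : ℝ) : ℝ :=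
  b₁ * (muConst ((γ - 1) / 2) + 2) * invBound M B ^ 2 / (2 * M * exp B)

lemma source_mul_le (h : Regime γ M B b₁ K P) {x a τ z w : ℝ}
    (ha : |a| ≤ muConst P.θ * P.b x) (hz : |z| ≤ invBound M B) (hw : |w| ≤ invBound M B)
    (hτ : 0 ≤ τ) (hτ' : τ ≤ P.dt) :
    |source P.θ a (P.b x) z w * τ| ≤ changeConst γ M B b₁ * P.dx := by
  have h1 := abs_source_le h.θ_pos (by linarith [h.θ_le]) (h.b_nonneg x) (h.b_le x) ha hz hw
  have hM := h.M_pos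
  have h2 := (abs_nonneg _).trans h1
  rw [abs_mul, abs_of_nonneg hτ, h.cfl, changeConst, ← h.θ_eq]
  calc _ ≤ b₁ * (muConst P.θ + 2) * invBound M B ^ 2 * P.dt := by gcongr
    _ = _ := by field_simp

/-- Threshold for the mesh in the analysis of the fractional step. -/
def stepThreshold (γ M B b₁ : ℝ) : ℝ :=
  1 + b₁ + 3 * changeConst γ M B b₁ +
    stepConst ((γ - 1) / 2) b₁ (invBound M B) (M * exp (-B)) / (2 * M * exp B)

lemma stepConst_nonneg (h : Regime γ M B b₁ K P) :
    0 ≤ stepConst ((γ - 1) / 2) b₁ (invBound M B) (M * exp (-B)) := by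
  have h1 := h.b₁_nonneg
  have h2 := muConst_nonneg h.θ_pos (by linarith [h.θ_le])
  have h3 := sigmaConst_pos h.θ_pos (by linarith [h.θ_le])
  have h4 := h.invBound_pos
  have h5 := h.M_pos
  rw [h.θ_eq] at h2 h3
  unfold stepConst
  positivity

lemma changeConst_nonneg (h : Regime γ M B b₁ K P) : 0 ≤ changeConst γ M B b₁ := by
  have h1 := h.b₁_nonneg
  have h2 := muConst_nonneg h.θ_pos (by linarith [h.θ_le])
  have h5 := h.M_pos
  rw [h.θ_eq] at h2
  unfold changeConst
  positivity

lemma dt_mul_stepConst (h : Regime γ M B b₁ K P) (hK : stepThreshold γ M B b₁ ≤ K) :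
    P.dt * stepConst P.θ b₁ (invBound M B) (M * exp (-B)) ≤ 1 := by
  have h1 := h.stepConst_nonneg
  have h2 := h.changeConst_nonneg
  have h3 := h.b₁_nonneg
  have h5 := h.M_pos
  have h6 : stepConst ((γ - 1) / 2) b₁ (invBound M B) (M * exp (-B)) / (2 * M * exp B) ≤ K := by
    unfold stepThreshold at hK; linarith
  have h7 := mul_le_mul_of_nonneg_right h6 h.dx_pos.le
  rw [h.θ_eq]
  refine le_trans (le_of_eq ?_) (h7.trans h.dx_small)
  rw [h.cfl]; field_simp

/-- The sign condition of `source_le` on the boundary of the region. The ratio of the two bounds is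
exp(-2∫b) ≤ exp(2B) ≤ 1/σ, and this is where the mass of b must be limited. -/
lemma sigma_upper (h : Regime γ M B b₁ K P) (x : ℝ) :
    -P.lower x * sigmaConst P.θ ≤ P.upper x := by
  have hσ := sigmaConst_pos h.θ_pos (by linarith [h.θ_le])
  have h1 := (abs_le.mp (h.mass x)).1
  have h2 : exp (-2 * P.cumul x) * sigmaConst P.θ ≤ 1 :=
    (mul_le_mul_of_nonneg_right (exp_le_exp.mpr (by linarith)) hσ.le).trans h.sigma
  have h3 : exp (-P.cumul x) = exp (-2 * P.cumul x) * exp (P.cumul x) := by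
    rw [← Real.exp_add]; ring_nf
  unfold Scheme.lower Scheme.upper
  rw [h.M_eq, h3]
  have := mul_le_mul_of_nonneg_right h2 (mul_pos h.M_pos (exp_pos (P.cumul x))).le
  linarith

lemma sigma_lower (h : Regime γ M B b₁ K P) (x : ℝ) :
    P.upper x * sigmaConst P.θ ≤ -P.lower x := by
  have := h.flip.sigma_upper (-x)
  rwa [upper_flip, lower_flip, neg_neg, neg_neg] at this

lemma abs_inv_le (h : Regime γ M B b₁ K P) {x η z w : ℝ} (hη : η ≤ 1) (hzw : z ≤ w)
    (hz : P.lower x - η ≤ z) (hw : w ≤ P.upper x + η) :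
    |z| ≤ invBound M B ∧ |w| ≤ invBound M B := by
  have h1 := h.le_lower x
  have h2 := h.upper_le x
  have h3 := h.invBound_ge
  constructor <;> rw [abs_le] <;> constructor <;> linarith

/-- The fractional step keeps the lower bound of `z`. -/
lemma lower_step (h : Regime γ M B b₁ K P) (hK : stepThreshold γ M B b₁ ≤ K) {x η z w : ℝ}
    (hη : 0 ≤ η) (hη1 : η ≤ 1) (hzw : z ≤ w) (hz : P.lower x - η ≤ z) (hw : w ≤ P.upper x + η) :
    P.lower x - 2 * η ≤
      -(-z + source P.θ (-P.a x) (P.b x) (-w) (-z) * P.dt) := by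
  obtain ⟨h1, h2⟩ := h.abs_inv_le hη1 hzw hz hw
  have h5 := upper_step (a := -P.a x) (z := -w) (w := -z) (W := -P.lower x) (Z := -P.upper x)
    (η := η) h.θ_pos (by linarith [h.θ_le]) (h.b_nonneg x) (h.b_le x)
    (by rw [abs_neg]; exact h.a_le x) (by rwa [abs_neg]) (by rwa [abs_neg]) (by linarith)
    (mul_pos h.M_pos (exp_pos (-B))) (by linarith [h.lower_le x])
    (by rw [neg_neg]; exact h.sigma_lower x) hη (by linarith) (by linarith) h.dt_pos.le
    (h.dt_mul_stepConst hK)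
  linarith

/-- The gap between w and z exceeds the total change of both during the step. The state thus stays
away from the vacuum and its invariants are those passed to `ofZW`. -/
lemma fracStep_leftLimit (h : Regime γ M B b₁ K P) (hK : stepThreshold γ M B b₁ ≤ K)
    {x η : ℝ} {u : State} (hη : 0 ≤ η) (hη1 : η ≤ 1)
    (hzw : K * P.dx ≤ wInv P.θ u - zInv P.θ u)
    (hz : P.lower x - η ≤ zInv P.θ u) (hw : wInv P.θ u ≤ P.upper x + η) :
    LeftLimitIn P.θ P.dt (P.lower x - 2 * η) (P.upper x + 2 * η)
      (fun τ => P.fracStep x τ u) := by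
  have hd := h.dx_pos
  have hle : zInv P.θ u ≤ wInv P.θ u := by
    have := mul_pos h.K_pos hd; linarith
  obtain ⟨h1, h2⟩ := h.abs_inv_le hη1 hle hz hw
  simp only [fracStep_eq h.θ_pos.ne']
  refine LeftLimitIn.ofZW h.θ_pos
    (zl := -(-zInv P.θ u + source P.θ (-P.a x) (P.b x) (-wInv P.θ u) (-zInv P.θ u) * P.dt))
    (wl := wInv P.θ u + source P.θ (P.a x) (P.b x) (zInv P.θ u) (wInv P.θ u) * P.dt)
    ?_ ?_ ?_ ?_ ?_
  · exact (Continuous.tendsto (by fun_prop) _).mono_left nhdsWithin_le_nhds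
  · exact (Continuous.tendsto (by fun_prop) _).mono_left nhdsWithin_le_nhds
  · filter_upwards [eventually_mem_Ioo h.dt_pos] with τ hτ
    have h3 := abs_le.mp (h.source_mul_le (x := x) (a := P.a x) (h.a_le x) h1 h2 hτ.1.le hτ.2.le)
    have h4 := abs_le.mp (h.source_mul_le (x := x) (a := -P.a x) (z := -wInv P.θ u)
      (w := -zInv P.θ u) (by rw [abs_neg]; exact h.a_le x) (by rwa [abs_neg]) (by rwa [abs_neg])
      hτ.1.le hτ.2.le)
    have h5 : 3 * changeConst γ M B b₁ + 1 ≤ K := by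
      have := h.stepConst_nonneg
      have := h.b₁_nonneg
      have h6 := h.M_pos
      have : 0 ≤ stepConst ((γ - 1) / 2) b₁ (invBound M B) (M * exp (-B)) / (2 * M * exp B) := by
        positivity
      unfold stepThreshold at hK; linarith
    have h6 := mul_le_mul_of_nonneg_right h5 hd.le
    have h7 := mul_nonneg h.changeConst_nonneg hd.le
    linarith [h3.1, h4.1]
  · exact h.lower_step hK hη hη1 hle hz hw
  · exact upper_step h.θ_pos (by linarith [h.θ_le]) (h.b_nonneg x) (h.b_le x) (h.a_le x) h1 h2 hle
      (mul_pos h.M_pos (exp_pos (-B))) (h.le_upper x) (h.sigma_upper x) hη hz hw h.dt_pos.le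
      (h.dt_mul_stepConst hK)

end Regime

/-! ### Riemann invariants across jumps and along blocks. -/

/-- The constant in the third order deviation of the jump curve from the rarefaction curve. -/
def devConst (θ : ℝ) : ℝ := (2 ^ ((θ + 1) / (2 * θ)) - 1) ^ 2 / (2 * θ)

lemma devConst_nonneg {θ : ℝ} (hθ : 0 < θ) : 0 ≤ devConst θ := by unfold devConst; positivity

lemma OneJump.wInv_le_of_le {γ θ s : ℝ} {ul ur : State} (hγ : γ = 1 + 2 * θ) (hθ : 0 < θ)
    (h : OneJump γ s ul ur) (hle : ul.1 ≤ ur.1) :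
    wInv θ ur ≤ wInv θ ul ∧ vel ur ≤ vel ul - (ur.1 ^ θ - ul.1 ^ θ) / θ := by
  have h1 := h.vel_of_le hγ hθ hle
  have h2 := rarefaction_le_jumpVel hγ hθ h.1 hle
  have h3 : (ur.1 ^ θ - ul.1 ^ θ) / θ = ur.1 ^ θ / θ - ul.1 ^ θ / θ := sub_div _ _ _
  constructor
  · unfold wInv; linarith
  · linarith

/-- 1-jumps with decreasing density: `w` increases, at third order only. -/
lemma OneJump.wInv_of_ge {γ θ s : ℝ} {ul ur : State} (hγ : γ = 1 + 2 * θ) (hθ : 0 < θ)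
    (hθ1 : θ ≤ 1) (h : OneJump γ s ul ur) (hle : ur.1 ≤ ul.1) :
    wInv θ ul ≤ wInv θ ur ∧ (ul.1 ^ θ - ur.1 ^ θ) / θ ≤ zInv θ ur - zInv θ ul ∧
      (ul.1 ^ θ ≤ 2 * ur.1 ^ θ → wInv θ ur ≤ wInv θ ul +
        devConst θ * ((ul.1 ^ θ - ur.1 ^ θ) ^ 3 / (ur.1 ^ θ) ^ 2)) := by
  have h1 := h.vel_of_ge hγ hθ hle
  have h2 := rarefaction_le_jumpVel hγ hθ h.2.1 hle
  have h3 : (ul.1 ^ θ - ur.1 ^ θ) / θ = ul.1 ^ θ / θ - ur.1 ^ θ / θ := sub_div _ _ _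
  have h4 := jumpVel_nonneg γ ul.1 ur.1
  refine ⟨?_, ?_, fun h5 => ?_⟩
  · unfold wInv; linarith
  · unfold zInv; linarith
  · have h6 := jumpVel_le hγ hθ hθ1 h.2.1 hle h5
    unfold wInv devConst; linarith

/-- A compressive 1-jump strictly lowers z. Prescribing increasing values of z therefore forces
expansive jumps. -/
lemma OneJump.le_of_zInv_le {γ θ s : ℝ} {ul ur : State} (hγ : γ = 1 + 2 * θ) (hθ : 0 < θ)
    (h : OneJump γ s ul ur) (hz : zInv θ ul ≤ zInv θ ur) : ur.1 ≤ ul.1 := by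
  by_contra hlt
  push Not at hlt
  have h1 := (h.wInv_le_of_le hγ hθ hlt.le).2
  have h2 : ul.1 ^ θ < ur.1 ^ θ := Real.rpow_lt_rpow h.1.le hlt hθ
  have h3 : (ur.1 ^ θ - ul.1 ^ θ) / θ = ur.1 ^ θ / θ - ul.1 ^ θ / θ := sub_div _ _ _
  have h4 : 0 < (ur.1 ^ θ - ul.1 ^ θ) / θ := div_pos (by linarith) hθ
  unfold zInv at hz; linarith

namespace Regime

variable {γ M B b₁ K : ℝ} {P : Scheme}

lemma steady_eq (h : Regime γ M B b₁ K P) (x xd : ℝ) (u : State) :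
    P.steady x xd u = ofZW P.θ (zInv P.θ u * exp (-(P.cumul x - P.cumul xd)))
      (wInv P.θ u * exp (P.cumul x - P.cumul xd)) := by
  unfold Scheme.steady; rw [h.cumul_sub]

/-- The displacement constant of the blocks over one cell. -/
def dispConst (M B b₁ : ℝ) : ℝ := 2 * invBound M B * b₁

lemma dispConst_nonneg (h : Regime γ M B b₁ K P) : 0 ≤ dispConst M B b₁ := by
  have := h.invBound_pos
  have := h.b₁_nonneg
  unfold dispConst; positivity

lemma steady_props (h : Regime γ M B b₁ K P) (hK : b₁ ≤ K) {j : ℤ} {x xd : ℝ} {u : State}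
    (hx : P.InCell j x) (hxd : P.InCell j xd) (hz : |zInv P.θ u| ≤ invBound M B)
    (hw : |wInv P.θ u| ≤ invBound M B)
    (hlt : 2 * dispConst M B b₁ * P.dx < wInv P.θ u - zInv P.θ u) :
    0 < (P.steady x xd u).1 ∧
    zInv P.θ (P.steady x xd u) = zInv P.θ u * exp (-(P.cumul x - P.cumul xd)) ∧
    wInv P.θ (P.steady x xd u) = wInv P.θ u * exp (P.cumul x - P.cumul xd) ∧
    |zInv P.θ (P.steady x xd u) - zInv P.θ u| ≤ dispConst M B b₁ * P.dx ∧
    |wInv P.θ (P.steady x xd u) - wInv P.θ u| ≤ dispConst M B b₁ * P.dx := by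
  have h1 := h.abs_cumul_sub_le_dx hx hxd
  have h2 := h.abs_mul_exp_sub_le hK (i := -(P.cumul x - P.cumul xd)) (by rwa [abs_neg]) hz
  have h3 := h.abs_mul_exp_sub_le hK h1 hw
  have h4 : zInv P.θ u * exp (-(P.cumul x - P.cumul xd)) <
      wInv P.θ u * exp (P.cumul x - P.cumul xd) := by
    unfold dispConst at hlt
    linarith [(abs_le.mp h2).2, (abs_le.mp h3).1]
  rw [h.steady_eq, zInv_ofZW h.θ_pos h4, wInv_ofZW h.θ_pos h4]
  exact ⟨ofZW_fst_pos h.θ_pos h4, rfl, rfl, h2, h3⟩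

/-- `u` is a non-vacuum value at the point `x` of the cell `j` which respects the lower bound and,
up to a multiple of `e`, the upper bound. -/
structure BlockData (P : Scheme) (j : ℤ) (x : ℝ) (u : State) (e : ℝ) : Prop where
  inCell : P.InCell j x
  pos : 0 < u.1
  -- The scaled invariants do not change along a block. Only the upper bound carries an error: fans
  -- raise z, and expansive 1-jumps increase w slightly.
  lower : -P.M ≤ zInv P.θ u * exp (P.cumul x)
  upper : wInv P.θ u * exp (-P.cumul x) ≤ P.M + e

lemma BlockData.mono {j : ℤ} {x e e' : ℝ} {u : State} (hu : BlockData P j x u e) (he : e ≤ e') :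
    BlockData P j x u e' := { hu with upper := hu.upper.trans (by linarith) }

lemma scaled_lower {M z i : ℝ} : -M ≤ z * exp i ↔ -M * exp (-i) ≤ z := by
  rw [Real.exp_neg, ← div_eq_mul_inv, div_le_iff₀ (exp_pos i)]

lemma scaled_upper {M w i : ℝ} : w * exp (-i) ≤ M ↔ w ≤ M * exp i := by
  rw [Real.exp_neg, ← div_eq_mul_inv, div_le_iff₀ (exp_pos i)]

lemma BlockData.bounds (h : Regime γ M B b₁ K P) {j : ℤ} {x e : ℝ} {u : State}
    (hu : BlockData P j x u e) (he0 : 0 ≤ e) :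
    P.lower x ≤ zInv P.θ u ∧ wInv P.θ u ≤ P.upper x + e * exp B := by
  refine ⟨scaled_lower.mp hu.lower, (scaled_upper.mp hu.upper).trans ?_⟩
  have : exp (P.cumul x) ≤ exp B := exp_le_exp.mpr (abs_le.mp (h.mass x)).2
  unfold Scheme.upper
  nlinarith

lemma BlockData.abs_le (h : Regime γ M B b₁ K P) {j : ℤ} {x e : ℝ} {u : State}
    (hu : BlockData P j x u e) (he0 : 0 ≤ e) (he : e ≤ 1) :
    |zInv P.θ u| ≤ invBound M B ∧ |wInv P.θ u| ≤ invBound M B := by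
  obtain ⟨h1, h2⟩ := hu.bounds h he0
  have h3 := zInv_lt_wInv h.θ_pos hu.pos
  have h4 := h.le_lower x
  have h5 := h.upper_le x
  have h6 : e * exp B ≤ exp B := by nlinarith [exp_pos B]
  have h7 : invBound M B = M * exp B + exp B := by unfold invBound; ring
  have h8 := exp_pos B
  constructor <;> rw [_root_.abs_le] <;> constructor <;> linarith

lemma BlockData.steady (h : Regime γ M B b₁ K P) (hK : b₁ ≤ K) {j : ℤ} {x x' e : ℝ} {u : State}
    (hu : BlockData P j x u e) (he0 : 0 ≤ e) (he : e ≤ 1) (hx' : P.InCell j x')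
    (hlt : 2 * dispConst M B b₁ * P.dx < wInv P.θ u - zInv P.θ u) :
    BlockData P j x' (P.steady x' x u) e := by
  obtain ⟨h1, h2⟩ := hu.abs_le h he0 he
  obtain ⟨h3, h4, h5, -, -⟩ := h.steady_props hK hx' hu.inCell h1 h2 hlt
  refine ⟨hx', h3, ?_, ?_⟩
  · rw [h4, mul_assoc, ← Real.exp_add]
    have := hu.lower
    ring_nf at this ⊢; exact this
  · rw [h5, mul_assoc, ← Real.exp_add]
    have := hu.upper
    ring_nf at this ⊢; exact this

/-- A block respects the bounds after the fractional step. -/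
lemma BlockData.fracStep (h : Regime γ M B b₁ K P) (hK : stepThreshold γ M B b₁ ≤ K)
    (hK' : 2 * dispConst M B b₁ + 1 ≤ K)
    {j : ℤ} {x x' e : ℝ} {u : State}
    (hu : BlockData P j x u e) (he0 : 0 ≤ e) (he : e * exp B ≤ 1) (hx' : P.InCell j x')
    (hlt : 2 * K * P.dx ≤ wInv P.θ u - zInv P.θ u) :
    LeftLimitIn P.θ P.dt (P.lower x' - 2 * (e * exp B)) (P.upper x' + 2 * (e * exp B))
      (fun τ => P.fracStep x' τ (P.steady x' x u)) := by
  have he1 : e ≤ 1 := by nlinarith [h.one_le_exp_B]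
  have hb : b₁ ≤ K := by
    have := h.stepConst_nonneg
    have := h.changeConst_nonneg
    have h6 := h.M_pos
    have : 0 ≤ stepConst ((γ - 1) / 2) b₁ (invBound M B) (M * exp (-B)) / (2 * M * exp B) := by
      positivity
    unfold stepThreshold at hK; linarith
  have hd := h.dx_pos
  have hKd := mul_le_mul_of_nonneg_right hK' hd.le
  have hlt' : 2 * dispConst M B b₁ * P.dx < wInv P.θ u - zInv P.θ u := by
    have := mul_pos h.K_pos hd
    linarith
  have h0 := hu.steady h hb he0 he1 hx' hlt'
  obtain ⟨h1, h2⟩ := h0.bounds h he0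
  obtain ⟨h3, h4⟩ := hu.abs_le h he0 he1
  obtain ⟨-, -, -, h5, h6⟩ := h.steady_props hb hx' hu.inCell h3 h4 hlt'
  have h7 : 0 ≤ e * exp B := mul_nonneg he0 (exp_pos _).le
  refine h.fracStep_leftLimit hK h7 he ?_ (by linarith) h2
  linarith [(_root_.abs_le.mp h5).2, (_root_.abs_le.mp h6).1]

/-- The choice of the exponent 1 + β/3: as θ ≤ 1/3, one has 2βθ + 1 + β/3 ≤ 1 + β, and α > 1/2 +
β/2. -/
lemma rpow_sq_le (h : Regime γ M B b₁ K P) {e : ℝ} (he : 1 + P.β ≤ 2 * e) :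
    (P.dx ^ e) ^ 2 ≤ (P.dx ^ (P.β * P.θ)) ^ 2 * P.errSize := by
  have hd := h.dx_pos
  rw [← Real.rpow_natCast, ← Real.rpow_natCast, ← Real.rpow_mul hd.le, ← Real.rpow_mul hd.le,
    Scheme.errSize, ← Real.rpow_add hd]
  apply Real.rpow_le_rpow_of_exponent_ge hd h.dx_le
  have := h.β_pos
  have := h.θ_le
  push_cast
  nlinarith

/-- For a single jump of strength √dx the cube dx^(3/2) is enough, since β ≤ 1/2. -/
lemma cube_sqrt_le (h : Regime γ M B b₁ K P) :
    (P.dx ^ (1 / 2 : ℝ)) ^ 3 ≤ (P.dx ^ (P.β * P.θ)) ^ 2 * P.errSize := by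
  have hd := h.dx_pos
  rw [← Real.rpow_natCast, ← Real.rpow_natCast, ← Real.rpow_mul hd.le, ← Real.rpow_mul hd.le,
    Scheme.errSize, ← Real.rpow_add hd]
  apply Real.rpow_le_rpow_of_exponent_ge hd h.dx_le
  have := h.β_pos
  have := h.β_lt
  have := h.θ_le
  push_cast
  nlinarith

/-- The error constant of one jump in a fan. -/
def fanStepConst (γ B : ℝ) : ℝ := 108 * devConst ((γ - 1) / 2) * exp B

lemma fanStepConst_nonneg (h : Regime γ M B b₁ K P) : 0 ≤ fanStepConst γ B := by
  have := devConst_nonneg h.θ_pos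
  rw [h.θ_eq] at this
  unfold fanStepConst; positivity

/-- One step in a fan. -/
lemma BlockData.jump (h : Regime γ M B b₁ K P) (hK : b₁ ≤ K) (hK' : 6 + dispConst M B b₁ ≤ K)
    {j : ℤ} {x x' e s : ℝ} {u u' : State} (hu : BlockData P j x u e)
    (he0 : 0 ≤ e) (he : e ≤ 1) (hx' : P.InCell j x')
    (hlt : 2 * dispConst M B b₁ * P.dx < wInv P.θ u - zInv P.θ u)
    (hj : OneJump P.γ s (P.steady x' x u) u')
    (hz : zInv P.θ (P.steady x' x u) ≤ zInv P.θ u')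
    (hz' : zInv P.θ u' ≤ zInv P.θ u + 2 * P.dx ^ P.α)
    (hD : zInv P.θ u' + P.dx ^ (P.β * P.θ) / P.θ ≤
      wInv P.θ u * exp (-P.cumul x) * exp (P.cumul x')) :
    wInv P.θ u * exp (-P.cumul x) ≤ wInv P.θ u' * exp (-P.cumul x') ∧
    wInv P.θ u' * exp (-P.cumul x') ≤ wInv P.θ u * exp (-P.cumul x) +
      fanStepConst γ B * P.dx ^ P.α * P.errSize ∧
    BlockData P j x' u' (e + fanStepConst γ B * P.dx ^ P.α * P.errSize) := by
  obtain ⟨h1, h2⟩ := hu.abs_le h he0 he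
  obtain ⟨h3, h4, h5, h6, h7⟩ := h.steady_props hK hx' hu.inCell h1 h2 hlt
  have hb := hu.steady h hK he0 he hx' hlt
  have hθ := h.θ_pos
  have hd := h.dx_pos
  have hle := hj.le_of_zInv_le h.γ_eq' hθ hz
  obtain ⟨h8, h9, h10⟩ := hj.wInv_of_ge h.γ_eq' hθ (by linarith [h.θ_le]) hle
  have hwe : wInv P.θ u * exp (-P.cumul x) * exp (P.cumul x') = wInv P.θ (P.steady x' x u) := by
    rw [h5, mul_assoc, ← Real.exp_add]; ring_nf
  have hwe' : wInv P.θ u * exp (-P.cumul x) =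
      wInv P.θ (P.steady x' x u) * exp (-P.cumul x') := by
    rw [← hwe, mul_assoc _ (exp (P.cumul x')), ← Real.exp_add]; simp
  -- The jump raises w, so `hD` bounds the gap between w and z behind it.
  have hcr : P.dx ^ (P.β * P.θ) / 2 ≤ u'.1 ^ P.θ := by
    rw [rpow_eq hθ.ne']
    have : P.dx ^ (P.β * P.θ) / P.θ ≤ wInv P.θ u' - zInv P.θ u' := by linarith
    rw [div_le_iff₀ hθ] at this
    linarith
  have ha : 0 < P.dx ^ P.α := Real.rpow_pos_of_pos hd _
  have hb0 : 0 < P.dx ^ (P.β * P.θ) := Real.rpow_pos_of_pos hd _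
  have hKd := mul_le_mul_of_nonneg_right hK' hd.le
  have hKa := mul_le_mul_of_nonneg_right hK' ha.le
  have hsd := h.small_dx
  have hsa := h.small_α
  have hdisp := h.dispConst_nonneg
  -- The prescribed increase of z is at most 2·dx^α, and the displacement of the block along the
  -- cell costs less than another dx^α.
  have hdiff : (P.steady x' x u).1 ^ P.θ - u'.1 ^ P.θ ≤ 3 * P.dx ^ P.α := by
    rw [div_le_iff₀ hθ] at h9
    have h12 : zInv P.θ u' - zInv P.θ (P.steady x' x u) ≤ 3 * P.dx ^ P.α := by
      linarith [(_root_.abs_le.mp h6).1]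
    nlinarith [h.θ_le]
  have hdiff0 : 0 ≤ (P.steady x' x u).1 ^ P.θ - u'.1 ^ P.θ :=
    sub_nonneg.mpr (Real.rpow_le_rpow hj.2.1.le hle hθ.le)
  have hE := h10 (by nlinarith)
  have hE2 : devConst P.θ * (((P.steady x' x u).1 ^ P.θ - u'.1 ^ P.θ) ^ 3 / (u'.1 ^ P.θ) ^ 2) ≤
      108 * devConst P.θ * P.dx ^ P.α * P.errSize := by
    have hdc := devConst_nonneg hθ
    have h13 : ((P.steady x' x u).1 ^ P.θ - u'.1 ^ P.θ) ^ 3 / (u'.1 ^ P.θ) ^ 2 ≤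
        (3 * P.dx ^ P.α) ^ 3 / (P.dx ^ (P.β * P.θ) / 2) ^ 2 := by
      gcongr
    -- Here 108 = 3³·2². One factor dx^α is kept for the sum over the jumps of the fan.
    have h14 : (3 * P.dx ^ P.α) ^ 3 / (P.dx ^ (P.β * P.θ) / 2) ^ 2 ≤
        108 * P.dx ^ P.α * P.errSize := by
      rw [div_le_iff₀ (by positivity)]
      have := h.rpow_sq_le (e := P.α) (by linarith [h.α_gt])
      nlinarith
    calc _ ≤ devConst P.θ * (108 * P.dx ^ P.α * P.errSize) :=
          mul_le_mul_of_nonneg_left (h13.trans h14) hdc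
      _ = _ := by ring
  have hup : wInv P.θ u' * exp (-P.cumul x') ≤ wInv P.θ u * exp (-P.cumul x) +
      fanStepConst γ B * P.dx ^ P.α * P.errSize := by
    have h15 : exp (-P.cumul x') ≤ exp B :=
      exp_le_exp.mpr (by linarith [(_root_.abs_le.mp (h.mass x')).1])
    have h16 : wInv P.θ u' ≤ wInv P.θ (P.steady x' x u) +
        108 * devConst P.θ * P.dx ^ P.α * P.errSize := by linarith
    have h17 := mul_le_mul_of_nonneg_right h16 (exp_pos (-P.cumul x')).le
    have h19 : 0 ≤ 108 * devConst P.θ * P.dx ^ P.α * P.errSize := by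
      have := devConst_nonneg hθ
      have := h.errSize_pos
      positivity
    have h20 := mul_le_mul_of_nonneg_left h15 h19
    have e : fanStepConst γ B * P.dx ^ P.α * P.errSize =
        108 * devConst P.θ * P.dx ^ P.α * P.errSize * exp B := by
      unfold fanStepConst; rw [h.θ_eq]; ring
    rw [e, hwe']; linarith
  refine ⟨?_, hup, ⟨hx', hj.2.1, ?_, ?_⟩⟩
  · rw [hwe']
    exact mul_le_mul_of_nonneg_right h8 (exp_pos _).le
  · exact hb.lower.trans (mul_le_mul_of_nonneg_right hz (exp_pos _).le)
  · have h18 := hu.upper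
    linarith

/-! ### Fans -/

lemma two_le_fanSize (P : Scheme) (zl zend : ℝ) : 2 ≤ P.fanSize zl zend := by
  unfold Scheme.fanSize
  have : (2 : ℤ) ≤ max (⌊(zend - zl) / P.dx ^ P.α⌋ + 1) 2 := le_max_right _ _
  omega

lemma lt_fanSize_mul (h : Regime γ M B b₁ K P) (zl zend : ℝ) :
    zend - zl < P.fanSize zl zend * P.dx ^ P.α := by
  have ha : 0 < P.dx ^ P.α := Real.rpow_pos_of_pos h.dx_pos _
  rw [← div_lt_iff₀ ha]
  have h1 : ⌊(zend - zl) / P.dx ^ P.α⌋ + 1 ≤ (P.fanSize zl zend : ℤ) := by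
    unfold Scheme.fanSize
    have := le_max_left (⌊(zend - zl) / P.dx ^ P.α⌋ + 1) 2
    have := le_max_right (⌊(zend - zl) / P.dx ^ P.α⌋ + 1) 2
    omega
  have h2 : ((⌊(zend - zl) / P.dx ^ P.α⌋ : ℤ) : ℝ) + 1 ≤ (P.fanSize zl zend : ℝ) := by
    exact_mod_cast h1
  linarith [Int.lt_floor_add_one ((zend - zl) / P.dx ^ P.α)]

lemma fanSize_mul_le (h : Regime γ M B b₁ K P) {zl zend : ℝ} (h3 : 3 ≤ P.fanSize zl zend) :
    ((P.fanSize zl zend : ℝ) - 1) * P.dx ^ P.α ≤ zend - zl := by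
  have ha : 0 < P.dx ^ P.α := Real.rpow_pos_of_pos h.dx_pos _
  rw [← le_div_iff₀ ha]
  have h1 : (P.fanSize zl zend : ℤ) - 1 = ⌊(zend - zl) / P.dx ^ P.α⌋ := by
    unfold Scheme.fanSize at *
    rcases le_total (⌊(zend - zl) / P.dx ^ P.α⌋ + 1) 2 with h4 | h4
    · rw [max_eq_right h4] at h3
      exact absurd h3 (by decide)
    · rw [max_eq_left h4]
      omega
  have h2 : (P.fanSize zl zend : ℝ) - 1 = ((⌊(zend - zl) / P.dx ^ P.α⌋ : ℤ) : ℝ) := by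
    exact_mod_cast h1
  rw [h2]; exact Int.floor_le _

lemma fanSize_eq_two (h : Regime γ M B b₁ K P) {zl zend : ℝ} (hle : zend ≤ zl) :
    P.fanSize zl zend = 2 := by
  have h2 := two_le_fanSize P zl zend
  by_contra hne
  have h3 : 3 ≤ P.fanSize zl zend := by omega
  have h4 := h.fanSize_mul_le h3
  have h5 : (3 : ℝ) ≤ (P.fanSize zl zend : ℝ) := by exact_mod_cast h3
  have ha : 0 < P.dx ^ P.α := Real.rpow_pos_of_pos h.dx_pos _
  nlinarith

lemma fanZ_one (P : Scheme) (zl zend : ℝ) : P.fanZ zl zend 1 = zl := by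
  have h2 := two_le_fanSize P zl zend
  unfold Scheme.fanZ
  rw [if_neg (by omega)]; simp

lemma fanZ_le (h : Regime γ M B b₁ K P) {zl zend : ℝ} {k : ℕ} (hk : 2 ≤ k)
    (hkp : k ≤ P.fanSize zl zend) : P.fanZ zl zend k ≤ zend := by
  unfold Scheme.fanZ
  split_ifs with hk'
  · exact le_rfl
  · have h3 : 3 ≤ P.fanSize zl zend := by omega
    have h4 := h.fanSize_mul_le h3
    have ha : 0 < P.dx ^ P.α := Real.rpow_pos_of_pos h.dx_pos _
    have h5 : (k : ℝ) ≤ (P.fanSize zl zend : ℝ) := by exact_mod_cast hkp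
    nlinarith

/-- The rounding in `fanSize` makes the last increment of z lie between dx^α and 2·dx^α; all others
equal dx^α. -/
lemma fanZ_succ_le (h : Regime γ M B b₁ K P) {zl zend : ℝ} {k : ℕ}
    (hkp : k + 1 ≤ P.fanSize zl zend) :
    P.fanZ zl zend (k + 1) ≤ P.fanZ zl zend k + 2 * P.dx ^ P.α := by
  have ha : 0 < P.dx ^ P.α := Real.rpow_pos_of_pos h.dx_pos _
  unfold Scheme.fanZ
  rw [if_neg (show ¬ k = P.fanSize zl zend by omega)]
  split_ifs with hk'
  · have h4 := h.lt_fanSize_mul zl zend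
    rw [← hk'] at h4
    push_cast at h4; linarith
  · push_cast; linarith

lemma le_fanZ_succ (h : Regime γ M B b₁ K P) {zl zend : ℝ} {k : ℕ}
    (h3 : 3 ≤ P.fanSize zl zend) (hkp : k + 1 ≤ P.fanSize zl zend) :
    P.fanZ zl zend k + P.dx ^ P.α ≤ P.fanZ zl zend (k + 1) := by
  unfold Scheme.fanZ
  rw [if_neg (show ¬ k = P.fanSize zl zend by omega)]
  split_ifs with hk'
  · have h4 := h.fanSize_mul_le h3
    rw [← hk'] at h4
    push_cast at h4; linarith
  · push_cast; linarith

lemma fanNode_one (P : Scheme) (j : ℤ) (s : ℕ → ℝ) : P.fanNode j s 1 = (j : ℝ) * P.dx := by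
  simp [Scheme.fanNode]

lemma IsFan.inCell (h : Regime γ M B b₁ K P) {j : ℤ} {ul : State} {zend : ℝ} {q : ℕ}
    {s : ℕ → ℝ} {U : ℕ → State} (hF : P.IsFan j ul zend q s U) {k : ℕ} (hk : 1 ≤ k)
    (hkq : k ≤ q) : P.InCell j (P.fanNode j s k) := by
  obtain ⟨k, rfl⟩ : ∃ m, k = m + 1 := ⟨k - 1, by omega⟩
  rcases Nat.eq_zero_or_pos k with rfl | hk0
  · rw [zero_add, fanNode_one]; exact h.invCell_left j
  · exact (hF.2 k hk0 hkq).2.1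

/-- The accumulated error constant of a fan. -/
def fanConst (γ M B : ℝ) : ℝ := fanStepConst γ B * (2 * invBound M B + 1)

lemma fanConst_nonneg (h : Regime γ M B b₁ K P) : 0 ≤ fanConst γ M B := by
  have := h.fanStepConst_nonneg
  have := h.invBound_pos
  unfold fanConst; positivity

/-- Threshold for the mesh in the analysis of fans. -/
def fanThreshold (γ M B b₁ : ℝ) : ℝ :=
  6 + b₁ + 6 * dispConst M B b₁ + fanConst γ M B * exp B

/-- The states of a fan all of whose jumps raise `z` respect the bounds, up to `O(errSize)`. -/
lemma fan_bounds (h : Regime γ M B b₁ K P) (hK : fanThreshold γ M B b₁ ≤ K)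
    {j : ℤ} {ul : State} {zend : ℝ} {q : ℕ} {s : ℕ → ℝ} {U : ℕ → State}
    (hpos : 0 < ul.1) (hzl : P.lower (j * P.dx) ≤ zInv P.θ ul)
    (hwl : wInv P.θ ul ≤ P.upper (j * P.dx))
    (hend : 2 ≤ q → zInv P.θ ul ≤ zend ∧ zend + 2 * (P.dx ^ (P.β * P.θ) / P.θ) ≤ wInv P.θ ul)
    (hF : P.IsFan j ul zend q s U) (hq : q ≤ P.fanSize (zInv P.θ ul) zend)
    (hR : ∀ k, 1 ≤ k → k + 1 ≤ q →
      zInv P.θ (P.fanBlock j s U k (P.fanNode j s (k + 1))) ≤ zInv P.θ (U (k + 1)))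
    {k : ℕ} (hk : 1 ≤ k) (hkq : k ≤ q) :
    zInv P.θ (U k) = P.fanZ (zInv P.θ ul) zend k ∧
    wInv P.θ ul * exp (-P.cumul (j * P.dx)) ≤
      wInv P.θ (U k) * exp (-P.cumul (P.fanNode j s k)) ∧
    wInv P.θ (U k) * exp (-P.cumul (P.fanNode j s k)) ≤
      wInv P.θ ul * exp (-P.cumul (j * P.dx)) + fanConst γ M B * P.errSize ∧
    BlockData P j (P.fanNode j s k) (U k) (fanConst γ M B * P.errSize) := by
  have hfs := h.fanStepConst_nonneg
  have hfc := h.fanConst_nonneg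
  have hη := h.errSize_pos
  have hdisp := h.dispConst_nonneg
  have hb₁ := h.b₁_nonneg
  have hd := h.dx_pos
  have hθ := h.θ_pos
  have ha : 0 < P.dx ^ P.α := Real.rpow_pos_of_pos hd _
  have ha1 : P.dx ^ P.α ≤ 1 := Real.rpow_le_one hd.le h.dx_le (by linarith [h.α_gt, h.β_pos])
  have hfeB : 0 ≤ fanConst γ M B * exp B := mul_nonneg hfc (exp_pos _).le
  have hle_fc : fanConst γ M B ≤ fanConst γ M B * exp B := by nlinarith [h.one_le_exp_B]
  have hKb : b₁ ≤ K := by unfold fanThreshold at hK; linarith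
  have hKd : 6 + 6 * dispConst M B b₁ ≤ K := by unfold fanThreshold at hK; linarith
  have hKf : fanConst γ M B ≤ K := by unfold fanThreshold at hK; linarith
  have hu1 : BlockData P j (j * P.dx) ul 0 :=
    ⟨h.invCell_left j, hpos, scaled_lower.mpr hzl, by
      rw [add_zero]; exact scaled_upper.mpr hwl⟩
  obtain ⟨hzl', hwl'⟩ := hu1.abs_le h le_rfl zero_le_one
  -- The error is counted per jump, k - 1 of them before the k-th state; the last clause turns the
  -- count into a multiple of `errSize`.
  suffices H : ∀ k, 1 ≤ k → k ≤ q → zInv P.θ (U k) = P.fanZ (zInv P.θ ul) zend k ∧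
      wInv P.θ ul * exp (-P.cumul (j * P.dx)) ≤
        wInv P.θ (U k) * exp (-P.cumul (P.fanNode j s k)) ∧
      wInv P.θ (U k) * exp (-P.cumul (P.fanNode j s k)) ≤
        wInv P.θ ul * exp (-P.cumul (j * P.dx)) +
          (k - 1) * (fanStepConst γ B * P.dx ^ P.α * P.errSize) ∧
      BlockData P j (P.fanNode j s k) (U k)
        ((k - 1) * (fanStepConst γ B * P.dx ^ P.α * P.errSize)) ∧
      (k - 1) * (fanStepConst γ B * P.dx ^ P.α * P.errSize) ≤ fanConst γ M B * P.errSize by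
    obtain ⟨h1, h2, h2', h3, h4⟩ := H k hk hkq
    exact ⟨h1, h2, by linarith, h3.mono h4⟩
  intro k hk
  induction k, hk using Nat.le_induction with
  | base =>
    intro _
    rw [hF.1, fanZ_one, fanNode_one]
    refine ⟨rfl, le_rfl, by simp, by simpa using hu1, ?_⟩
    simp; positivity
  | succ k hk ih =>
    intro hkq
    obtain ⟨h1, h2, h2', h3, h4⟩ := ih (by omega)
    obtain ⟨hzend, hgap⟩ := hend (by omega)
    obtain ⟨f1, f2, f3, -⟩ := hF.2 k hk hkq
    have hk1 : (1 : ℝ) ≤ k := by exact_mod_cast hk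
    have hs0 : 0 ≤ fanStepConst γ B * P.dx ^ P.α * P.errSize := by positivity
    have he0 : 0 ≤ ((k : ℝ) - 1) * (fanStepConst γ B * P.dx ^ P.α * P.errSize) :=
      mul_nonneg (by linarith) hs0
    have hfe1 : fanConst γ M B * P.errSize ≤ 1 :=
      (mul_le_mul_of_nonneg_right hKf hη.le).trans h.errSize_small
    have he1 := h4.trans hfe1
    have hzk : zInv P.θ (U k) ≤ zend := by
      rw [h1]
      rcases hk.eq_or_lt with rfl | hk2
      · rw [fanZ_one]; exact hzend
      · exact h.fanZ_le hk2 (by omega)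
    have hwx : ∀ x, P.InCell j x → wInv P.θ ul - dispConst M B b₁ * P.dx ≤
        wInv P.θ ul * exp (-P.cumul (j * P.dx)) * exp (P.cumul x) := by
      intro x hx
      have h5 := h.abs_mul_exp_sub_le hKb (h.abs_cumul_sub_le_dx hx (h.invCell_left j)) hwl'
      rw [mul_assoc, ← Real.exp_add]
      have e : -P.cumul (j * P.dx) + P.cumul x = P.cumul x - P.cumul (j * P.dx) := by ring
      rw [e]; unfold dispConst
      linarith [(abs_le.mp h5).1]
    have hdβ : 6 * dispConst M B b₁ * P.dx < P.dx ^ (P.β * P.θ) / P.θ := by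
      have h6 := mul_le_mul_of_nonneg_right hKd hd.le
      have h7 := h.dx_β
      have h8 : P.dx ^ (P.β * P.θ) ≤ P.dx ^ (P.β * P.θ) / P.θ := by
        rw [le_div_iff₀ hθ]
        have := Real.rpow_pos_of_pos hd (P.β * P.θ)
        nlinarith [h.θ_le]
      linarith
    have hdpos : 0 ≤ dispConst M B b₁ * P.dx := by positivity
    have hwk : wInv P.θ ul - dispConst M B b₁ * P.dx ≤ wInv P.θ (U k) := by
      have h9 := mul_le_mul_of_nonneg_right h2 (exp_pos (P.cumul (P.fanNode j s k))).le
      have h10 := hwx _ (IsFan.inCell h hF hk (by omega))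
      rw [mul_assoc (wInv P.θ (U k)), ← Real.exp_add] at h9
      simp at h9
      linarith
    have hzk1 : zInv P.θ (U (k + 1)) ≤ zend := by
      rw [f1]; exact h.fanZ_le (by omega) (by omega)
    have hD : zInv P.θ (U (k + 1)) + P.dx ^ (P.β * P.θ) / P.θ ≤
        wInv P.θ (U k) * exp (-P.cumul (P.fanNode j s k)) *
          exp (P.cumul (P.fanNode j s (k + 1))) := by
      have h9 := mul_le_mul_of_nonneg_right h2 (exp_pos (P.cumul (P.fanNode j s (k + 1)))).le
      have h10 := hwx _ f2
      linarith
    obtain ⟨g1, g3, g2⟩ := h3.jump h hKb (by linarith) he0 he1 f2 (by linarith) f3 (hR k hk hkq)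
      (by rw [f1, h1]; exact h.fanZ_succ_le (by omega)) hD
    refine ⟨f1, h2.trans g1, by push_cast; linarith, ?_, ?_⟩
    · push_cast
      refine g2.mono (le_of_eq ?_)
      ring
    -- The number of jumps times dx^α is at most the total variation of z in the fan, hence bounded.
    -- A fan of two states has one jump only.
    · have h11 : (((k + 1 : ℕ) : ℝ) - 1) * P.dx ^ P.α ≤ 2 * invBound M B + 1 := by
        have h12 : ((k + 1 : ℕ) : ℝ) ≤ P.fanSize (zInv P.θ ul) zend := by
          exact_mod_cast hkq.trans hq
        have h13 : ((P.fanSize (zInv P.θ ul) zend : ℝ) - 1) * P.dx ^ P.α ≤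
            2 * invBound M B + 1 := by
          have hwz : 0 ≤ P.dx ^ (P.β * P.θ) / P.θ :=
            div_nonneg (Real.rpow_pos_of_pos hd _).le hθ.le
          rcases (two_le_fanSize P (zInv P.θ ul) zend).eq_or_lt with h14 | h14
          · rw [← h14]; push_cast; linarith [h.invBound_pos]
          · have := h.fanSize_mul_le h14
            linarith [(abs_le.mp hzl').1, (abs_le.mp hwl').2]
        have : ((((k + 1 : ℕ) : ℝ) - 1)) * P.dx ^ P.α ≤
            ((P.fanSize (zInv P.θ ul) zend : ℝ) - 1) * P.dx ^ P.α :=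
          mul_le_mul_of_nonneg_right (by linarith) ha.le
        linarith
      have h12 := mul_le_mul_of_nonneg_right h11 (mul_nonneg hfs hη.le)
      unfold fanConst
      calc _ = (((k + 1 : ℕ) : ℝ) - 1) * P.dx ^ P.α * (fanStepConst γ B * P.errSize) := by ring
        _ ≤ _ := h12
        _ = _ := by ring

/-- In a fan of at least three states every jump raises `z`. -/
lemma fan_raises (h : Regime γ M B b₁ K P) (hK : fanThreshold γ M B b₁ ≤ K)
    {j : ℤ} {ul : State} {zend : ℝ} {q : ℕ} {s : ℕ → ℝ} {U : ℕ → State}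
    (hpos : 0 < ul.1) (hzl : P.lower (j * P.dx) ≤ zInv P.θ ul)
    (hwl : wInv P.θ ul ≤ P.upper (j * P.dx))
    (hend : zInv P.θ ul ≤ zend ∧ zend + 2 * (P.dx ^ (P.β * P.θ) / P.θ) ≤ wInv P.θ ul)
    (hF : P.IsFan j ul zend q s U) (hq : q ≤ P.fanSize (zInv P.θ ul) zend)
    (h3 : 3 ≤ P.fanSize (zInv P.θ ul) zend) :
    ∀ k, 1 ≤ k → k + 1 ≤ q →
      zInv P.θ (P.fanBlock j s U k (P.fanNode j s (k + 1))) ≤ zInv P.θ (U (k + 1)) := by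
  have hfc := h.fanConst_nonneg
  have hη := h.errSize_pos
  have hdisp := h.dispConst_nonneg
  have hb₁ := h.b₁_nonneg
  have hd := h.dx_pos
  have hθ := h.θ_pos
  have hfeB : 0 ≤ fanConst γ M B * exp B := mul_nonneg hfc (exp_pos _).le
  have hle_fc : fanConst γ M B ≤ fanConst γ M B * exp B := by nlinarith [h.one_le_exp_B]
  have hKb : b₁ ≤ K := by unfold fanThreshold at hK; linarith
  have hKd : 6 + 6 * dispConst M B b₁ ≤ K := by unfold fanThreshold at hK; linarith
  have hKf : fanConst γ M B ≤ K := by unfold fanThreshold at hK; linarith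
  have hu1 : BlockData P j (j * P.dx) ul 0 :=
    ⟨h.invCell_left j, hpos, scaled_lower.mpr hzl, by
      rw [add_zero]; exact scaled_upper.mpr hwl⟩
  obtain ⟨hzl', hwl'⟩ := hu1.abs_le h le_rfl zero_le_one
  intro k hk
  induction k using Nat.strong_induction_on with
  | _ k ih =>
    intro hkq
    -- The first k states form a fan whose jumps raise z by induction, so `fan_bounds` applies to
    -- them. The block then moves z by O(dx), less than the prescribed increment dx^α; this is why
    -- the fan needs at least three states.
    have hF' : P.IsFan j ul zend k s U := ⟨hF.1, fun i hi hik => hF.2 i hi (by omega)⟩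
    obtain ⟨h1, h2, -, h4⟩ := h.fan_bounds hK hpos hzl hwl (fun _ => hend) hF' (by omega)
      (fun i hi hik => ih i (by omega) hi (by omega)) hk le_rfl
    obtain ⟨f1, f2, f3, -⟩ := hF.2 k hk hkq
    have hfe0 : 0 ≤ fanConst γ M B * P.errSize := mul_nonneg hfc hη.le
    have hfe1 : fanConst γ M B * P.errSize ≤ 1 :=
      (mul_le_mul_of_nonneg_right hKf hη.le).trans h.errSize_small
    obtain ⟨h5, h6⟩ := h4.abs_le h hfe0 hfe1
    have hzk : zInv P.θ (U k) ≤ zend := by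
      rw [h1]
      rcases hk.eq_or_lt with rfl | hk2
      · rw [fanZ_one]; exact hend.1
      · exact h.fanZ_le hk2 (by omega)
    have hwk : wInv P.θ ul - dispConst M B b₁ * P.dx ≤ wInv P.θ (U k) := by
      have h9 := mul_le_mul_of_nonneg_right h2 (exp_pos (P.cumul (P.fanNode j s k))).le
      have h10 := h.abs_mul_exp_sub_le hKb
        (h.abs_cumul_sub_le_dx (IsFan.inCell h hF hk (by omega)) (h.invCell_left j)) hwl'
      rw [mul_assoc (wInv P.θ (U k)), ← Real.exp_add, mul_assoc, ← Real.exp_add] at h9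
      have e : -P.cumul (j * P.dx) + P.cumul (P.fanNode j s k) =
        P.cumul (P.fanNode j s k) - P.cumul (j * P.dx) := by ring
      rw [e] at h9
      simp at h9
      unfold dispConst
      linarith [(abs_le.mp h10).1]
    have hdβ : 6 * dispConst M B b₁ * P.dx < P.dx ^ (P.β * P.θ) / P.θ := by
      have h6 := mul_le_mul_of_nonneg_right hKd hd.le
      have h7 := h.dx_β
      have h8 : P.dx ^ (P.β * P.θ) ≤ P.dx ^ (P.β * P.θ) / P.θ := by
        rw [le_div_iff₀ hθ]
        have := Real.rpow_pos_of_pos hd (P.β * P.θ)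
        nlinarith [h.θ_le]
      linarith
    have hdpos : 0 ≤ dispConst M B b₁ * P.dx := by positivity
    obtain ⟨-, -, -, h7, -⟩ := h.steady_props hKb f2 h4.inCell h5 h6 (by linarith)
    have h8 := h.le_fanZ_succ h3 (hkq.trans hq)
    have h9 := mul_le_mul_of_nonneg_right hKd hd.le
    have h10 := h.small_dx
    rw [f1]
    unfold Scheme.fanBlock
    linarith [(abs_le.mp h7).2]

end Regime

/-! ### The left part of a regular cell: a fan and the state attached to it. -/

namespace Regime

variable {γ M B b₁ K : ℝ} {P : Scheme}

/-- A non-vacuum node value at `x`: it respects the bounds and is not too close to the vacuum. -/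
structure NodeData (P : Scheme) (x : ℝ) (u : State) : Prop where
  pos : 0 < u.1
  lower : P.lower x ≤ zInv P.θ u
  upper : wInv P.θ u ≤ P.upper x
  gap : P.dx ^ (P.δ * P.θ) ≤ wInv P.θ u - zInv P.θ u

lemma NodeData.abs_le (h : Regime γ M B b₁ K P) {x : ℝ} {u : State}
    (hu : NodeData P x u) : |zInv P.θ u| ≤ invBound M B ∧ |wInv P.θ u| ≤ invBound M B :=
  h.abs_inv_le (η := 0) zero_le_one (zInv_lt_wInv h.θ_pos hu.pos).le (by linarith [hu.lower])
    (by linarith [hu.upper])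

/-- The constants in `fanThreshold`, separated. -/
lemma fanThreshold_le (h : Regime γ M B b₁ K P) (hK : fanThreshold γ M B b₁ ≤ K) :
    b₁ ≤ K ∧ 6 + 6 * dispConst M B b₁ + fanConst γ M B * exp B ≤ K ∧
      fanConst γ M B ≤ fanConst γ M B * exp B ∧ fanConst γ M B * P.errSize ≤ 1 := by
  have hfc := h.fanConst_nonneg
  have hdisp := h.dispConst_nonneg
  have hb₁ := h.b₁_nonneg
  have hle_fc : fanConst γ M B ≤ fanConst γ M B * exp B := by nlinarith [h.one_le_exp_B]
  unfold fanThreshold at hK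
  refine ⟨by nlinarith, by linarith, hle_fc, ?_⟩
  exact (mul_le_mul_of_nonneg_right (by linarith) h.errSize_pos.le).trans h.errSize_small

/-- The first state inherits its distance from the vacuum from the node. The others have z ≤ zend,
while w has dropped by O(dx) at most. -/
lemma fan_gap (h : Regime γ M B b₁ K P) (hK : fanThreshold γ M B b₁ ≤ K)
    {j : ℤ} {ul : State} {zend : ℝ} {q : ℕ} {s : ℕ → ℝ} {U : ℕ → State}
    (hul : NodeData P (j * P.dx) ul)
    (hend : 2 ≤ q → zInv P.θ ul ≤ zend ∧ zend + 2 * (P.dx ^ (P.β * P.θ) / P.θ) ≤ wInv P.θ ul)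
    (hF : P.IsFan j ul zend q s U) (hq : q ≤ P.fanSize (zInv P.θ ul) zend)
    (hR : ∀ k, 1 ≤ k → k + 1 ≤ q →
      zInv P.θ (P.fanBlock j s U k (P.fanNode j s (k + 1))) ≤ zInv P.θ (U (k + 1)))
    {k : ℕ} (hk : 1 ≤ k) (hkq : k ≤ q) :
    wInv P.θ ul - dispConst M B b₁ * P.dx ≤ wInv P.θ (U k) ∧
    K * P.dx - dispConst M B b₁ * P.dx ≤ wInv P.θ (U k) - zInv P.θ (U k) := by
  obtain ⟨hKb, hKd, -, -⟩ := h.fanThreshold_le hK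
  obtain ⟨h1, h2, -, h4⟩ := h.fan_bounds hK hul.pos hul.lower hul.upper hend hF hq hR hk hkq
  have hd := h.dx_pos
  have hθ := h.θ_pos
  have hdisp : 0 ≤ dispConst M B b₁ * P.dx := mul_nonneg h.dispConst_nonneg hd.le
  obtain ⟨hzl', hwl'⟩ := hul.abs_le h
  have hwk : wInv P.θ ul - dispConst M B b₁ * P.dx ≤ wInv P.θ (U k) := by
    have h9 := mul_le_mul_of_nonneg_right h2 (exp_pos (P.cumul (P.fanNode j s k))).le
    have h10 := h.abs_mul_exp_sub_le hKb
      (h.abs_cumul_sub_le_dx (IsFan.inCell h hF hk hkq) (h.invCell_left j)) hwl'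
    rw [mul_assoc (wInv P.θ (U k)), ← Real.exp_add, mul_assoc, ← Real.exp_add] at h9
    have e : -P.cumul (j * P.dx) + P.cumul (P.fanNode j s k) =
      P.cumul (P.fanNode j s k) - P.cumul (j * P.dx) := by ring
    rw [e] at h9
    simp at h9
    unfold dispConst
    linarith [(_root_.abs_le.mp h10).1]
  refine ⟨hwk, ?_⟩
  rcases hk.eq_or_lt with rfl | hk2
  · rw [hF.1]
    have := hul.gap
    have := h.dx_δ
    linarith
  · have hz : zInv P.θ (U k) ≤ zend := by
      rw [h1]; exact h.fanZ_le hk2 (hkq.trans hq)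
    have h8 : P.dx ^ (P.β * P.θ) ≤ P.dx ^ (P.β * P.θ) / P.θ := by
      rw [le_div_iff₀ hθ]
      have := Real.rpow_pos_of_pos hd (P.β * P.θ)
      nlinarith [h.θ_le]
    have h9 := h.dx_β
    have h10 := (hend (by omega)).2
    have h11 := Real.rpow_pos_of_pos hd (P.β * P.θ)
    linarith

/-- The left part of a regular cell: the fan of `ul` aiming at the middle density `r`, and the
state `u'` attached to its last block at the point `x₁` by a 1-jump of speed `s₁`. -/
structure LeftPart (P : Scheme) (j : ℤ) (ul : State) (r : ℝ) (s : ℕ → ℝ) (U : ℕ → State)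
    (x₁ s₁ : ℝ) (u' : State) : Prop where
  node : NodeData P (j * P.dx) ul
  r_pos : 0 < r
  r_ge : P.dx ^ (P.β * P.θ) ≤ r ^ P.θ
  isFan : P.IsFan j ul (waveVel P.γ P.θ ul r - r ^ P.θ / P.θ)
    (P.fanSize (zInv P.θ ul) (waveVel P.γ P.θ ul r - r ^ P.θ / P.θ) - 1) s U
  inCell : P.InCell j x₁
  x_eq : x₁ = P.mid j + s₁ * P.dt / 2
  jump : OneJump P.γ s₁ (P.fanBlock j s U
    (P.fanSize (zInv P.θ ul) (waveVel P.γ P.θ ul r - r ^ P.θ / P.θ) - 1) x₁) u'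

lemma waveVel_of_le {γ θ r : ℝ} {ul : State} (h : r ≤ ul.1) :
    waveVel γ θ ul r = wInv θ ul - r ^ θ / θ := by
  rw [waveVel, if_pos h, wInv, sub_div]; ring

lemma waveVel_of_lt {γ θ r : ℝ} {ul : State} (hl : 0 < ul.1) (h : ul.1 < r) :
    waveVel γ θ ul r = vel ul - jumpVel γ r ul.1 := by
  have hr : 0 < r := hl.trans h
  rw [waveVel, if_neg (not_le.mpr h), jumpVel]
  congr 1
  have h1 : 0 ≤ r - ul.1 := by linarith
  have h2 : r - ul.1 ≠ 0 := by linarith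
  conv_lhs => rw [← Real.sqrt_sq h1, ← Real.sqrt_mul' _ (sq_nonneg _)]
  congr 1
  rw [Real.sqrt_sq h1]
  field_simp

lemma waveVel_le {γ θ r : ℝ} {ul : State} (hγ : γ = 1 + 2 * θ) (hθ : 0 < θ) (hl : 0 < ul.1) :
    waveVel γ θ ul r ≤ wInv θ ul - r ^ θ / θ := by
  rcases le_or_gt r ul.1 with h | h
  · exact (waveVel_of_le h).le
  · rw [waveVel_of_lt hl h]
    have h1 := rarefaction_le_jumpVel hγ hθ hl h.le
    rw [sub_div] at h1
    unfold wInv; linarith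

namespace LeftPart

variable {j : ℤ} {ul u' : State} {r x₁ s₁ : ℝ} {s : ℕ → ℝ} {U : ℕ → State}

/-- The fan has p - 1 states. If there is a jump at all then p ≥ 3, which rules out a shock and
allows `fan_raises`. -/
lemma fan_hyps (h : Regime γ M B b₁ K P) (hK : fanThreshold γ M B b₁ ≤ K)
    (H : LeftPart P j ul r s U x₁ s₁ u') :
    (2 ≤ P.fanSize (zInv P.θ ul) (waveVel P.γ P.θ ul r - r ^ P.θ / P.θ) - 1 →
      zInv P.θ ul ≤ waveVel P.γ P.θ ul r - r ^ P.θ / P.θ ∧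
      waveVel P.γ P.θ ul r - r ^ P.θ / P.θ + 2 * (P.dx ^ (P.β * P.θ) / P.θ) ≤ wInv P.θ ul) ∧
    (∀ k, 1 ≤ k → k + 1 ≤ P.fanSize (zInv P.θ ul) (waveVel P.γ P.θ ul r - r ^ P.θ / P.θ) - 1 →
      zInv P.θ (P.fanBlock j s U k (P.fanNode j s (k + 1))) ≤ zInv P.θ (U (k + 1))) := by
  have hθ := h.θ_pos
  have h1 : 2 ≤ P.fanSize (zInv P.θ ul) (waveVel P.γ P.θ ul r - r ^ P.θ / P.θ) - 1 →
      zInv P.θ ul ≤ waveVel P.γ P.θ ul r - r ^ P.θ / P.θ ∧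
      waveVel P.γ P.θ ul r - r ^ P.θ / P.θ + 2 * (P.dx ^ (P.β * P.θ) / P.θ) ≤ wInv P.θ ul := by
    intro h2
    constructor
    · by_contra hlt
      rw [h.fanSize_eq_two (not_le.mp hlt).le] at h2
      omega
    · have h3 := waveVel_le (r := r) h.γ_eq' hθ H.node.pos
      have h4 := div_le_div_of_nonneg_right H.r_ge hθ.le
      linarith
  refine ⟨h1, fun k hk hkq => ?_⟩
  exact h.fan_raises hK H.node.pos H.node.lower H.node.upper (h1 (by omega)) H.isFan (by omega)
    (by omega) k hk hkq

/-- The last block of the fan at the point `x₁`. -/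
def lastBlock (P : Scheme) (j : ℤ) (ul : State) (r : ℝ) (s : ℕ → ℝ) (U : ℕ → State) (x₁ : ℝ) :
    State :=
  P.fanBlock j s U (P.fanSize (zInv P.θ ul) (waveVel P.γ P.θ ul r - r ^ P.θ / P.θ) - 1) x₁

lemma block (h : Regime γ M B b₁ K P) (hK : fanThreshold γ M B b₁ ≤ K)
    (H : LeftPart P j ul r s U x₁ s₁ u') {k : ℕ} (hk : 1 ≤ k)
    (hkq : k ≤ P.fanSize (zInv P.θ ul) (waveVel P.γ P.θ ul r - r ^ P.θ / P.θ) - 1) :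
    BlockData P j (P.fanNode j s k) (U k) (fanConst γ M B * P.errSize) ∧
      K * P.dx - dispConst M B b₁ * P.dx ≤ wInv P.θ (U k) - zInv P.θ (U k) := by
  obtain ⟨h1, h2⟩ := H.fan_hyps h hK
  exact ⟨(h.fan_bounds hK H.node.pos H.node.lower H.node.upper h1 H.isFan (by omega) h2 hk
      hkq).2.2.2,
    (h.fan_gap hK H.node h1 H.isFan (by omega) h2 hk hkq).2⟩

set_option maxHeartbeats 800000 in
/-- The last block of the fan: its invariants, compared with those of `ul` and with `r`. -/
lemma lastBlock_props (h : Regime γ M B b₁ K P) (hK : fanThreshold γ M B b₁ ≤ K)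
    (H : LeftPart P j ul r s U x₁ s₁ u') :
    BlockData P j x₁ (lastBlock P j ul r s U x₁) (fanConst γ M B * P.errSize) ∧
    wInv P.θ ul - dispConst M B b₁ * P.dx ≤ wInv P.θ (lastBlock P j ul r s U x₁) ∧
    (lastBlock P j ul r s U x₁).1 ^ P.θ ≤ r ^ P.θ + 3 * P.dx ^ P.α ∧
    (r ≤ ul.1 → r ^ P.θ - dispConst M B b₁ * P.dx ≤ (lastBlock P j ul r s U x₁).1 ^ P.θ) ∧
    (ul.1 < r → |zInv P.θ (lastBlock P j ul r s U x₁) - zInv P.θ ul| ≤ dispConst M B b₁ * P.dx ∧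
      |wInv P.θ (lastBlock P j ul r s U x₁) - wInv P.θ ul| ≤ dispConst M B b₁ * P.dx) := by
  obtain ⟨hKb, hKd, hfe, hfe1⟩ := h.fanThreshold_le hK
  obtain ⟨h1, h2⟩ := H.fan_hyps h hK
  have hp2 := two_le_fanSize P (zInv P.θ ul) (waveVel P.γ P.θ ul r - r ^ P.θ / P.θ)
  have hd := h.dx_pos
  have hθ := h.θ_pos
  have hθ3 := h.θ_le
  have hdisp : 0 ≤ dispConst M B b₁ * P.dx := mul_nonneg h.dispConst_nonneg hd.le
  have hfc := h.fanConst_nonneg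
  have hη := h.errSize_pos
  have hfeB : 0 ≤ fanConst γ M B * exp B := mul_nonneg hfc (exp_pos _).le
  have hfe0 : 0 ≤ fanConst γ M B * P.errSize := mul_nonneg hfc hη.le
  have ha : 0 < P.dx ^ P.α := Real.rpow_pos_of_pos hd _
  have hsd := h.small_dx
  have hKdd := mul_le_mul_of_nonneg_right hKd hd.le
  have hnn := mul_nonneg hfeB hd.le
  obtain ⟨hzl', hwl'⟩ := H.node.abs_le h
  set zend := waveVel P.γ P.θ ul r - r ^ P.θ / P.θ with hzend
  set p := P.fanSize (zInv P.θ ul) zend with hp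
  have hk1 : 1 ≤ p - 1 := by omega
  obtain ⟨f1, f2, f3, f4⟩ := h.fan_bounds hK H.node.pos H.node.lower H.node.upper h1 H.isFan
    (by omega) h2 hk1 le_rfl
  obtain ⟨g1, g2⟩ := h.fan_gap hK H.node h1 H.isFan (by omega) h2 hk1 le_rfl
  obtain ⟨a1, a2⟩ := f4.abs_le h hfe0 hfe1
  have hlt : 2 * dispConst M B b₁ * P.dx < wInv P.θ (U (p - 1)) - zInv P.θ (U (p - 1)) := by
    linarith
  obtain ⟨p1, p2, p3, p4, p5⟩ := h.steady_props hKb H.inCell f4.inCell a1 a2 hlt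
  have hb := f4.steady h hKb hfe0 hfe1 H.inCell hlt
  have hl : lastBlock P j ul r s U x₁ =
    P.steady x₁ (P.fanNode j s (p - 1)) (U (p - 1)) := rfl
  rw [← hl] at p1 p2 p3 p4 p5 hb
  have hws : wInv P.θ (lastBlock P j ul r s U x₁) =
      wInv P.θ (U (p - 1)) * exp (-P.cumul (P.fanNode j s (p - 1))) * exp (P.cumul x₁) := by
    rw [p3, mul_assoc, ← Real.exp_add]; ring_nf
  have hx1 := h.abs_mul_exp_sub_le hKb (h.abs_cumul_sub_le_dx H.inCell (h.invCell_left j)) hwl'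
  have hux : wInv P.θ ul * exp (-P.cumul (j * P.dx)) * exp (P.cumul x₁) =
      wInv P.θ ul * exp (P.cumul x₁ - P.cumul (j * P.dx)) := by
    rw [mul_assoc, ← Real.exp_add]; ring_nf
  have hwlow : wInv P.θ ul - dispConst M B b₁ * P.dx ≤ wInv P.θ (lastBlock P j ul r s U x₁) := by
    have := mul_le_mul_of_nonneg_right f2 (exp_pos (P.cumul x₁)).le
    rw [hws]
    rw [hux] at this
    unfold dispConst
    linarith [(_root_.abs_le.mp hx1).1]
  have hwup : wInv P.θ (lastBlock P j ul r s U x₁) ≤ wInv P.θ ul + dispConst M B b₁ * P.dx +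
      fanConst γ M B * exp B * P.dx := by
    have h5 := mul_le_mul_of_nonneg_right f3 (exp_pos (P.cumul x₁)).le
    rw [add_mul, hux, ← hws] at h5
    have h6 : exp (P.cumul x₁) ≤ exp B := exp_le_exp.mpr (_root_.abs_le.mp (h.mass x₁)).2
    have h7 : fanConst γ M B * P.errSize * exp (P.cumul x₁) ≤
        fanConst γ M B * exp B * P.dx := by
      calc _ ≤ fanConst γ M B * P.dx * exp B := by
            gcongr; exact h.errSize_le
        _ = _ := by ring
    unfold dispConst
    linarith [(_root_.abs_le.mp hx1).2]
  have hc := rpow_eq hθ.ne' (lastBlock P j ul r s U x₁)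
  have hcL := rpow_eq hθ.ne' ul
  -- For a shock z falls, so p = 2 and the only block is that of ul itself.
  have hstep2 : ul.1 < r → |zInv P.θ (lastBlock P j ul r s U x₁) - zInv P.θ ul| ≤
        dispConst M B b₁ * P.dx ∧
      |wInv P.θ (lastBlock P j ul r s U x₁) - wInv P.θ ul| ≤ dispConst M B b₁ * P.dx := by
    intro hlr
    have hle : zend ≤ zInv P.θ ul := by
      have h3 := waveVel_le (r := r) h.γ_eq' hθ H.node.pos
      have h4 : ul.1 ^ P.θ / P.θ ≤ r ^ P.θ / P.θ :=
        div_le_div_of_nonneg_right (Real.rpow_le_rpow H.node.pos.le hlr.le hθ.le) hθ.le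
      have h5 : wInv P.θ ul - zInv P.θ ul = 2 * (ul.1 ^ P.θ / P.θ) := by
        unfold wInv zInv; ring
      rw [hzend]; linarith
    have hp2' : p - 1 = 1 := by rw [hp, h.fanSize_eq_two hle]
    rw [hp2', H.isFan.1] at p4 p5
    exact ⟨p4, p5⟩
  refine ⟨hb, hwlow, ?_, fun hrl => ?_, hstep2⟩
  · rcases le_or_gt r ul.1 with hrl | hlr
    -- The fan stops one state before its target, which costs at most one increment of z.
    · have hz1 : zend - 2 * P.dx ^ P.α ≤ zInv P.θ (U (p - 1)) := by
        have := h.fanZ_succ_le (zl := zInv P.θ ul) (zend := zend) (k := p - 1) (by omega)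
        rw [← f1, show p - 1 + 1 = p by omega] at this
        have e : P.fanZ (zInv P.θ ul) zend p = zend := by
          unfold Scheme.fanZ; rw [if_pos hp]
        linarith
      have hze : wInv P.θ ul - zend = 2 * (r ^ P.θ / P.θ) := by
        rw [hzend, waveVel_of_le hrl]; ring
      have e1 : P.θ * (2 * (r ^ P.θ / P.θ)) = 2 * r ^ P.θ := by field_simp
      have h6 : wInv P.θ (lastBlock P j ul r s U x₁) - zInv P.θ (lastBlock P j ul r s U x₁) ≤
          2 * (r ^ P.θ / P.θ) + 6 * P.dx ^ P.α := by
        linarith [(_root_.abs_le.mp p4).1]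
      have h7 := mul_le_mul_of_nonneg_left h6 hθ.le
      rw [mul_add, e1] at h7
      have h8 : P.θ * (6 * P.dx ^ P.α) ≤ 1 * (6 * P.dx ^ P.α) :=
        mul_le_mul_of_nonneg_right (by linarith) (by linarith)
      rw [hc]; linarith
    · obtain ⟨q1, q2⟩ := hstep2 hlr
      have h3 : ul.1 ^ P.θ ≤ r ^ P.θ := Real.rpow_le_rpow H.node.pos.le hlr.le hθ.le
      have h6 : wInv P.θ (lastBlock P j ul r s U x₁) - zInv P.θ (lastBlock P j ul r s U x₁) ≤
          (wInv P.θ ul - zInv P.θ ul) + 6 * P.dx ^ P.α := by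
        linarith [(_root_.abs_le.mp q1).1, (_root_.abs_le.mp q2).2]
      have h7 := mul_le_mul_of_nonneg_left h6 hθ.le
      rw [mul_add] at h7
      have h8 : P.θ * (6 * P.dx ^ P.α) ≤ 1 * (6 * P.dx ^ P.α) :=
        mul_le_mul_of_nonneg_right (by linarith) (by linarith)
      rw [hc]; linarith
  · have hz1 : zInv P.θ (U (p - 1)) ≤ zend := by
      rw [f1]
      rcases hk1.eq_or_lt with he | hk2
      · rw [← he, fanZ_one]
        have h4 : r ^ P.θ / P.θ ≤ ul.1 ^ P.θ / P.θ :=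
          div_le_div_of_nonneg_right (Real.rpow_le_rpow H.r_pos.le hrl hθ.le) hθ.le
        rw [hzend, waveVel_of_le hrl]; unfold zInv wInv; linarith
      · exact h.fanZ_le hk2 (by omega)
    have hze : wInv P.θ ul - zend = 2 * (r ^ P.θ / P.θ) := by
      rw [hzend, waveVel_of_le hrl]; ring
    have e1 : P.θ * (2 * (r ^ P.θ / P.θ)) = 2 * r ^ P.θ := by field_simp
    have h6 : 2 * (r ^ P.θ / P.θ) - 2 * (dispConst M B b₁ * P.dx) ≤
        wInv P.θ (lastBlock P j ul r s U x₁) - zInv P.θ (lastBlock P j ul r s U x₁) := by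
      linarith [(_root_.abs_le.mp p4).2]
    have h7 := mul_le_mul_of_nonneg_left h6 hθ.le
    rw [mul_sub, e1] at h7
    have h8 : P.θ * (2 * (dispConst M B b₁ * P.dx)) ≤ 1 * (2 * (dispConst M B b₁ * P.dx)) :=
      mul_le_mul_of_nonneg_right (by linarith) (by linarith)
    rw [hc]; linarith

/-- The base point at the middle time lies in the cell, so the mesh ratio bounds the speed. It is
the only a priori information about the attached state. -/
lemma speed_bound (h : Regime γ M B b₁ K P) (H : LeftPart P j ul r s U x₁ s₁ u') :
    |s₁| ≤ 2 * invBound M B := by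
  have h1 := H.inCell
  rw [H.x_eq] at h1
  have hd := h.dx_pos
  have ht := h.dt_pos
  have h2 : |s₁ * P.dt| ≤ P.dx := by
    obtain ⟨h3, h4⟩ := h1
    unfold Scheme.mid at h3 h4
    rw [_root_.abs_le]; constructor <;> linarith
  rw [abs_mul, abs_of_pos ht, h.cfl] at h2
  have h3 : |s₁| ≤ 2 * M * exp B := by
    have : |s₁| * P.dt ≤ (2 * M * exp B) * P.dt := by linarith
    exact le_of_mul_le_mul_right this ht
  unfold invBound
  nlinarith [exp_pos B]

lemma vel_abs_le {θ G : ℝ} {u : State} (hz : |zInv θ u| ≤ G) (hw : |wInv θ u| ≤ G) :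
    |vel u| ≤ G := by
  rw [vel_eq θ u]
  rw [_root_.abs_le] at *
  constructor <;> linarith [hz.1, hz.2, hw.1, hw.2]

lemma rpow_le_of_abs {θ G : ℝ} {u : State} (h0 : 0 < θ) (h1 : θ ≤ 1) (hz : |zInv θ u| ≤ G)
    (hw : |wInv θ u| ≤ G) : u.1 ^ θ ≤ G := by
  rw [rpow_eq h0.ne']
  rw [_root_.abs_le] at *
  have : 0 ≤ G := by linarith [hz.1, hz.2]
  have h3 : wInv θ u - zInv θ u ≤ 2 * G := by linarith [hz.1, hw.2]
  nlinarith

/-- A priori bounds for the state attached to the fan. -/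
lemma attached_bounds (h : Regime γ M B b₁ K P) (hK : fanThreshold γ M B b₁ ≤ K)
    (H : LeftPart P j ul r s U x₁ s₁ u') :
    -(4 * invBound M B) ≤ vel u' ∧ u'.1 ^ P.θ ≤ 4 * invBound M B ∧
    ((lastBlock P j ul r s U x₁).1 < u'.1 →
      shockS P.γ u'.1 (lastBlock P j ul r s U x₁).1 ≤ 3 * invBound M B) := by
  obtain ⟨hKb, hKd, hfe, hfe1⟩ := h.fanThreshold_le hK
  have hfe0 : 0 ≤ fanConst γ M B * P.errSize := mul_nonneg h.fanConst_nonneg h.errSize_pos.le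
  obtain ⟨hb, -, -, -, -⟩ := H.lastBlock_props h hK
  obtain ⟨a1, a2⟩ := hb.abs_le h hfe0 hfe1
  have hθ := h.θ_pos
  have hG := h.invBound_pos
  have hv := _root_.abs_le.mp (vel_abs_le a1 a2)
  have hc := rpow_le_of_abs hθ (by linarith [h.θ_le]) a1 a2
  have hs := _root_.abs_le.mp (H.speed_bound h)
  have hj : OneJump P.γ s₁ (lastBlock P j ul r s U x₁) u' := H.jump
  -- The jump formula s₁ = v - S turns the bound of the speed into one of the shock strength. Its
  -- expression by S and the density ratio then bounds the velocity jump, and with it the density.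
  have hS : shockS P.γ u'.1 (lastBlock P j ul r s U x₁).1 ≤ 3 * invBound M B := by
    have := hj.2.2.2
    linarith
  refine ⟨?_, ?_, fun _ => hS⟩
  · rcases le_or_gt u'.1 (lastBlock P j ul r s U x₁).1 with hle | hlt
    · rw [hj.vel_of_ge h.γ_eq' hθ hle]
      linarith [jumpVel_nonneg P.γ (lastBlock P j ul r s U x₁).1 u'.1]
    · rw [hj.vel_of_le h.γ_eq' hθ hlt.le, jumpVel_eq_shockS h.γ_eq' hθ hj.1 hlt]
      have h2 : (u'.1 - (lastBlock P j ul r s U x₁).1) / u'.1 ≤ 1 := by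
        rw [div_le_one hj.2.1]; linarith [hj.1]
      have h3 : 0 ≤ shockS P.γ u'.1 (lastBlock P j ul r s U x₁).1 :=
        (Real.rpow_nonneg hj.1.le _).trans (le_shockS h.γ_eq' hθ hj.1 hlt)
      nlinarith
  · rcases le_or_gt u'.1 (lastBlock P j ul r s U x₁).1 with hle | hlt
    · have := Real.rpow_le_rpow hj.2.1.le hle hθ.le
      linarith
    · have h1 := rarefaction_le_jumpVel h.γ_eq' hθ hj.1 hlt.le
      rw [jumpVel_eq_shockS h.γ_eq' hθ hj.1 hlt, div_le_iff₀ hθ] at h1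
      have h2 : (u'.1 - (lastBlock P j ul r s U x₁).1) / u'.1 ≤ 1 := by
        rw [div_le_one hj.2.1]; linarith [hj.1]
      have h3 : 0 ≤ shockS P.γ u'.1 (lastBlock P j ul r s U x₁).1 :=
        (Real.rpow_nonneg hj.1.le _).trans (le_shockS h.γ_eq' hθ hj.1 hlt)
      have h4 : shockS P.γ u'.1 (lastBlock P j ul r s U x₁).1 *
          ((u'.1 - (lastBlock P j ul r s U x₁).1) / u'.1) ≤ 3 * invBound M B := by nlinarith
      have h5 := h.θ_le
      nlinarith

end LeftPart

end Regime

/-! ### Comparison of the attached state with the exact wave curve. -/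

lemma two_rpow_sub_one_nonneg {θ : ℝ} (hθ : 0 < θ) : 0 ≤ (2 : ℝ) ^ (1 / θ) - 1 := by
  have : (1 : ℝ) ≤ 2 ^ (1 / θ) := Real.one_le_rpow (by norm_num) (by positivity)
  linarith

/-- Comparison of a shock issuing from a perturbation `l` of `ul` with the wave curve of `ul`. -/
lemma OneJump.waveVel_le_of_shock {γ θ s r d e S₀ : ℝ} {ul l u' : State} (hγ : γ = 1 + 2 * θ)
    (hθ : 0 < θ) (hθ1 : θ ≤ 1) (hj : OneJump γ s l u') (hul : 0 < ul.1) (hlr : ul.1 < r)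
    (hlu : l.1 < u'.1) (hur : u'.1 < r) (hd : 0 ≤ d) (hv : vel ul - d ≤ vel l)
    (hc : ul.1 ^ θ ≤ l.1 ^ θ + d) (hdc : d ≤ l.1 ^ θ) (hde : d / l.1 ^ θ ≤ e)
    (hS : shockS γ u'.1 l.1 ≤ S₀) :
    waveVel γ θ ul r + (r ^ θ - u'.1 ^ θ) / θ -
      (d * (1 + 2 / θ + devConst θ + 4 * (2 ^ (1 / θ) - 1)) + S₀ * ((2 ^ (1 / θ) - 1) * e)) ≤
      vel u' := by
  have hN := two_rpow_sub_one_nonneg hθ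
  have hdev := devConst_nonneg hθ
  have hl := hj.1
  have hlθ : 0 < l.1 ^ θ := Real.rpow_pos_of_pos hl θ
  have hS0 : 0 ≤ shockS γ u'.1 l.1 := (Real.rpow_nonneg hl.le _).trans (le_shockS hγ hθ hl hlu)
  have he : 0 ≤ e := (div_nonneg hd hlθ.le).trans hde
  have hnn : 0 ≤ S₀ * ((2 ^ (1 / θ) - 1) * e) := mul_nonneg (hS0.trans hS) (mul_nonneg hN he)
  rw [Regime.waveVel_of_lt hul hlr, hj.vel_of_le hγ hθ hlu.le]
  have hx : d * (1 + 2 / θ + devConst θ + 4 * (2 ^ (1 / θ) - 1)) =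
    d + 2 * (d / θ) + d * devConst θ + 4 * (2 ^ (1 / θ) - 1) * d := by ring
  rw [hx]
  have h1 : 0 ≤ d / θ := div_nonneg hd hθ.le
  have h2 : 0 ≤ d * devConst θ := mul_nonneg hd hdev
  have h3 : 0 ≤ 4 * (2 ^ (1 / θ) - 1) * d := by positivity
  -- If u' is less dense than ul, it lies between l and ul. The jump from l is then of size O(d),
  -- and the curve from ul to r is compared with the rarefaction alone.
  rcases lt_or_ge u'.1 ul.1 with hlt | hge
  · have h4 := rarefaction_le_jumpVel hγ hθ hul hlr.le
    have h5 : l.1 ^ θ ≤ u'.1 ^ θ := Real.rpow_le_rpow hl.le hlu.le hθ.le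
    have h6 : u'.1 ^ θ ≤ ul.1 ^ θ := Real.rpow_le_rpow hj.2.1.le hlt.le hθ.le
    have h7 := jumpVel_le hγ hθ hθ1 hl hlu.le (by linarith)
    have h8 : (u'.1 ^ θ - l.1 ^ θ) ^ 3 / (l.1 ^ θ) ^ 2 ≤ d := by
      rw [div_le_iff₀ (by positivity)]
      have h9 : (u'.1 ^ θ - l.1 ^ θ) ^ 3 ≤ d ^ 3 :=
        pow_le_pow_left₀ (by linarith) (by linarith) 3
      have h10 : d ^ 2 ≤ (l.1 ^ θ) ^ 2 := pow_le_pow_left₀ hd hdc 2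
      nlinarith
    have h9 : devConst θ * ((u'.1 ^ θ - l.1 ^ θ) ^ 3 / (l.1 ^ θ) ^ 2) ≤ d * devConst θ := by
      rw [mul_comm d]; exact mul_le_mul_of_nonneg_left h8 hdev
    have h10 : (u'.1 ^ θ - l.1 ^ θ) / θ ≤ d / θ := div_le_div_of_nonneg_right (by linarith) hθ.le
    have h11 : (r ^ θ - u'.1 ^ θ) / θ ≤ (r ^ θ - ul.1 ^ θ) / θ + d / θ := by
      rw [← add_div]; exact div_le_div_of_nonneg_right (by linarith) hθ.le
    unfold devConst at *
    linarith
  -- Otherwise split the jump from ul to r at the density of u'. The upper piece is at least a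
  -- rarefaction, and the lower one differs from the jump issuing from l by the stability estimate.
  · have h4 := jumpVel_superadditive hγ hθ hul hge hur.le
    have h5 := rarefaction_le_jumpVel hγ hθ hj.2.1 hur.le
    suffices h6 : jumpVel γ u'.1 l.1 ≤ jumpVel γ u'.1 ul.1 + 4 * (2 ^ (1 / θ) - 1) * d +
        S₀ * ((2 ^ (1 / θ) - 1) * e) by linarith
    rcases le_or_gt ul.1 l.1 with h6 | h6
    · have := jumpVel_anti_right hγ hθ hul h6 hlu.le
      linarith
    · have h7 := jumpVel_stability hγ hθ hθ1 hl h6.le hge hlu (by linarith)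
      have h8 : ul.1 ^ θ - l.1 ^ θ ≤ d := by linarith
      have h8' : 0 ≤ ul.1 ^ θ - l.1 ^ θ :=
        sub_nonneg.mpr (Real.rpow_le_rpow hl.le h6.le hθ.le)
      have h9 : 4 * (2 ^ (1 / θ) - 1) * (ul.1 ^ θ - l.1 ^ θ) ≤ 4 * (2 ^ (1 / θ) - 1) * d := by
        gcongr
      have h10 : (ul.1 ^ θ - l.1 ^ θ) / l.1 ^ θ ≤ e :=
        (div_le_div_of_nonneg_right h8 hlθ.le).trans hde
      have h11 : shockS γ u'.1 l.1 * ((2 ^ (1 / θ) - 1) * ((ul.1 ^ θ - l.1 ^ θ) / l.1 ^ θ)) ≤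
          S₀ * ((2 ^ (1 / θ) - 1) * e) := by
        apply mul_le_mul hS _ _ (hS0.trans hS)
        · exact mul_le_mul_of_nonneg_left h10 hN
        · exact mul_nonneg hN (div_nonneg h8' hlθ.le)
      linarith

/-- The effect on a non-vacuum state of multiplying the invariants by factors close to one; the
result may be degenerate (`z > w`). -/
lemma ofZW_perturb {θ z w p q ε : ℝ} (hθ : 0 < θ) (hzw : z < w) (hp : |p| ≤ ε) (hq : |q| ≤ ε)
    (hpos : 0 < (ofZW θ (z * (1 + q)) (w * (1 + p))).1) :
    |vel (ofZW θ (z * (1 + q)) (w * (1 + p))) - (w + z) / 2| ≤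
      ε * (|(w + z) / 2| + (w - z) / 2) ∧
    (ofZW θ (z * (1 + q)) (w * (1 + p))).1 ^ θ ≤
      θ * ((w - z) / 2 + ε * (|(w + z) / 2| + (w - z) / 2)) ∧
    θ * ((w - z) / 2 - ε * (|(w + z) / 2| + (w - z) / 2)) ≤
      (ofZW θ (z * (1 + q)) (w * (1 + p))).1 ^ θ ∧
    (w - z) / 2 - ε * (|(w + z) / 2| + (w - z) / 2) ≤ (w * (1 + p) - z * (1 + q)) / 2 := by
  have hε : 0 ≤ ε := (abs_nonneg p).trans hp
  -- The perturbation is relative to the sizes of z and w, which are bounded by |v| plus half of the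
  -- gap.
  have hzabs : |z| ≤ |(w + z) / 2| + (w - z) / 2 := by
    have e : z = (w + z) / 2 - (w - z) / 2 := by ring
    have h2 : |(w - z) / 2| = (w - z) / 2 := abs_of_nonneg (by linarith)
    calc |z| = |(w + z) / 2 - (w - z) / 2| := by rw [← e]
      _ ≤ |(w + z) / 2| + |(w - z) / 2| := abs_sub _ _
      _ = _ := by rw [h2]
  have hwabs : |w| ≤ |(w + z) / 2| + (w - z) / 2 := by
    have e : w = (w + z) / 2 + (w - z) / 2 := by ring
    have h2 : |(w - z) / 2| = (w - z) / 2 := abs_of_nonneg (by linarith)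
    calc |w| = |(w + z) / 2 + (w - z) / 2| := by rw [← e]
      _ ≤ |(w + z) / 2| + |(w - z) / 2| := abs_add_le _ _
      _ = _ := by rw [h2]
  set Q := |(w + z) / 2| + (w - z) / 2 with hQ
  have hQ0 : 0 ≤ Q := (abs_nonneg z).trans hzabs
  have h1 : |z * q| ≤ ε * Q := by
    rw [abs_mul, mul_comm ε]; exact mul_le_mul hzabs hq (abs_nonneg _) hQ0
  have h2 : |w * p| ≤ ε * Q := by
    rw [abs_mul, mul_comm ε]; exact mul_le_mul hwabs hp (abs_nonneg _) hQ0
  rw [abs_le] at h1 h2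
  have hlow : (w - z) / 2 - ε * Q ≤ (w * (1 + p) - z * (1 + q)) / 2 := by
    linarith [h1.1, h1.2, h2.1, h2.2]
  have hup : (w * (1 + p) - z * (1 + q)) / 2 ≤ (w - z) / 2 + ε * Q := by
    linarith [h1.1, h1.2, h2.1, h2.2]
  refine ⟨?_, ?_, ?_, hlow⟩
  · rw [vel_ofZW_of_pos hpos, abs_le]
    constructor <;> linarith [h1.1, h1.2, h2.1, h2.2]
  · refine (ofZW_rpow_le hθ hpos).trans ?_
    have h3 : |w * (1 + p) - z * (1 + q)| ≤ 2 * ((w - z) / 2 + ε * Q) := by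
      rw [abs_le]; constructor <;> linarith [h1.1, h1.2, h2.1, h2.2]
    nlinarith
  · rcases le_or_gt ((w - z) / 2 - ε * Q) 0 with h3 | h3
    · have := Real.rpow_pos_of_pos hpos θ
      nlinarith
    · rw [ofZW_rpow hθ (by linarith)]
      nlinarith

namespace Regime

variable {γ M B b₁ K : ℝ} {P : Scheme}

/-- The constant in the comparison of velocities. -/
def velConst (γ M B b₁ : ℝ) : ℝ :=
  dispConst M B b₁ * (1 + 2 / ((γ - 1) / 2) + devConst ((γ - 1) / 2) +
    4 * (2 ^ (1 / ((γ - 1) / 2)) - 1)) +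
  3 * invBound M B * ((2 ^ (1 / ((γ - 1) / 2)) - 1) * (4 * dispConst M B b₁ / ((γ - 1) / 2)))

lemma velConst_ge (h : Regime γ M B b₁ K P) : dispConst M B b₁ ≤ velConst γ M B b₁ := by
  have h1 := h.dispConst_nonneg
  have h2 := h.invBound_pos
  have h3 := devConst_nonneg h.θ_pos
  have h4 := two_rpow_sub_one_nonneg h.θ_pos
  have h5 := h.θ_pos
  rw [h.θ_eq] at h3 h4 h5
  unfold velConst
  have h6 : 0 ≤ 2 / ((γ - 1) / 2) := by positivity
  have h7 : 0 ≤ 3 * invBound M B *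
    ((2 ^ (1 / ((γ - 1) / 2)) - 1) * (4 * dispConst M B b₁ / ((γ - 1) / 2))) := by positivity
  nlinarith

namespace LeftPart

variable {j : ℤ} {ul u' : State} {r x₁ s₁ : ℝ} {s : ℕ → ℝ} {U : ℕ → State}

/-- The attached state is not far below the density `r`, or its velocity is bounded below by the
value on the wave curve. -/
lemma attached_vel (h : Regime γ M B b₁ K P) (hK : fanThreshold γ M B b₁ ≤ K)
    (hK' : 8 * dispConst M B b₁ / ((γ - 1) / 2) ≤ K)
    (H : LeftPart P j ul r s U x₁ s₁ u') :
    r ^ P.θ - dispConst M B b₁ * P.dx ≤ u'.1 ^ P.θ ∨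
    waveVel P.γ P.θ ul r + (r ^ P.θ - u'.1 ^ P.θ) / P.θ -
      velConst γ M B b₁ * P.dx ^ (1 / 2 : ℝ) ≤ vel u' := by
  obtain ⟨hb, hw, -, hcR, hS⟩ := H.lastBlock_props h hK
  have hθ := h.θ_pos
  have hd := h.dx_pos
  have hj : OneJump P.γ s₁ (lastBlock P j ul r s U x₁) u' := H.jump
  have hD := h.dispConst_nonneg
  have hdisp : 0 ≤ dispConst M B b₁ * P.dx := mul_nonneg hD hd.le
  have hsq := h.dx_le_sqrt
  have hVC : dispConst M B b₁ * P.dx ≤ velConst γ M B b₁ * P.dx ^ (1 / 2 : ℝ) :=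
    mul_le_mul h.velConst_ge hsq hd.le (hD.trans h.velConst_ge)
  -- An expansive jump does not lower w, and w(ul) bounds w along the whole wave curve of ul. This
  -- already gives the second alternative.
  rcases le_or_gt u'.1 (lastBlock P j ul r s U x₁).1 with hle | hlt
  · right
    have h1 := (hj.wInv_of_ge h.γ_eq' hθ (by linarith [h.θ_le]) hle).1
    have h2 := waveVel_le (r := r) h.γ_eq' hθ H.node.pos
    have h3 : vel u' = wInv P.θ u' - u'.1 ^ P.θ / P.θ := by unfold wInv; ring
    rw [h3, sub_div]
    linarith
  · rcases le_or_gt r ul.1 with hrl | hlr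
    · left
      exact (hcR hrl).trans (Real.rpow_le_rpow hj.1.le hlt.le hθ.le)
    · rcases le_or_gt r u'.1 with hru | hru
      · left
        have := Real.rpow_le_rpow H.r_pos.le hru hθ.le
        linarith
      · right
        obtain ⟨q1, q2⟩ := hS hlr
        have q1' := _root_.abs_le.mp q1
        have q2' := _root_.abs_le.mp q2
        have hc := rpow_eq hθ.ne' (lastBlock P j ul r s U x₁)
        have hcL := rpow_eq hθ.ne' ul
        have hδ0 : 0 < P.dx ^ (P.δ * P.θ) := Real.rpow_pos_of_pos hd _
        have hs0 : 0 < P.dx ^ (1 / 2 : ℝ) := Real.rpow_pos_of_pos hd _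
        have h8 : dispConst M B b₁ * P.dx ≤ P.θ * P.dx ^ (P.δ * P.θ) / 8 := by
          have h9 := (mul_le_mul_of_nonneg_right hK' hd.le).trans h.dx_δ
          rw [← h.θ_eq, div_mul_eq_mul_div, div_le_iff₀ hθ] at h9
          linarith
        have hcl : P.θ * P.dx ^ (P.δ * P.θ) / 4 ≤ (lastBlock P j ul r s U x₁).1 ^ P.θ := by
          have h10 := mul_le_mul_of_nonneg_left H.node.gap hθ.le
          have h11 : P.θ * (wInv P.θ ul - zInv P.θ ul) ≤
              P.θ * (wInv P.θ (lastBlock P j ul r s U x₁) -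
                zInv P.θ (lastBlock P j ul r s U x₁)) + 2 * (dispConst M B b₁ * P.dx) := by
            have := h.θ_le
            nlinarith
          rw [hc]; linarith
        have hcd : ul.1 ^ P.θ ≤
            (lastBlock P j ul r s U x₁).1 ^ P.θ + dispConst M B b₁ * P.dx := by
          rw [hc, hcL]
          have := h.θ_le
          nlinarith
        -- The relative perturbation of ρ^θ at the node is O(dx/dx^(δθ)), and δθ < 1/2 makes it
        -- O(√dx). This is the source of the error √dx.
        have hde : dispConst M B b₁ * P.dx / (lastBlock P j ul r s U x₁).1 ^ P.θ ≤
            4 * dispConst M B b₁ / P.θ * P.dx ^ (1 / 2 : ℝ) := by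
          rw [div_le_iff₀ (hj.1.trans_le le_rfl |> fun h0 => Real.rpow_pos_of_pos h0 _)]
          have h12 : P.dx ≤ P.dx ^ (1 / 2 : ℝ) * P.dx ^ (P.δ * P.θ) := by
            have e : P.dx = P.dx ^ (1 / 2 : ℝ) * P.dx ^ (1 / 2 : ℝ) := by
              rw [← Real.rpow_add hd]; norm_num
            have h13 : P.dx ^ (1 / 2 : ℝ) ≤ P.dx ^ (P.δ * P.θ) := by
              have := h.small_sqrt
              nlinarith [h.one_le_K]
            calc P.dx = P.dx ^ (1 / 2 : ℝ) * P.dx ^ (1 / 2 : ℝ) := e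
              _ ≤ _ := mul_le_mul_of_nonneg_left h13 hs0.le
          have h14 : 4 * dispConst M B b₁ / P.θ * P.dx ^ (1 / 2 : ℝ) *
              (P.θ * P.dx ^ (P.δ * P.θ) / 4) ≤ 4 * dispConst M B b₁ / P.θ * P.dx ^ (1 / 2 : ℝ) *
              (lastBlock P j ul r s U x₁).1 ^ P.θ :=
            mul_le_mul_of_nonneg_left hcl (by positivity)
          refine le_trans ?_ h14
          have e : 4 * dispConst M B b₁ / P.θ * P.dx ^ (1 / 2 : ℝ) *
              (P.θ * P.dx ^ (P.δ * P.θ) / 4) =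
              dispConst M B b₁ * (P.dx ^ (1 / 2 : ℝ) * P.dx ^ (P.δ * P.θ)) := by
            field_simp
          rw [e]
          exact mul_le_mul_of_nonneg_left h12 hD
        have hv : vel ul - dispConst M B b₁ * P.dx ≤ vel (lastBlock P j ul r s U x₁) := by
          rw [vel_eq P.θ ul, vel_eq P.θ (lastBlock P j ul r s U x₁)]; linarith
        have hfin := hj.waveVel_le_of_shock h.γ_eq' hθ (by linarith [h.θ_le]) H.node.pos hlr hlt
          hru hdisp hv hcd (by linarith) hde ((H.attached_bounds h hK).2.2 hlt)
        refine le_trans ?_ hfin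
        have hN := two_rpow_sub_one_nonneg hθ
        have hdev := devConst_nonneg hθ
        have hpos : 0 ≤ 1 + 2 / P.θ + devConst P.θ + 4 * (2 ^ (1 / P.θ) - 1) := by positivity
        have h15 : dispConst M B b₁ * P.dx *
            (1 + 2 / P.θ + devConst P.θ + 4 * (2 ^ (1 / P.θ) - 1)) ≤
            dispConst M B b₁ * (1 + 2 / P.θ + devConst P.θ + 4 * (2 ^ (1 / P.θ) - 1)) *
              P.dx ^ (1 / 2 : ℝ) := by
          have := mul_le_mul_of_nonneg_left hsq (mul_nonneg hD hpos)
          linarith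
        have e : velConst γ M B b₁ * P.dx ^ (1 / 2 : ℝ) =
            dispConst M B b₁ * (1 + 2 / P.θ + devConst P.θ + 4 * (2 ^ (1 / P.θ) - 1)) *
              P.dx ^ (1 / 2 : ℝ) + 3 * invBound M B * ((2 ^ (1 / P.θ) - 1) *
                (4 * dispConst M B b₁ / P.θ * P.dx ^ (1 / 2 : ℝ))) := by
          unfold velConst; rw [h.θ_eq]; ring
        rw [e]
        linarith

/-- If the density of the attached state is not far below `r`, then its `w` is bounded. -/
lemma attached_upper (h : Regime γ M B b₁ K P) (hK : fanThreshold γ M B b₁ ≤ K)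
    (H : LeftPart P j ul r s U x₁ s₁ u') {C : ℝ} (hC : 0 ≤ C) (hKC : 2 * (C + 3) ≤ K)
    (hr : r ^ P.θ - C * P.dx ^ (1 / 2 : ℝ) ≤ u'.1 ^ P.θ) :
    wInv P.θ u' ≤ P.upper x₁ +
      (fanConst γ M B * exp B + 4 * devConst ((γ - 1) / 2) * (C + 3) ^ 3) * P.errSize := by
  obtain ⟨hKb, hKd, hfe, hfe1⟩ := h.fanThreshold_le hK
  have hfe0 : 0 ≤ fanConst γ M B * P.errSize := mul_nonneg h.fanConst_nonneg h.errSize_pos.le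
  obtain ⟨hb, hw, hcup, -, -⟩ := H.lastBlock_props h hK
  have hθ := h.θ_pos
  have hd := h.dx_pos
  have hj : OneJump P.γ s₁ (lastBlock P j ul r s U x₁) u' := H.jump
  have hup := (hb.bounds h hfe0).2
  have hdev := devConst_nonneg hθ
  have hη := h.errSize_pos
  have hnn : 0 ≤ 4 * devConst P.θ * (C + 3) ^ 3 * P.errSize := by positivity
  have hs0 : 0 < P.dx ^ (1 / 2 : ℝ) := Real.rpow_pos_of_pos hd _
  have hβ0 : 0 < P.dx ^ (P.β * P.θ) := Real.rpow_pos_of_pos hd _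
  rw [← h.θ_eq, add_mul]
  have e1 : fanConst γ M B * exp B * P.errSize = fanConst γ M B * P.errSize * exp B := by ring
  rw [e1]
  rcases le_or_gt (lastBlock P j ul r s U x₁).1 u'.1 with hle | hlt
  · have := (hj.wInv_le_of_le h.γ_eq' hθ hle).1
    linarith
  · obtain ⟨-, -, h3⟩ := hj.wInv_of_ge h.γ_eq' hθ (by linarith [h.θ_le]) hlt.le
    have ha : P.dx ^ P.α ≤ P.dx ^ (1 / 2 : ℝ) :=
      Real.rpow_le_rpow_of_exponent_ge hd h.dx_le (by linarith [h.α_gt, h.β_pos])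
    -- The last block exceeds r^θ by 3·dx^α at most and the attached state is at most C√dx below, so
    -- the expansive jump has strength O(√dx).
    have hdiff : (lastBlock P j ul r s U x₁).1 ^ P.θ - u'.1 ^ P.θ ≤
        (C + 3) * P.dx ^ (1 / 2 : ℝ) := by linarith
    have hdiff0 : 0 ≤ (lastBlock P j ul r s U x₁).1 ^ P.θ - u'.1 ^ P.θ :=
      sub_nonneg.mpr (Real.rpow_le_rpow hj.2.1.le hlt.le hθ.le)
    have hsm : 2 * (C + 3) * P.dx ^ (1 / 2 : ℝ) ≤ P.dx ^ (P.β * P.θ) :=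
      (mul_le_mul_of_nonneg_right hKC hs0.le).trans h.small_sqrt'
    have hc' : P.dx ^ (P.β * P.θ) / 2 ≤ u'.1 ^ P.θ := by
      have := H.r_ge
      linarith
    have h4 := h3 (by linarith)
    have h5 : ((lastBlock P j ul r s U x₁).1 ^ P.θ - u'.1 ^ P.θ) ^ 3 / (u'.1 ^ P.θ) ^ 2 ≤
        ((C + 3) * P.dx ^ (1 / 2 : ℝ)) ^ 3 / (P.dx ^ (P.β * P.θ) / 2) ^ 2 := by
      gcongr
    have h6 : ((C + 3) * P.dx ^ (1 / 2 : ℝ)) ^ 3 / (P.dx ^ (P.β * P.θ) / 2) ^ 2 ≤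
        4 * (C + 3) ^ 3 * P.errSize := by
      rw [div_le_iff₀ (by positivity), mul_pow]
      have := mul_le_mul_of_nonneg_left h.cube_sqrt_le (show 0 ≤ (C + 3) ^ 3 by positivity)
      linarith
    have h7 := mul_le_mul_of_nonneg_left (h5.trans h6) hdev
    linarith

end LeftPart

/-- The constant in the bounds for the middle state. -/
def midConst (γ M B b₁ : ℝ) : ℝ := 16 * invBound M B * b₁ * (1 + 1 / ((γ - 1) / 2))

/-- The constant in the lower bound of the density of the middle state. -/
def densConst (γ M B b₁ : ℝ) : ℝ :=
  dispConst M B b₁ + velConst γ M B b₁ + 3 * midConst γ M B b₁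

/-- The error constant of the middle state. -/
def midErrConst (γ M B b₁ : ℝ) : ℝ :=
  fanConst γ M B * exp B + 4 * devConst ((γ - 1) / 2) * (densConst γ M B b₁ + 3) ^ 3

/-- Threshold for the mesh in the analysis of regular cells. -/
def regThreshold (γ M B b₁ : ℝ) : ℝ :=
  fanThreshold γ M B b₁ + 8 * dispConst M B b₁ / ((γ - 1) / 2) + 8 * b₁ +
    2 * (densConst γ M B b₁ + 3) + 8 * midConst γ M B b₁ + 4 * stepThreshold γ M B b₁ +
    midErrConst γ M B b₁ * exp (2 * B) + 2

end Regime

/-! ### The middle block of a regular cell. -/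

namespace Regime

variable {γ M B b₁ K : ℝ} {P : Scheme}

lemma midConst_nonneg (h : Regime γ M B b₁ K P) : 0 ≤ midConst γ M B b₁ := by
  have h1 := h.b₁_nonneg
  have h2 := h.invBound_pos
  have h5 := h.θ_pos
  rw [h.θ_eq] at h5
  unfold midConst
  positivity

lemma stepThreshold_ge (h : Regime γ M B b₁ K P) : 1 ≤ stepThreshold γ M B b₁ := by
  have := h.stepConst_nonneg
  have := h.changeConst_nonneg
  have := h.b₁_nonneg
  have h6 := h.M_pos
  have : 0 ≤ stepConst ((γ - 1) / 2) b₁ (invBound M B) (M * exp (-B)) / (2 * M * exp B) := by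
    positivity
  unfold stepThreshold; linarith

lemma densConst_nonneg (h : Regime γ M B b₁ K P) : 0 ≤ densConst γ M B b₁ := by
  have := h.dispConst_nonneg
  have := h.velConst_ge
  have := h.midConst_nonneg
  unfold densConst; linarith

lemma midErrConst_nonneg (h : Regime γ M B b₁ K P) : 0 ≤ midErrConst γ M B b₁ := by
  have := h.fanConst_nonneg
  have := h.densConst_nonneg
  have h5 := devConst_nonneg h.θ_pos
  rw [h.θ_eq] at h5
  unfold midErrConst; positivity

/-- The constants in `regThreshold`, separated. -/
lemma regThreshold_le (h : Regime γ M B b₁ K P) (hK : regThreshold γ M B b₁ ≤ K) :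
    fanThreshold γ M B b₁ ≤ K ∧ 8 * dispConst M B b₁ / ((γ - 1) / 2) ≤ K ∧ 8 * b₁ ≤ K ∧
    2 * (densConst γ M B b₁ + 3) ≤ K ∧
    2 * densConst γ M B b₁ + 8 * midConst γ M B b₁ + 4 * stepThreshold γ M B b₁ ≤ K ∧
    midErrConst γ M B b₁ * exp (2 * B) ≤ K := by
  have h1 := h.fanConst_nonneg
  have h2 := h.dispConst_nonneg
  have h3 := h.b₁_nonneg
  have h4 := h.midConst_nonneg
  have h5 := h.densConst_nonneg
  have h6 := h.stepThreshold_ge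
  have h7 : 0 ≤ midErrConst γ M B b₁ * exp (2 * B) := mul_nonneg h.midErrConst_nonneg (exp_pos _).le
  have h8 : 0 ≤ fanThreshold γ M B b₁ := by
    have : 0 ≤ fanConst γ M B * exp B := mul_nonneg h1 (exp_pos _).le
    unfold fanThreshold; linarith
  have h9 : 0 ≤ 8 * dispConst M B b₁ / ((γ - 1) / 2) := by
    have := h.θ_pos
    rw [h.θ_eq] at this
    positivity
  unfold regThreshold at hK
  refine ⟨?_, ?_, ?_, ?_, ?_, ?_⟩ <;> linarith

lemma steady_eq_perturb (h : Regime γ M B b₁ K P) (x xd : ℝ) (u : State) :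
    P.steady x xd u = ofZW P.θ (zInv P.θ u * (1 + (exp (-(P.cumul x - P.cumul xd)) - 1)))
      (wInv P.θ u * (1 + (exp (P.cumul x - P.cumul xd) - 1))) := by
  rw [h.steady_eq]; congr 1 <;> ring

lemma abs_exp_cumul_sub_one_le (h : Regime γ M B b₁ K P) (hK : b₁ ≤ K) {j : ℤ} {x xd : ℝ}
    (hx : P.InCell j x) (hxd : P.InCell j xd) :
    |exp (P.cumul x - P.cumul xd) - 1| ≤ 2 * b₁ * P.dx ∧
    |exp (-(P.cumul x - P.cumul xd)) - 1| ≤ 2 * b₁ * P.dx := by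
  have h1 := h.abs_cumul_sub_le_dx hx hxd
  have h2 : b₁ * P.dx ≤ 1 := (mul_le_mul_of_nonneg_right hK h.dx_pos.le).trans h.dx_small
  have h3 := Real.abs_exp_sub_one_le (h1.trans h2)
  have h4 := Real.abs_exp_sub_one_le (x := -(P.cumul x - P.cumul xd))
    (by rw [abs_neg]; exact h1.trans h2)
  rw [abs_neg] at h4
  constructor <;> linarith

set_option maxHeartbeats 1000000 in
/-- The middle block of a regular cell respects the bounds after the fractional step. -/
lemma middle_leftLimit (h : Regime γ M B b₁ K P) (hK : regThreshold γ M B b₁ ≤ K)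
    {j : ℤ} {ul ur uM : State} {r x₁ x₂ s₁ s₂ : ℝ} {sl sr : ℕ → ℝ} {Ul Ur : ℕ → State}
    (H₁ : LeftPart P j ul r sl Ul x₁ s₁ (P.steady x₁ (P.mid j) uM))
    (H₂ : LeftPart P.flip (-j - 1) (flipState ur) r sr Ur (-x₂) (-s₂)
      (flipState (P.steady x₂ (P.mid j) uM)))
    (hx₂ : P.InCell j x₂) (huM : 0 < uM.1)
    (hV : waveVel P.γ P.θ ul r = -waveVel P.γ P.θ (flipState ur) r)
    {x : ℝ} (hx : P.InCell j x) :
    LeftLimitIn P.θ P.dt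
      (P.lower x - 2 * (midErrConst γ M B b₁ * exp (2 * B) * P.errSize))
      (P.upper x + 2 * (midErrConst γ M B b₁ * exp (2 * B) * P.errSize))
      (fun τ => P.fracStep x τ (P.steady x (P.mid j) uM)) := by
  obtain ⟨k1, k2, k3, k4, k5, k6⟩ := h.regThreshold_le hK
  have hθ := h.θ_pos
  have hθ3 := h.θ_le
  have hd := h.dx_pos
  have hb₁ := h.b₁_nonneg
  have hG := h.invBound_pos
  have hsq := h.dx_le_sqrt
  have hs0 : 0 < P.dx ^ (1 / 2 : ℝ) := Real.rpow_pos_of_pos hd _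
  have hmc := h.midConst_nonneg
  have hdc := h.densConst_nonneg
  have hD := h.dispConst_nonneg
  have hVC := h.velConst_ge
  have hst := h.stepThreshold_ge
  have hKb : b₁ ≤ K := by linarith
  have hmid := h.invCell_mid j
  have hf := h.flip
  have hzw := zInv_lt_wInv hθ huM
  set z := zInv P.θ uM with hz
  set w := wInv P.θ uM with hw
  have hcM := rpow_eq hθ.ne' uM
  rw [← hz, ← hw] at hcM
  -- deviation of the block from its base value
  have pert : ∀ y, P.InCell j y → 0 < (P.steady y (P.mid j) uM).1 →
      |vel (P.steady y (P.mid j) uM) - (w + z) / 2| ≤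
        2 * b₁ * P.dx * (|(w + z) / 2| + (w - z) / 2) ∧
      (P.steady y (P.mid j) uM).1 ^ P.θ ≤
        P.θ * ((w - z) / 2 + 2 * b₁ * P.dx * (|(w + z) / 2| + (w - z) / 2)) ∧
      P.θ * ((w - z) / 2 - 2 * b₁ * P.dx * (|(w + z) / 2| + (w - z) / 2)) ≤
        (P.steady y (P.mid j) uM).1 ^ P.θ := by
    intro y hy hpos
    obtain ⟨e1, e2⟩ := h.abs_exp_cumul_sub_one_le hKb hy hmid
    rw [h.steady_eq_perturb] at hpos ⊢
    obtain ⟨a1, a2, a3, -⟩ := ofZW_perturb hθ hzw e1 e2 hpos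
    exact ⟨a1, a2, a3⟩
  obtain ⟨b1, b2, -⟩ := H₁.attached_bounds h k1
  -- The left part bounds the velocity of the middle block from below and, by reflection, the right
  -- part bounds it from above.
  obtain ⟨c1, c2, -⟩ := H₂.attached_bounds hf k1
  rw [vel_flipState] at c1
  have hpos₁ : 0 < (P.steady x₁ (P.mid j) uM).1 := H₁.jump.2.1
  have hpos₂ : 0 < (P.steady x₂ (P.mid j) uM).1 := H₂.jump.2.1
  obtain ⟨d1, d2, d3⟩ := pert x₁ H₁.inCell hpos₁
  obtain ⟨e1, e2, e3⟩ := pert x₂ hx₂ hpos₂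
  have hε : 2 * b₁ * P.dx ≤ 1 / 4 := by
    have := (mul_le_mul_of_nonneg_right k3 hd.le).trans h.dx_small
    linarith
  have hε0 : 0 ≤ 2 * b₁ * P.dx := by positivity
  -- the size of the middle state
  have hQ0 : 0 ≤ |(w + z) / 2| + (w - z) / 2 := by
    have := abs_nonneg ((w + z) / 2); linarith
  have hQ : 2 * b₁ * P.dx * (|(w + z) / 2| + (w - z) / 2) ≤ midConst γ M B b₁ * P.dx := by
    set Q := |(w + z) / 2| + (w - z) / 2 with hQdef
    have h1 : |(w + z) / 2| ≤ 4 * invBound M B + 2 * b₁ * P.dx * Q := by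
      rw [abs_le]; constructor
      · linarith [(abs_le.mp d1).2]
      · linarith [(abs_le.mp e1).1]
    have h2 : (w - z) / 2 ≤ 4 * invBound M B / P.θ + 2 * b₁ * P.dx * Q := by
      have h3 : P.θ * ((w - z) / 2 - 2 * b₁ * P.dx * Q) ≤ 4 * invBound M B := d3.trans b2
      have h4 : (w - z) / 2 - 2 * b₁ * P.dx * Q ≤ 4 * invBound M B / P.θ := by
        rw [le_div_iff₀ hθ]; linarith
      linarith
    have h5 : Q ≤ 8 * invBound M B * (1 + 1 / P.θ) := by
      -- The deviation is itself proportional to the unknown size Q. The factor 1/4 allows it to be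
      -- absorbed.
      have h6 : 2 * b₁ * P.dx * Q ≤ 1 / 4 * Q := mul_le_mul_of_nonneg_right hε hQ0
      have e : 8 * invBound M B * (1 + 1 / P.θ) =
        2 * (4 * invBound M B + 4 * invBound M B / P.θ) := by ring
      rw [e]; linarith
    calc 2 * b₁ * P.dx * Q ≤ 2 * b₁ * P.dx * (8 * invBound M B * (1 + 1 / P.θ)) :=
          mul_le_mul_of_nonneg_left h5 hε0
      _ = _ := by unfold midConst; rw [h.θ_eq]; ring
  set q := 2 * b₁ * P.dx * (|(w + z) / 2| + (w - z) / 2) with hq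
  have hq0 : 0 ≤ q := mul_nonneg hε0 hQ0
  have hqs : q ≤ midConst γ M B b₁ * P.dx ^ (1 / 2 : ℝ) :=
    hQ.trans (mul_le_mul_of_nonneg_left hsq hmc)
  have hcM' : P.θ * ((w - z) / 2) = uM.1 ^ P.θ := by rw [hcM]; ring
  rw [mul_add, hcM'] at d2 e2
  rw [mul_sub, hcM'] at d3 e3
  have hθq : P.θ * q ≤ q := by nlinarith
  have hDs : dispConst M B b₁ * P.dx ≤ dispConst M B b₁ * P.dx ^ (1 / 2 : ℝ) :=
    mul_le_mul_of_nonneg_left hsq hD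
  have hVs : 0 ≤ velConst γ M B b₁ * P.dx ^ (1 / 2 : ℝ) := mul_nonneg (hD.trans hVC) hs0.le
  have hms : 0 ≤ midConst γ M B b₁ * P.dx ^ (1 / 2 : ℝ) := mul_nonneg hmc hs0.le
  have hDs0 : 0 ≤ dispConst M B b₁ * P.dx ^ (1 / 2 : ℝ) := mul_nonneg hD hs0.le
  -- If both sides are in the second alternative of `attached_vel`, add the two inequalities. The
  -- wave-curve velocities cancel by the Riemann problem and the block velocities agree up to q, so
  -- both density deficits are O(√dx).
  have hdens : r ^ P.θ - (densConst γ M B b₁ - midConst γ M B b₁) * P.dx ^ (1 / 2 : ℝ) ≤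
      uM.1 ^ P.θ := by
    have e : (densConst γ M B b₁ - midConst γ M B b₁) * P.dx ^ (1 / 2 : ℝ) =
        dispConst M B b₁ * P.dx ^ (1 / 2 : ℝ) + velConst γ M B b₁ * P.dx ^ (1 / 2 : ℝ) +
        2 * (midConst γ M B b₁ * P.dx ^ (1 / 2 : ℝ)) := by unfold densConst; ring
    rw [e]
    have v1 := H₁.attached_vel h k1 k2
    have v2 := H₂.attached_vel hf k1 k2
    change r ^ P.θ - dispConst M B b₁ * P.dx ≤ (P.steady x₂ (P.mid j) uM).1 ^ P.θ ∨
      waveVel P.γ P.θ (flipState ur) r +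
        (r ^ P.θ - (P.steady x₂ (P.mid j) uM).1 ^ P.θ) / P.θ -
        velConst γ M B b₁ * P.dx ^ (1 / 2 : ℝ) ≤ vel (flipState (P.steady x₂ (P.mid j) uM)) at v2
    rcases v1 with v1 | v1
    · linarith
    rcases v2 with v2 | v2
    · linarith
    rw [vel_flipState] at v2
    have hsum : (r ^ P.θ - (P.steady x₁ (P.mid j) uM).1 ^ P.θ) / P.θ +
        (r ^ P.θ - (P.steady x₂ (P.mid j) uM).1 ^ P.θ) / P.θ ≤
        2 * (velConst γ M B b₁ * P.dx ^ (1 / 2 : ℝ)) + 2 * q := by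
      linarith [(abs_le.mp d1).2, (abs_le.mp e1).1]
    rw [← add_div, div_le_iff₀ hθ] at hsum
    have h7 : (2 * (velConst γ M B b₁ * P.dx ^ (1 / 2 : ℝ)) + 2 * q) * P.θ ≤
        (2 * (velConst γ M B b₁ * P.dx ^ (1 / 2 : ℝ)) + 2 * q) * 1 :=
      mul_le_mul_of_nonneg_left (by linarith) (by linarith)
    linarith
  have hC₁ : r ^ P.θ - densConst γ M B b₁ * P.dx ^ (1 / 2 : ℝ) ≤
      (P.steady x₁ (P.mid j) uM).1 ^ P.θ := by linarith
  have hC₂ : r ^ P.θ - densConst γ M B b₁ * P.dx ^ (1 / 2 : ℝ) ≤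
      (P.steady x₂ (P.mid j) uM).1 ^ P.θ := by linarith
  have u1 := H₁.attached_upper h k1 hdc k4 hC₁
  have u2 := H₂.attached_upper hf k1 hdc k4 hC₂
  rw [upper_flip, neg_neg] at u2
  change wInv P.θ (flipState (P.steady x₂ (P.mid j) uM)) ≤ -P.lower x₂ +
    (fanConst γ M B * exp B + 4 * devConst ((γ - 1) / 2) * (densConst γ M B b₁ + 3) ^ 3) *
      P.errSize at u2
  rw [wInv_flipState] at u2
  -- the blocks are not degenerate
  have hbig : 2 * (stepThreshold γ M B b₁ * P.dx) ≤ (w - z) / 2 - q := by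
    have h8 : uM.1 ^ P.θ ≤ (w - z) / 2 := by rw [← hcM']; nlinarith
    have h9 := h.small_sqrt'
    have h10 := H₁.r_ge
    have h11 := mul_le_mul_of_nonneg_right k5 hs0.le
    have h12 : stepThreshold γ M B b₁ * P.dx ≤ stepThreshold γ M B b₁ * P.dx ^ (1 / 2 : ℝ) :=
      mul_le_mul_of_nonneg_left hsq (by linarith)
    have h13 : 0 ≤ densConst γ M B b₁ * P.dx ^ (1 / 2 : ℝ) := mul_nonneg hdc hs0.le
    have h14 : 0 ≤ stepThreshold γ M B b₁ * P.dx ^ (1 / 2 : ℝ) := mul_nonneg (by linarith) hs0.le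
    linarith
  have hstd : 0 < stepThreshold γ M B b₁ * P.dx := mul_pos (by linarith) hd
  have nondeg : ∀ y, P.InCell j y →
      2 * (stepThreshold γ M B b₁ * P.dx) ≤
        wInv P.θ (P.steady y (P.mid j) uM) - zInv P.θ (P.steady y (P.mid j) uM) ∧
      zInv P.θ (P.steady y (P.mid j) uM) = z * exp (-(P.cumul y - P.cumul (P.mid j))) ∧
      wInv P.θ (P.steady y (P.mid j) uM) = w * exp (P.cumul y - P.cumul (P.mid j)) := by
    intro y hy
    obtain ⟨g1, g2⟩ := h.abs_exp_cumul_sub_one_le hKb hy hmid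
    have hzabs := abs_nonneg ((w + z) / 2)
    have e1 : (w * exp (P.cumul y - P.cumul (P.mid j)) -
        z * exp (-(P.cumul y - P.cumul (P.mid j)))) / 2 ≥ (w - z) / 2 - q := by
      have hza : |z| ≤ |(w + z) / 2| + (w - z) / 2 := by
        rw [abs_le]; constructor <;> linarith [neg_abs_le ((w + z) / 2), le_abs_self ((w + z) / 2)]
      have hwa : |w| ≤ |(w + z) / 2| + (w - z) / 2 := by
        rw [abs_le]; constructor <;> linarith [neg_abs_le ((w + z) / 2), le_abs_self ((w + z) / 2)]
      have m1 : |w * (exp (P.cumul y - P.cumul (P.mid j)) - 1)| ≤ q := by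
        rw [abs_mul, hq, mul_comm (2 * b₁ * P.dx)]
        exact mul_le_mul hwa g1 (abs_nonneg _) hQ0
      have m2 : |z * (exp (-(P.cumul y - P.cumul (P.mid j))) - 1)| ≤ q := by
        rw [abs_mul, hq, mul_comm (2 * b₁ * P.dx)]
        exact mul_le_mul hza g2 (abs_nonneg _) hQ0
      rw [abs_le] at m1 m2
      linarith [m1.1, m2.2]
    have hlt : z * exp (-(P.cumul y - P.cumul (P.mid j))) <
        w * exp (P.cumul y - P.cumul (P.mid j)) := by linarith
    rw [h.steady_eq, zInv_ofZW hθ hlt, wInv_ofZW hθ hlt]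
    exact ⟨by linarith, rfl, rfl⟩
  obtain ⟨-, n1, n2⟩ := nondeg x₁ H₁.inCell
  obtain ⟨-, n3, n4⟩ := nondeg x₂ hx₂
  obtain ⟨n5, n6, n7⟩ := nondeg x hx
  have hme : midErrConst γ M B b₁ = fanConst γ M B * exp B +
    4 * devConst ((γ - 1) / 2) * (densConst γ M B b₁ + 3) ^ 3 := rfl
  have hme0 := h.midErrConst_nonneg
  have hη := h.errSize_pos
  rw [← hme] at u1 u2
  rw [n2] at u1
  rw [n3] at u2
  have hE : exp (2 * B) = exp B * exp B := by rw [← Real.exp_add]; ring_nf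
  have hme1 : 0 ≤ midErrConst γ M B b₁ * P.errSize := mul_nonneg hme0 hη.le
  -- transport of a bound from one point to another
  have trans : ∀ c y : ℝ, c ≤ M * exp (P.cumul y) + midErrConst γ M B b₁ * P.errSize →
      c * exp (P.cumul x - P.cumul y) ≤
        M * exp (P.cumul x) + midErrConst γ M B b₁ * exp (2 * B) * P.errSize := by
    intro c y hc
    have h1 := mul_le_mul_of_nonneg_right hc (exp_pos (P.cumul x - P.cumul y)).le
    rw [add_mul, mul_assoc M, ← Real.exp_add] at h1
    have h2 : exp (P.cumul x - P.cumul y) ≤ exp (2 * B) := exp_le_exp.mpr (by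
      linarith [(abs_le.mp (h.mass x)).2, (abs_le.mp (h.mass y)).1])
    have h3 := mul_le_mul_of_nonneg_left h2 hme1
    have e : P.cumul y + (P.cumul x - P.cumul y) = P.cumul x := by ring
    rw [e] at h1
    linarith
  have trans' : ∀ c y : ℝ, c ≤ M * exp (-P.cumul y) + midErrConst γ M B b₁ * P.errSize →
      c * exp (-(P.cumul x - P.cumul y)) ≤
        M * exp (-P.cumul x) + midErrConst γ M B b₁ * exp (2 * B) * P.errSize := by
    intro c y hc
    have h1 := mul_le_mul_of_nonneg_right hc (exp_pos (-(P.cumul x - P.cumul y))).le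
    rw [add_mul, mul_assoc M, ← Real.exp_add] at h1
    have h2 : exp (-(P.cumul x - P.cumul y)) ≤ exp (2 * B) := exp_le_exp.mpr (by
      linarith [(abs_le.mp (h.mass x)).1, (abs_le.mp (h.mass y)).2])
    have h3 := mul_le_mul_of_nonneg_left h2 hme1
    have e : -P.cumul y + -(P.cumul x - P.cumul y) = -P.cumul x := by ring
    rw [e] at h1
    linarith
  -- Lowering K to the threshold weakens the gap that `fracStep_leftLimit` requires.
  have hregm : Regime γ M B b₁ (stepThreshold γ M B b₁) P := h.mono hst (by linarith)
  refine hregm.fracStep_leftLimit le_rfl ?_ ?_ ?_ ?_ ?_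
  · exact mul_nonneg (mul_nonneg hme0 (exp_pos _).le) hη.le
  · exact (mul_le_mul_of_nonneg_right k6 hη.le).trans h.errSize_small
  · linarith
  · have h1 := trans' (-(z * exp (-(P.cumul x₂ - P.cumul (P.mid j))))) x₂ (by
      unfold Scheme.lower at u2; rw [h.M_eq] at u2; linarith)
    rw [n6]
    unfold Scheme.lower; rw [h.M_eq]
    have e : -(z * exp (-(P.cumul x₂ - P.cumul (P.mid j)))) * exp (-(P.cumul x - P.cumul x₂)) =
        -(z * exp (-(P.cumul x - P.cumul (P.mid j)))) := by
      rw [neg_mul, mul_assoc, ← Real.exp_add]; ring_nf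
    rw [e] at h1
    linarith
  · have h1 := trans (w * exp (P.cumul x₁ - P.cumul (P.mid j))) x₁ (by
      unfold Scheme.upper at u1; rw [h.M_eq] at u1; linarith)
    rw [n7]
    unfold Scheme.upper; rw [h.M_eq]
    have e : w * exp (P.cumul x₁ - P.cumul (P.mid j)) * exp (P.cumul x - P.cumul x₁) =
        w * exp (P.cumul x - P.cumul (P.mid j)) := by
      rw [mul_assoc, ← Real.exp_add]; ring_nf
    rw [e] at h1
    linarith

end Regime

/-! ### Eventual constancy of the sector conditions -/

/-- To the left of T the point lies on one fixed side of a ray. If it is on the ray at time T, the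
sign of the speed decides. -/
lemma eventually_lt_mul_or (y s T : ℝ) :
    (∀ᶠ τ in 𝓝[<] T, y < s * τ) ∨ (∀ᶠ τ in 𝓝[<] T, ¬ y < s * τ) := by
  have hc : Tendsto (fun τ => s * τ) (𝓝[<] T) (𝓝 (s * T)) :=
    ((continuous_const.mul continuous_id).tendsto T).mono_left nhdsWithin_le_nhds
  rcases lt_trichotomy y (s * T) with h | h | h
  · exact Or.inl (hc.eventually (lt_mem_nhds h))
  · rcases lt_or_ge s 0 with hs | hs
    · left
      filter_upwards [self_mem_nhdsWithin] with τ hτ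
      have hτ' : τ < T := hτ
      nlinarith
    · right
      filter_upwards [self_mem_nhdsWithin] with τ hτ
      have hτ' : τ < T := hτ
      nlinarith
  · right
    filter_upwards [hc.eventually (gt_mem_nhds h)] with τ hτ
    exact not_lt.mpr (le_of_lt hτ)

lemma eventually_le_mul_or (y s T : ℝ) :
    (∀ᶠ τ in 𝓝[<] T, y ≤ s * τ) ∨ (∀ᶠ τ in 𝓝[<] T, ¬ y ≤ s * τ) := by
  rcases eventually_lt_mul_or (-y) (-s) T with h | h
  · right
    filter_upwards [h] with τ hτ
    linarith
  · left
    filter_upwards [h] with τ hτ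
    linarith

lemma eventually_div_lt_or (y c : ℝ) {T : ℝ} (hT : 0 < T) :
    (∀ᶠ τ in 𝓝[<] T, y / τ < c) ∨ (∀ᶠ τ in 𝓝[<] T, ¬ y / τ < c) := by
  rcases eventually_lt_mul_or y c T with h | h
  · left
    filter_upwards [h, eventually_mem_Ioo hT] with τ h1 h2
    rwa [div_lt_iff₀ h2.1]
  · right
    filter_upwards [h, eventually_mem_Ioo hT] with τ h1 h2
    rwa [div_lt_iff₀ h2.1]

lemma fanIndex_eventually (s : ℕ → ℝ) (y T : ℝ) {q : ℕ} (hq : 1 ≤ q) :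
    ∃ k, 1 ≤ k ∧ k ≤ q ∧ ∀ᶠ τ in 𝓝[<] T, fanIndex s y τ q = k := by
  induction q, hq using Nat.le_induction with
  | base => exact ⟨1, le_rfl, le_rfl, Eventually.of_forall fun τ => by simp [fanIndex]⟩
  | succ q hq ih =>
    obtain ⟨k, h1, h2, h3⟩ := ih
    rcases eventually_lt_mul_or y (s (q + 1)) T with h | h
    · refine ⟨k, h1, by omega, ?_⟩
      filter_upwards [h, h3] with τ h4 h5
      rw [fanIndex, if_neg (fun h6 => absurd h6.2 (not_le.mpr h4)), h5]
    · refine ⟨q + 1, by omega, le_rfl, ?_⟩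
      filter_upwards [h] with τ h4
      rw [fanIndex, if_pos ⟨hq, not_lt.mp h4⟩]

/-! ### Reflection of the fractional step -/

lemma ofZW_neg (θ z w : ℝ) : ofZW θ (-w) (-z) = flipState (ofZW θ z w) := by
  have e : θ * (-z - -w) / 2 = θ * (w - z) / 2 := by ring
  simp only [ofZW, flipState, e]
  congr 1; ring

lemma fracStep_flipState (P : Scheme) (x τ : ℝ) (u : State) :
    P.fracStep x τ (flipState u) = flipState (P.flip.fracStep (-x) τ u) := by
  unfold Scheme.fracStep
  rw [← ofZW_neg]
  simp only [zInv_flipState, wInv_flipState, vel_flipState, flipState_fst, lam1, lam2]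
  have e : P.flip.θ = P.θ := rfl
  have ea : P.flip.a (-x) = -P.a x := by simp [Scheme.flip]
  have eb : P.flip.b (-x) = P.b x := by simp [Scheme.flip]
  rw [e, ea, eb]
  congr 1 <;> ring

/-! ### Assembly of a regular cell. -/

namespace Regime

variable {γ M B b₁ K : ℝ} {P : Scheme}

lemma NodeData.flip {j : ℤ} {u : State} (hu : NodeData P (((j : ℝ) + 1) * P.dx) u) :
    NodeData P.flip (((-j - 1 : ℤ) : ℝ) * P.flip.dx) (flipState u) := by
  have e : ((-j - 1 : ℤ) : ℝ) * P.flip.dx = -(((j : ℝ) + 1) * P.dx) := by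
    simp only [Scheme.flip]; push_cast; ring
  rw [e]
  refine ⟨hu.pos, ?_, ?_, ?_⟩
  · rw [lower_flip, neg_neg]
    change _ ≤ zInv P.θ (flipState u)
    rw [zInv_flipState]; linarith [hu.upper]
  · rw [upper_flip, neg_neg]
    change wInv P.θ (flipState u) ≤ _
    rw [wInv_flipState]; linarith [hu.lower]
  · change P.dx ^ (P.δ * P.θ) ≤ wInv P.θ (flipState u) - zInv P.θ (flipState u)
    rw [zInv_flipState, wInv_flipState]; linarith [hu.gap]

/-- Left limits found after reflection. -/
lemma leftLimit_of_flip {x e : ℝ} {f : ℝ → State}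
    (h : LeftLimitIn P.θ P.dt (P.flip.lower (-x) - e) (P.flip.upper (-x) + e) f) :
    LeftLimitIn P.θ P.dt (P.lower x - e) (P.upper x + e) (fun τ => flipState (f τ)) := by
  have := h.flip
  rw [lower_flip, upper_flip, neg_neg] at this
  exact this.mono (by linarith) (by linarith)

/-- The corrected piecewise function made of the blocks of a fan. -/
lemma fanBar_leftLimit (h : Regime γ M B b₁ K P) (hf : fanThreshold γ M B b₁ ≤ K)
    (hK : 2 * stepThreshold γ M B b₁ + 5 * dispConst M B b₁ + 2 ≤ K)
    {j : ℤ} {q : ℕ} {s : ℕ → ℝ} {U : ℕ → State} (hq : 1 ≤ q)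
    (hU : ∀ k, 1 ≤ k → k ≤ q →
      BlockData P j (P.fanNode j s k) (U k) (fanConst γ M B * P.errSize) ∧
      K * P.dx - dispConst M B b₁ * P.dx ≤ wInv P.θ (U k) - zInv P.θ (U k))
    {x : ℝ} (hx : P.InCell j x) :
    LeftLimitIn P.θ P.dt (P.lower x - 2 * (fanConst γ M B * exp B) * P.errSize)
      (P.upper x + 2 * (fanConst γ M B * exp B) * P.errSize)
      (fun τ => P.fracStep x τ (P.fanBar j s U q x τ)) := by
  obtain ⟨k, h1, h2, h3⟩ := fanIndex_eventually s (x - P.mid j) P.dt hq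
  obtain ⟨g1, g2⟩ := hU k h1 h2
  have hst := h.stepThreshold_ge
  have hD := h.dispConst_nonneg
  have hd := h.dx_pos
  obtain ⟨-, hKd, -, hfe1⟩ := h.fanThreshold_le hf
  -- `BlockData.fracStep` requires the gap 2K'·dx for the constant K' it is used with, while the fan
  -- provides only (K - dispConst)·dx. It is therefore applied with a constant below K/2.
  have hm := h.mono (K' := stepThreshold γ M B b₁ + 2 * dispConst M B b₁) (by linarith)
    (by linarith)
  have hfc := h.fanConst_nonneg
  have hη := h.errSize_pos
  have hm' := h.mono (K' := stepThreshold γ M B b₁ + 2 * dispConst M B b₁ + 1) (by linarith)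
    (by linarith)
  have hexp : fanConst γ M B * P.errSize * exp B ≤ 1 := by
    have h4 : fanConst γ M B * exp B ≤ K := by linarith
    have := (mul_le_mul_of_nonneg_right h4 hη.le).trans h.errSize_small
    linarith
  have hKd' := mul_le_mul_of_nonneg_right hK hd.le
  refine LeftLimitIn.congr (f := fun τ => P.fracStep x τ (P.steady x (P.fanNode j s k) (U k)))
    ?_ ?_
  · refine (g1.fracStep hm' (by linarith) (by linarith) (mul_nonneg hfc hη.le) hexp hx
      (by linarith)).mono ?_ ?_ <;> linarith
  · filter_upwards [h3] with τ hτ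
    rw [Scheme.fanBar, hτ, Scheme.fanBlock]

/-- The error constant of a regular cell. -/
def regErrConst (γ M B b₁ : ℝ) : ℝ :=
  2 * (fanConst γ M B * exp B) + 2 * (midErrConst γ M B b₁ * exp (2 * B))

lemma rpow_ge_of_ge (h : Regime γ M B b₁ K P) {r : ℝ} (hr : P.dx ^ P.β ≤ r) :
    P.dx ^ (P.β * P.θ) ≤ r ^ P.θ := by
  rw [Real.rpow_mul h.dx_pos.le]
  exact Real.rpow_le_rpow (Real.rpow_nonneg h.dx_pos.le _) hr h.θ_pos.le

/-- One time step in a regular cell. -/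
lemma regularCell_leftLimit (h : Regime γ M B b₁ K P) (hK : regThreshold γ M B b₁ ≤ K)
    (hK' : 2 * stepThreshold γ M B b₁ + 5 * dispConst M B b₁ + 2 ≤ K)
    {j : ℤ} {ul ur : State} {r : ℝ} {V : ℝ → ℝ → State} (hul : NodeData P (j * P.dx) ul)
    (hur : NodeData P (((j : ℝ) + 1) * P.dx) ur) (hr : P.dx ^ P.β < r)
    (hmid : waveVel P.γ P.θ ul r = -waveVel P.γ P.θ (flipState ur) r)
    (hV : P.RegularCell j ul ur r V) {x : ℝ} (hx1 : (j : ℝ) * P.dx ≤ x)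
    (hx2 : x < ((j : ℝ) + 1) * P.dx) :
    LeftLimitIn P.θ P.dt (P.lower x - regErrConst γ M B b₁ * P.errSize)
      (P.upper x + regErrConst γ M B b₁ * P.errSize) (V x) := by
  obtain ⟨pl, pr, sl, sr, Ul, Ur, s1, s2, uM, rfl, rfl, hFl, hFr, huM, -, -, -, hc1, hc2, hj1,
    hj2, hVeq⟩ := hV
  obtain ⟨k1, -⟩ := h.regThreshold_le hK
  have hrpos : 0 < r := (Real.rpow_pos_of_pos h.dx_pos _).trans hr
  have hrge := h.rpow_ge_of_ge hr.le
  have hx : P.InCell j x := ⟨hx1, hx2.le⟩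
  have hf := h.flip
  have H1 : LeftPart P j ul r sl Ul (P.mid j + s1 * P.dt / 2) s1
      (P.steady (P.mid j + s1 * P.dt / 2) (P.mid j) uM) :=
    ⟨hul, hrpos, hrge, hFl, hc1, rfl, hj1⟩
  have H2 : LeftPart P.flip (-j - 1) (flipState ur) r sr Ur (-(P.mid j + s2 * P.dt / 2)) (-s2)
      (flipState (P.steady (P.mid j + s2 * P.dt / 2) (P.mid j) uM)) := by
    refine ⟨hur.flip, hrpos, hrge, hFr, invCell_flip hc2, ?_, ?_⟩
    · rw [mid_flip]
      change _ = -P.mid j + -s2 * P.dt / 2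
      ring
    · unfold TwoJump at hj2
      rw [flipState_flipState] at hj2
      exact hj2
  have hfc : 0 ≤ fanConst γ M B * exp B := mul_nonneg h.fanConst_nonneg (exp_pos _).le
  have hme : 0 ≤ midErrConst γ M B b₁ * exp (2 * B) :=
    mul_nonneg h.midErrConst_nonneg (exp_pos _).le
  have hη := h.errSize_pos
  have hle1 : 2 * (fanConst γ M B * exp B) * P.errSize ≤ regErrConst γ M B b₁ * P.errSize :=
    mul_le_mul_of_nonneg_right (by unfold regErrConst; linarith) hη.le
  have hle2 : 2 * (midErrConst γ M B b₁ * exp (2 * B) * P.errSize) ≤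
      regErrConst γ M B b₁ * P.errSize := by
    rw [← mul_assoc]
    exact mul_le_mul_of_nonneg_right (by unfold regErrConst; linarith) hη.le
  have hVev : ∀ᶠ τ in 𝓝[<] P.dt, 0 < τ ∧ τ < P.dt := eventually_mem_Ioo h.dt_pos
  rcases eventually_lt_mul_or (x - P.mid j) s1 P.dt with hs1 | hs1
  · have hp := two_le_fanSize P (zInv P.θ ul) (waveVel P.γ P.θ ul r - r ^ P.θ / P.θ)
    have := h.fanBar_leftLimit k1 hK' (by omega) (fun k hk hkq => H1.block h k1 hk hkq) hx
    refine (this.congr ?_).mono (by linarith) (by linarith)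
    filter_upwards [hVev, hs1] with τ h1 h2
    rw [hVeq x τ hx1 hx2 h1.1.le h1.2, if_pos h2]
  · rcases eventually_lt_mul_or (x - P.mid j) s2 P.dt with hs2 | hs2
    · have := h.middle_leftLimit hK H1 H2 hc2 huM hmid hx
      refine (this.congr ?_).mono (by linarith) (by linarith)
      filter_upwards [hVev, hs1, hs2] with τ h1 h2 h3
      rw [hVeq x τ hx1 hx2 h1.1.le h1.2, if_neg h2, if_pos h3]
    · have hp := two_le_fanSize P.flip (zInv P.flip.θ (flipState ur))
        (waveVel P.flip.γ P.flip.θ (flipState ur) r - r ^ P.flip.θ / P.flip.θ)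
      have := hf.fanBar_leftLimit k1 hK' (by omega) (fun k hk hkq => H2.block hf k1 hk hkq)
        (invCell_flip hx)
      refine ((leftLimit_of_flip this).congr ?_).mono ?_ ?_
      · filter_upwards [hVev, hs1, hs2] with τ h1 h2 h3
        rw [hVeq x τ hx1 hx2 h1.1.le h1.2, if_neg h2, if_neg h3, fracStep_flipState]
        rfl
      · change _ ≤ P.lower x - 2 * (fanConst γ M B * exp B) * P.errSize
        linarith
      · change P.upper x + 2 * (fanConst γ M B * exp B) * P.errSize ≤ _
        linarith

end Regime

/-! ### The Riemann solution stays in a box of Riemann invariants -/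

/-- In a rarefaction w is constant and z rises from its value at ul. Across a shock w falls, and z
is bounded at the end state by assumption. -/
lemma oneWave_leftLimit {γ θ T lo hi y r : ℝ} {ul : State} (hγ : γ = 1 + 2 * θ) (hθ : 0 < θ)
    (hT : 0 < T) (hl : 0 < ul.1) (hr : 0 ≤ r) (h1 : lo ≤ zInv θ ul) (h2 : wInv θ ul ≤ hi)
    (h0 : lo ≤ 0) (h0' : 0 ≤ hi) (hm : 0 < r → lo ≤ waveVel γ θ ul r - r ^ θ / θ) :
    LeftLimitIn θ T lo hi (fun τ => oneWave γ θ ul r (y / τ)) := by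
  have hul : LeftLimitIn θ T lo hi (fun _ => ul) :=
    .const ⟨hl.le, fun h => absurd h hl.ne'⟩ h1 h2
  have hend : LeftLimitIn θ T lo hi (fun _ => (r, r * waveVel γ θ ul r)) := by
    rcases hr.eq_or_lt with rfl | hr
    · have e : ((0 : ℝ) ^ θ) = 0 := Real.zero_rpow hθ.ne'
      exact .const ⟨le_rfl, by simp⟩ (by simp [zInv, vel, e, h0]) (by simp [wInv, vel, e, h0'])
    · have e : vel (r, r * waveVel γ θ ul r) = waveVel γ θ ul r := by
        simp [vel, hr.ne']
      have := Regime.waveVel_le (r := r) hγ hθ hl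
      refine .const ⟨hr.le, fun h => absurd h hr.ne'⟩ ?_ ?_
      · rw [zInv, e]; exact hm hr
      · rw [wInv, e]; change _ + r ^ θ / θ ≤ _; linarith
  by_cases hlt : ul.1 < r
  · rcases eventually_div_lt_or y (vel ul - shockS γ r ul.1) hT with h | h
    · refine hul.congr ?_
      filter_upwards [h] with τ hτ
      rw [oneWave, if_pos hlt, if_pos hτ]
    · refine hend.congr ?_
      filter_upwards [h] with τ hτ
      rw [oneWave, if_pos hlt, if_neg hτ]
  · rcases eventually_div_lt_or y (lam1 θ ul) hT with h | h
    · refine hul.congr ?_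
      filter_upwards [h] with τ hτ
      rw [oneWave, if_neg hlt, if_pos hτ]
    · rcases eventually_div_lt_or y (waveVel γ θ ul r - r ^ θ) hT with h' | h'
      · have hξ : Tendsto (fun τ => y / τ) (𝓝[<] T) (𝓝 (y / T)) :=
          ((continuousAt_const.div continuousAt_id hT.ne').tendsto).mono_left nhdsWithin_le_nhds
        -- The value of z obtained from λ₁ = ξ at constant w.
        have hlim : Tendsto (fun τ => (2 * (y / τ) - (1 - θ) * wInv θ ul) / (1 + θ)) (𝓝[<] T)
            (𝓝 ((2 * (y / T) - (1 - θ) * wInv θ ul) / (1 + θ))) :=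
          ((hξ.const_mul 2).sub_const _).div_const _
        have hθ1 : 0 < 1 + θ := by linarith
        refine LeftLimitIn.congr (LeftLimitIn.ofZW hθ hlim
          (tendsto_const_nhds (x := wInv θ ul)) ?_ ?_ h2) ?_
        · filter_upwards [h'] with τ hτ
          rw [Regime.waveVel_of_le (not_lt.mp hlt)] at hτ
          have := Real.rpow_nonneg hr θ
          have := div_nonneg this hθ.le
          rw [div_lt_iff₀ hθ1]
          linarith
        · refine h1.trans (ge_of_tendsto hlim ?_)
          filter_upwards [h] with τ hτ
          rw [le_div_iff₀ hθ1]
          have e := rpow_eq hθ.ne' ul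
          rw [lam1, vel_eq θ, e, not_lt] at hτ
          linarith
        · filter_upwards [h, h'] with τ hτ hτ'
          rw [oneWave, if_neg hlt, if_neg hτ, if_pos hτ', ofZW]
          have e1 : θ * (wInv θ ul - (2 * (y / τ) - (1 - θ) * wInv θ ul) / (1 + θ)) / 2 =
              θ * (wInv θ ul - y / τ) / (1 + θ) := by field_simp; ring
          have e2 : (wInv θ ul + (2 * (y / τ) - (1 - θ) * wInv θ ul) / (1 + θ)) / 2 =
              (y / τ + θ * wInv θ ul) / (1 + θ) := by field_simp; ring
          rw [e1, e2]
      · refine hend.congr ?_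
        filter_upwards [h, h'] with τ hτ hτ'
        rw [oneWave, if_neg hlt, if_neg hτ, if_neg hτ']

/-- `u` is the vacuum, or its invariants satisfy `lo ≤ z` and `w ≤ hi`. -/
def InBox (θ lo hi : ℝ) (u : State) : Prop :=
  u = (0, 0) ∨ (0 < u.1 ∧ lo ≤ zInv θ u ∧ wInv θ u ≤ hi)

lemma InBox.flip {θ lo hi : ℝ} {u : State} (h : InBox θ lo hi u) :
    InBox θ (-hi) (-lo) (flipState u) := by
  rcases h with rfl | ⟨h1, h2, h3⟩
  · left; simp [flipState]
  · right; simp; exact ⟨h1, h3, h2⟩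

lemma oneWave_vacuum {γ θ : ℝ} (hθ : 0 < θ) (ξ : ℝ) : oneWave γ θ (0, 0) 0 ξ = (0, 0) := by
  have e : ((0 : ℝ) ^ θ) = 0 := Real.zero_rpow hθ.ne'
  by_cases h : ξ < 0 <;> simp [oneWave, lam1, waveVel, vel, e, h]

/-- The middle state lies on the 2-wave curve of ur, along which z is at least z(ur): the reflected
form of `waveVel_le`. -/
lemma waveVel_ge_of_mid {γ θ r : ℝ} {ul ur : State} (hγ : γ = 1 + 2 * θ) (hθ : 0 < θ)
    (hr : 0 < ur.1) (h : waveVel γ θ ul r = -waveVel γ θ (flipState ur) r) :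
    zInv θ ur ≤ waveVel γ θ ul r - r ^ θ / θ := by
  have := Regime.waveVel_le (r := r) hγ hθ (ul := flipState ur) hr
  rw [wInv_flipState] at this
  linarith

lemma riemannSol_leftLimit {γ θ T lo hi y r : ℝ} {ul ur : State} (hγ : γ = 1 + 2 * θ)
    (hθ : 0 < θ) (hT : 0 < T) (hl : InBox θ lo hi ul) (hr : InBox θ lo hi ur)
    (h0 : lo ≤ 0) (h0' : 0 ≤ hi) (hm : IsMiddleDensity γ θ ul ur r) :
    LeftLimitIn θ T lo hi (fun τ => riemannSol γ θ ul ur r y τ) := by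
  have hpos := eventually_mem_Ioo hT
  have hzero : ul.1 = 0 ∨ ur.1 = 0 → r = 0 := by
    rintro (h | h) <;> rcases hm with ⟨h1, h2, -⟩ | ⟨h1, -⟩
    · exact absurd h h1.ne'
    · exact h1
    · exact absurd h h2.ne'
    · exact h1
  have hleft : 0 < ul.1 → lo ≤ zInv θ ul → wInv θ ul ≤ hi →
      LeftLimitIn θ T lo hi (fun τ => oneWave γ θ ul r (y / τ)) := by
    intro g1 g2 g3
    refine oneWave_leftLimit hγ hθ hT g1 ?_ g2 g3 h0 h0' ?_
    · rcases hm with ⟨-, -, h1, -⟩ | ⟨h1, -⟩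
      exacts [h1.le, h1.ge]
    · intro hr0
      rcases hm with ⟨-, h1, -, h2⟩ | ⟨h1, -⟩
      · rcases hr with rfl | ⟨-, h3, -⟩
        · exact absurd h1 (lt_irrefl _)
        · exact h3.trans (waveVel_ge_of_mid hγ hθ h1 h2)
      · exact absurd h1 hr0.ne'
  have hright : 0 < ur.1 → lo ≤ zInv θ ur → wInv θ ur ≤ hi →
      LeftLimitIn θ T lo hi (fun τ => flipState (oneWave γ θ (flipState ur) r (-(y / τ)))) := by
    intro g1 g2 g3
    have key : LeftLimitIn θ T (-hi) (-lo)
        (fun τ => oneWave γ θ (flipState ur) r ((-y) / τ)) := by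
      refine oneWave_leftLimit hγ hθ hT g1 ?_ (by simpa using g3) (by simpa using g2)
        (by linarith) (by linarith) ?_
      · rcases hm with ⟨-, -, h1, -⟩ | ⟨h1, -⟩
        exacts [h1.le, h1.ge]
      · intro hr0
        rcases hm with ⟨h1, -, -, h2⟩ | ⟨h1, -⟩
        · rcases hl with rfl | ⟨-, -, h3⟩
          · exact absurd h1 (lt_irrefl _)
          · have := Regime.waveVel_le (r := r) hγ hθ h1
            linarith
        · exact absurd h1 hr0.ne'
    have := key.flip
    rw [neg_neg, neg_neg] at this
    refine this.congr (Eventually.of_forall fun τ => ?_)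
    rw [neg_div]
  rcases hr with rfl | ⟨hr1, hr2, hr3⟩
  · obtain rfl := hzero (Or.inr rfl)
    rcases hl with rfl | ⟨hl1, hl2, hl3⟩
    · refine LeftLimitIn.congr (LeftLimitIn.const (u := (0, 0)) ⟨le_rfl, fun _ => rfl⟩ ?_ ?_) ?_
      · simp [zInv, vel, Real.zero_rpow hθ.ne', h0]
      · simp [wInv, vel, Real.zero_rpow hθ.ne', h0']
      · filter_upwards [hpos] with τ hτ
        rw [riemannSol, if_neg hτ.1.ne', riemannProfile, if_pos (Or.inl rfl), oneWave_vacuum hθ]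
    · refine (hleft hl1 hl2 hl3).congr ?_
      filter_upwards [hpos] with τ hτ
      rw [riemannSol, if_neg hτ.1.ne', riemannProfile, if_pos (Or.inl rfl)]
  · rcases hl with rfl | ⟨hl1, hl2, hl3⟩
    · refine (hright hr1 hr2 hr3).congr ?_
      filter_upwards [hpos] with τ hτ
      rw [riemannSol, if_neg hτ.1.ne', riemannProfile, if_neg]
      simp [hr1.ne']
    · rcases eventually_div_lt_or y (waveVel γ θ ul r) hT with h | h
      · refine (hleft hl1 hl2 hl3).congr ?_
        filter_upwards [hpos, h] with τ hτ h
        rw [riemannSol, if_neg hτ.1.ne', riemannProfile, if_pos (Or.inr ⟨hl1, h⟩)]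
      · refine (hright hr1 hr2 hr3).congr ?_
        filter_upwards [hpos, h] with τ hτ h
        rw [riemannSol, if_neg hτ.1.ne', riemannProfile, if_neg]
        rintro (h3 | h3)
        · exact hr1.ne' h3
        · exact h h3.2

namespace Regime

variable {γ M B b₁ K : ℝ} {P : Scheme}

/-! ### The modified sides of a cell near the vacuum -/

lemma abs_lower_sub_le (h : Regime γ M B b₁ K P) (hK : b₁ ≤ K) {j : ℤ} {x y : ℝ}
    (hx : P.InCell j x) (hy : P.InCell j y) :
    |P.lower y - P.lower x| ≤ dispConst M B b₁ * P.dx := by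
  have h1 := h.abs_cumul_sub_le_dx hx hy
  have h2 : |P.lower x| ≤ invBound M B := by
    have := h.le_lower x
    have := h.lower_le x
    have := h.invBound_ge
    have := mul_pos h.M_pos (exp_pos (-B))
    rw [abs_le]; constructor <;> linarith [h.invBound_pos]
  have h3 := h.abs_mul_exp_sub_le hK h1 h2
  have e : P.lower x * exp (P.cumul x - P.cumul y) = P.lower y := by
    unfold Scheme.lower
    rw [mul_assoc, ← Real.exp_add]; ring_nf
  rwa [e] at h3

lemma invCell_right (h : Regime γ M B b₁ K P) (j : ℤ) : P.InCell j (((j : ℝ) + 1) * P.dx) :=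
  ⟨by have := h.dx_pos; linarith, le_rfl⟩

lemma upper_pos (h : Regime γ M B b₁ K P) (x : ℝ) : 0 < P.upper x :=
  (mul_pos h.M_pos (exp_pos _)).trans_le (h.le_upper x)

/-- Threshold for the mesh in the cells near the vacuum. -/
def vacThreshold (γ M B b₁ : ℝ) : ℝ :=
  fanThreshold γ M B b₁ + (2 * stepThreshold γ M B b₁ + 5 * dispConst M B b₁ + 2) + 2 * b₁ +
    8 / ((γ - 1) / 2 * (M * exp (-B))) + 4 * changeConst γ M B b₁ / (M * exp (-B)) +
    invBound M B * b₁ * (muConst ((γ - 1) / 2) + 1 + 1 / ((γ - 1) / 2)) / (2 * M * exp B)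

lemma vacThreshold_le (h : Regime γ M B b₁ K P) (hK : vacThreshold γ M B b₁ ≤ K) :
    fanThreshold γ M B b₁ ≤ K ∧
    2 * stepThreshold γ M B b₁ + 5 * dispConst M B b₁ + 2 ≤ K ∧ 2 * b₁ + 1 ≤ K ∧
    8 / (P.θ * (M * exp (-B))) ≤ K ∧ 4 * changeConst γ M B b₁ / (M * exp (-B)) ≤ K ∧
    invBound M B * b₁ * (muConst P.θ + 1 + 1 / P.θ) / (2 * M * exp B) + 1 ≤ K := by
  have hθ := h.θ_pos
  have hmu := muConst_nonneg h.θ_pos (by linarith [h.θ_le])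
  have hM := h.M_pos
  have hb := h.b₁_nonneg
  have hG := h.invBound_pos
  have h1 : 0 ≤ 8 / (P.θ * (M * exp (-B))) := by positivity
  have h2 : 0 ≤ 4 * changeConst γ M B b₁ / (M * exp (-B)) := by
    have := h.changeConst_nonneg; positivity
  have h3 : 0 ≤ invBound M B * b₁ * (muConst P.θ + 1 + 1 / P.θ) / (2 * M * exp B) := by
    positivity
  have h4 := h.stepThreshold_ge
  have h5 := h.dispConst_nonneg
  have h6 : 6 ≤ fanThreshold γ M B b₁ := by
    have := mul_nonneg h.fanConst_nonneg (exp_pos B).le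
    unfold fanThreshold; linarith
  unfold vacThreshold at hK
  rw [← h.θ_eq] at hK
  refine ⟨?_, ?_, ?_, ?_, ?_, ?_⟩ <;> linarith

lemma fan_leftLimit (h : Regime γ M B b₁ K P) (hK : vacThreshold γ M B b₁ ≤ K)
    {j : ℤ} {ul : State} {zend : ℝ} {q : ℕ} {s : ℕ → ℝ} {U : ℕ → State}
    (hul : NodeData P (j * P.dx) ul)
    (hend : zInv P.θ ul ≤ zend ∧ zend + 2 * (P.dx ^ (P.β * P.θ) / P.θ) ≤ wInv P.θ ul)
    (hF : P.IsFan j ul zend q s U) (hq1 : 1 ≤ q) (hq : q ≤ P.fanSize (zInv P.θ ul) zend)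
    (hR : ∀ k, 1 ≤ k → k + 1 ≤ q →
      zInv P.θ (P.fanBlock j s U k (P.fanNode j s (k + 1))) ≤ zInv P.θ (U (k + 1)))
    {x : ℝ} (hx : P.InCell j x) :
    LeftLimitIn P.θ P.dt (P.lower x - 2 * (fanConst γ M B * exp B) * P.errSize)
      (P.upper x + 2 * (fanConst γ M B * exp B) * P.errSize)
      (fun τ => P.fracStep x τ (P.fanBar j s U q x τ)) := by
  obtain ⟨k1, k2, -⟩ := h.vacThreshold_le hK
  refine h.fanBar_leftLimit k1 k2 hq1 (fun k hk hkq => ?_) hx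
  exact ⟨(h.fan_bounds k1 hul.pos hul.lower hul.upper (fun _ => hend) hF hq hR hk hkq).2.2.2,
    (h.fan_gap k1 hul (fun _ => hend) hF hq hR hk hkq).2⟩

/-- Only the part to the left of the ray of speed λ₁(u_p) is used. This matters when the fan has two
states, because its single jump may then be compressive. -/
lemma vacuumFan_leftLimit (h : Regime γ M B b₁ K P) (hK : vacThreshold γ M B b₁ ≤ K)
    {j : ℤ} {ul : State} {zend : ℝ} {s : ℕ → ℝ} {U : ℕ → State}
    (hul : NodeData P (j * P.dx) ul)
    (hend : zInv P.θ ul ≤ zend ∧ zend + 2 * (P.dx ^ (P.β * P.θ) / P.θ) ≤ wInv P.θ ul)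
    (hF : P.IsFan j ul zend (P.fanSize (zInv P.θ ul) zend) s U)
    {x : ℝ} (hx : P.InCell j x)
    (hc : ∀ᶠ τ in 𝓝[<] P.dt,
      x - P.mid j ≤ lam1 P.θ (U (P.fanSize (zInv P.θ ul) zend)) * τ) :
    LeftLimitIn P.θ P.dt (P.lower x - 2 * (fanConst γ M B * exp B) * P.errSize)
      (P.upper x + 2 * (fanConst γ M B * exp B) * P.errSize)
      (fun τ => P.fracStep x τ (P.fanBar j s U (P.fanSize (zInv P.θ ul) zend) x τ)) := by
  obtain ⟨k1, -⟩ := h.vacThreshold_le hK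
  have h2 := two_le_fanSize P (zInv P.θ ul) zend
  rcases h2.eq_or_lt with hp | hp
  · have hp' := hp.symm
    rw [hp'] at hF hc ⊢
    obtain ⟨-, -, hj, -⟩ := hF.2 1 le_rfl le_rfl
    rcases le_or_gt (zInv P.θ (P.fanBlock j s U 1 (P.fanNode j s 2))) (zInv P.θ (U 2)) with hz | hz
    · refine h.fan_leftLimit hK hul hend hF (by norm_num) hp.le (fun k hk hkq => ?_) hx
      obtain rfl : k = 1 := by omega
      exact hz
    -- A jump that lowers z is compressive. By Lax's inequality its ray is faster than λ₁(u_2), so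
    -- the second block never occurs in the sector considered.
    · have hlt : (P.fanBlock j s U 1 (P.fanNode j s 2)).1 < (U 2).1 := by
        by_contra hge
        push Not at hge
        obtain ⟨-, h3, -⟩ := hj.wInv_of_ge h.γ_eq' h.θ_pos (by linarith [h.θ_le]) hge
        have := div_nonneg
          (sub_nonneg.mpr (Real.rpow_le_rpow hj.2.1.le hge h.θ_pos.le)) h.θ_pos.le
        exact absurd (this.trans h3) (by linarith)
      have hs := hj.lam1_lt h.γ_eq' h.θ_pos hlt
      have hF1 : P.IsFan j ul zend 1 s U := ⟨hF.1, fun k h3 h4 => by omega⟩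
      refine (h.fan_leftLimit hK hul hend hF1 le_rfl (by omega)
        (fun k h3 h4 => by omega) hx).congr ?_
      filter_upwards [hc, eventually_mem_Ioo h.dt_pos] with τ h3 h4
      have h5 : fanIndex s (x - P.mid j) τ 2 = 1 := by
        rw [fanIndex, if_neg]
        · simp [fanIndex]
        · rintro ⟨-, h5⟩
          have := mul_lt_mul_of_pos_right hs h4.1
          change s 2 * τ ≤ _ at h5
          linarith
      have h6 : fanIndex s (x - P.mid j) τ 1 = 1 := by simp [fanIndex]
      rw [Scheme.fanBar, Scheme.fanBar, h5, h6]
  · exact h.fan_leftLimit hK hul hend hF (by omega) le_rfl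
      (h.fan_raises k1 hul.pos hul.lower hul.upper hend hF le_rfl hp) hx

lemma fracStepVac_eq {P : Scheme} (h0 : P.θ ≠ 0) (x τ : ℝ) (u : State) : P.fracStepVac x τ u =
    ofZW P.θ (-(-zInv P.θ u + source P.θ (-P.a x) (P.b x) (-wInv P.θ u) (-zInv P.θ u) * τ))
      (wInv P.θ u - source P.θ (-P.a x) (P.b x) (zInv P.θ u) (wInv P.θ u) * τ) := by
  unfold Scheme.fracStepVac source lam1 lam2
  rw [rpow_eq h0, vel_eq P.θ]
  congr 1 <;> ring

/-- The fractional step of a state whose invariants are both negative, in the version used near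
the vacuum. -/
lemma fracStepVac_leftLimit (h : Regime γ M B b₁ K P) (hK : vacThreshold γ M B b₁ ≤ K)
    {x : ℝ} {u : State} (hzw : zInv P.θ u < wInv P.θ u) (hz : P.lower x ≤ zInv P.θ u)
    (hw : wInv P.θ u ≤ -(M * exp (-B) / 4)) :
    LeftLimitIn P.θ P.dt (P.lower x) (P.upper x) (fun τ => P.fracStepVac x τ u) := by
  obtain ⟨k1, k2, k3, k4, k5, k6⟩ := h.vacThreshold_le hK
  have hd := h.dx_pos
  have hM := h.M_pos
  have hm0 : 0 < M * exp (-B) := mul_pos hM (exp_pos _)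
  have hup := h.upper_pos x
  have hD := h.dispConst_nonneg
  have hst := h.stepThreshold_ge
  obtain ⟨h1, h2⟩ := h.abs_inv_le (x := x) (η := 0) zero_le_one hzw.le (by linarith) (by linarith)
  have hsrc : ∀ τ, 0 ≤ τ → τ ≤ P.dt →
      |source P.θ (-P.a x) (P.b x) (zInv P.θ u) (wInv P.θ u) * τ| ≤
        changeConst γ M B b₁ * P.dx := fun τ h3 h4 =>
    h.source_mul_le (by rw [abs_neg]; exact h.a_le x) h1 h2 h3 h4
  simp only [fracStepVac_eq h.θ_pos.ne']
  refine LeftLimitIn.ofZW h.θ_pos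
    (zl := -(-zInv P.θ u + source P.θ (-P.a x) (P.b x) (-wInv P.θ u) (-zInv P.θ u) * P.dt))
    (wl := wInv P.θ u - source P.θ (-P.a x) (P.b x) (zInv P.θ u) (wInv P.θ u) * P.dt)
    ?_ ?_ ?_ ?_ ?_
  · exact (Continuous.tendsto (by fun_prop) _).mono_left nhdsWithin_le_nhds
  · exact (Continuous.tendsto (by fun_prop) _).mono_left nhdsWithin_le_nhds
  · filter_upwards [eventually_mem_Ioo h.dt_pos] with τ hτ
    have hθ := h.θ_pos
    -- The gap between w and z is only multiplied by a factor near 1. It stays positive without any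
    -- lower bound, so the state may be arbitrarily close to the vacuum.
    have e : (wInv P.θ u - source P.θ (-P.a x) (P.b x) (zInv P.θ u) (wInv P.θ u) * τ) -
        -(-zInv P.θ u + source P.θ (-P.a x) (P.b x) (-wInv P.θ u) (-zInv P.θ u) * τ) =
        (wInv P.θ u - zInv P.θ u) * (1 + P.θ * ((wInv P.θ u + zInv P.θ u) / 2) *
          (P.a x + P.b x * (1 + 1 / P.θ)) * τ) := by
      unfold source; field_simp; ring
    have hv : |(wInv P.θ u + zInv P.θ u) / 2| ≤ invBound M B := by
      rw [abs_le] at *; constructor <;> linarith [h1.1, h1.2, h2.1, h2.2]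
    have hmu := muConst_nonneg h.θ_pos (by linarith [h.θ_le])
    have hb := h.b_nonneg x
    have hb1 := h.b_le x
    have hab : |P.a x + P.b x * (1 + 1 / P.θ)| ≤ b₁ * (muConst P.θ + 1 + 1 / P.θ) := by
      have h5 : 0 ≤ P.b x * (1 + 1 / P.θ) := by positivity
      have h6 : 0 ≤ muConst P.θ + 1 + 1 / P.θ := by positivity
      calc _ ≤ |P.a x| + |P.b x * (1 + 1 / P.θ)| := abs_add_le _ _
        _ ≤ muConst P.θ * P.b x + P.b x * (1 + 1 / P.θ) := by
          rw [abs_of_nonneg h5]; linarith [h.a_le x]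
        _ = P.b x * (muConst P.θ + 1 + 1 / P.θ) := by ring
        _ ≤ _ := mul_le_mul_of_nonneg_right hb1 h6
    have hθ1 : P.θ ≤ 1 := by linarith [h.θ_le]
    have hb0 := h.b₁_nonneg
    have hG := h.invBound_pos
    have hsmall : |P.θ * ((wInv P.θ u + zInv P.θ u) / 2) *
          (P.a x + P.b x * (1 + 1 / P.θ)) * τ| < 1 := by
      rw [abs_mul, abs_mul, abs_mul, abs_of_pos hθ, abs_of_pos hτ.1]
      calc _ ≤ 1 * invBound M B * (b₁ * (muConst P.θ + 1 + 1 / P.θ)) * P.dt := by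
            have := hτ.2.le
            have := hτ.1.le
            gcongr
        _ = invBound M B * b₁ * (muConst P.θ + 1 + 1 / P.θ) / (2 * M * exp B) * P.dx := by
            rw [h.cfl]; field_simp
        _ ≤ (K - 1) * P.dx := mul_le_mul_of_nonneg_right (by linarith) hd.le
        _ < 1 := by linarith [h.dx_small]
    have := mul_pos (sub_pos.mpr hzw) (show 0 < 1 + P.θ * ((wInv P.θ u + zInv P.θ u) / 2) *
          (P.a x + P.b x * (1 + 1 / P.θ)) * τ by linarith [(abs_lt.mp hsmall).1])
    linarith
  · have := h.lower_step (by linarith) le_rfl zero_le_one hzw.le (x := x)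
      (by linarith) (show wInv P.θ u ≤ P.upper x + 0 by linarith)
    linarith
  -- Since w starts a fixed distance below zero and moves by O(dx), it stays negative, hence below
  -- the upper bound.
  · have h3 := (abs_le.mp (hsrc P.dt h.dt_pos.le le_rfl)).1
    have h4 : changeConst γ M B b₁ * P.dx ≤ M * exp (-B) / 4 := by
      rw [div_le_iff₀ hm0] at k5
      have h5 := mul_le_mul_of_nonneg_right k5 hd.le
      have h6 := mul_le_mul_of_nonneg_left h.dx_small hm0.le
      linarith
    linarith

/-- Both bounds increase with x. The box takes the lower one at the right end of the cell, which is
L_j, and the upper one at the left end, so a state in it is admissible at each point of the cell. -/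
lemma vacuumSide_props (h : Regime γ M B b₁ K P) (hK : vacThreshold γ M B b₁ ≤ K)
    {j : ℤ} {ul uS : State} {c : ℝ} {W : ℝ → ℝ → State} (hul : NodeData P (j * P.dx) ul)
    (hV : P.VacuumSide j ul uS c W) :
    InBox P.θ (P.lower (((j : ℝ) + 1) * P.dx)) (P.upper (j * P.dx)) uS ∧
    ∀ x, P.InCell j x → (∀ᶠ τ in 𝓝[<] P.dt, x - P.mid j ≤ c * τ) →
      LeftLimitIn P.θ P.dt (P.lower x - 2 * (fanConst γ M B * exp B) * P.errSize)
      (P.upper x + 2 * (fanConst γ M B * exp B) * P.errSize) (W x) := by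
  obtain ⟨k1, k2, k3, k4, k5, k6⟩ := h.vacThreshold_le hK
  have hd := h.dx_pos
  have hM := h.M_pos
  have hθ := h.θ_pos
  have hm0 : 0 < M * exp (-B) := mul_pos hM (exp_pos _)
  have hb := h.b₁_nonneg
  have hst := h.stepThreshold_ge
  have hD := h.dispConst_nonneg
  have herr : 0 ≤ 2 * (fanConst γ M B * exp B) * P.errSize :=
    mul_nonneg (mul_nonneg zero_le_two (mul_nonneg h.fanConst_nonneg (exp_pos _).le))
      h.errSize_pos.le
  have hzw := zInv_lt_wInv hθ hul.pos
  have hLL : P.lowerL j = P.lower (((j : ℝ) + 1) * P.dx) := rfl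
  have hzr := rpow_eq hθ.ne' ul
  rw [← hLL]
  rcases hV with ⟨hρ, zend, p, s, U, hze, rfl, hF, rfl, rfl, hW⟩ | ⟨-, hz, rfl, -, hW⟩ |
    ⟨hρ, hz, x4, hx4, hzx4, huS, -, hW⟩
  · have hβ1 : P.dx ^ (P.β * P.θ) ≤ (2 * P.dx ^ P.β) ^ P.θ := by
      refine h.rpow_ge_of_ge ?_
      have := Real.rpow_pos_of_pos hd P.β
      linarith
    have hβ2 : (2 * P.dx ^ P.β) ^ P.θ ≤ ul.1 ^ P.θ := by
      have := Real.rpow_pos_of_pos hd P.β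
      exact Real.rpow_le_rpow (by linarith) hρ.le hθ.le
    have hβ0 : 0 < P.dx ^ (P.β * P.θ) := Real.rpow_pos_of_pos hd _
    have hend : zInv P.θ ul ≤ zend ∧ zend + 2 * (P.dx ^ (P.β * P.θ) / P.θ) ≤ wInv P.θ ul := by
      constructor
      · have h1 := div_le_div_of_nonneg_right hβ2 hθ.le
        have h2 : ul.1 ^ P.θ / P.θ = (wInv P.θ ul - zInv P.θ ul) / 2 := by
          rw [hzr]; field_simp
        linarith
      · have h1 := div_le_div_of_nonneg_right hβ1 hθ.le
        linarith
    refine ⟨?_, fun x hx hc => ?_⟩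
    · right
      have h2 := two_le_fanSize P (zInv P.θ ul) zend
      obtain ⟨q, hq⟩ : ∃ q, P.fanSize (zInv P.θ ul) zend = q + 1 :=
        ⟨P.fanSize (zInv P.θ ul) zend - 1, by omega⟩
      have h3 : zInv P.θ (U (P.fanSize (zInv P.θ ul) zend)) = zend := by
        obtain ⟨h4, -⟩ := hF.2 q (by omega) (by omega)
        rw [← hq] at h4
        rw [h4, Scheme.fanZ, if_pos rfl]
      -- L_j exceeds the bound at the node by O(dx) only, while the gap at the node is at least
      -- dx^(δθ).
      have hlt : max zend (P.lowerL j) < wInv P.θ ul := by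
        refine max_lt ?_ ?_
        · have := div_pos hβ0 hθ
          linarith [hend.2]
        · have h4 := (abs_le.mp (h.abs_lower_sub_le (by linarith) (h.invCell_left j)
            (h.invCell_right j))).2
          have h5 : dispConst M B b₁ * P.dx < K * P.dx := mul_lt_mul_of_pos_right (by linarith) hd
          have h6 := h.dx_δ
          have h7 := hul.lower
          have h8 := hul.gap
          rw [hLL]
          linarith
      rw [h3]
      refine ⟨ofZW_fst_pos hθ hlt, ?_, ?_⟩
      · rw [zInv_ofZW hθ hlt]; exact le_max_right _ _
      · rw [wInv_ofZW hθ hlt]; exact hul.upper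
    · refine (h.vacuumFan_leftLimit hK hul hend hF hx hc).congr ?_
      exact Eventually.of_forall fun τ => hW x τ
  · refine ⟨Or.inr ⟨hul.pos, hz, hul.upper⟩, fun x hx _ => ?_⟩
    refine LeftLimitIn.congr (LeftLimitIn.const (u := uS) ⟨hul.pos.le, fun h => absurd h hul.pos.ne'⟩
      ?_ ?_) (Eventually.of_forall fun τ => hW x τ)
    · have := h.lower_mono hx.2
      rw [hLL] at hz
      linarith
    · have := h.upper_mono hx.1
      linarith [hul.upper]
  -- Here z is below L_j < 0 and the density is small, so w is negative too and may decay towards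
  -- zero along with z.
  · have hwneg : wInv P.θ ul ≤ -(M * exp (-B) / 2) := by
      have h1 : ul.1 ^ P.θ ≤ 2 * P.dx ^ (P.β * P.θ) := by
        have h0 := Real.rpow_pos_of_pos hd P.β
        calc ul.1 ^ P.θ ≤ (2 * P.dx ^ P.β) ^ P.θ := Real.rpow_le_rpow hul.pos.le hρ hθ.le
          _ = 2 ^ P.θ * P.dx ^ (P.β * P.θ) := by
            rw [Real.mul_rpow zero_le_two h0.le, ← Real.rpow_mul hd.le]
          _ ≤ 2 ^ (1 : ℝ) * P.dx ^ (P.β * P.θ) := by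
            refine mul_le_mul_of_nonneg_right ?_ (Real.rpow_nonneg hd.le _)
            exact Real.rpow_le_rpow_of_exponent_le one_le_two (by linarith [h.θ_le])
          _ = _ := by rw [Real.rpow_one]
      have h2 : P.dx ^ (P.β * P.θ) * 8 ≤ P.θ * (M * exp (-B)) := by
        have h3 := h.small_β
        have h4 : 0 < P.θ * (M * exp (-B)) := mul_pos hθ hm0
        rw [div_le_iff₀ h4] at k4
        have h5 := mul_le_mul_of_nonneg_right k4 (Real.rpow_nonneg hd.le (P.β * P.θ))
        nlinarith
      have h3 := h.lower_le (((j : ℝ) + 1) * P.dx)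
      rw [hLL] at hz
      have h6 : P.θ * (wInv P.θ ul - zInv P.θ ul) ≤ P.θ * (M * exp (-B) / 2) := by linarith
      have := le_of_mul_le_mul_left h6 hθ
      linarith
    have hint : ∀ x, (∫ y in ((j : ℝ) * P.dx)..x, P.b y) = P.cumul x - P.cumul (j * P.dx) :=
      fun x => h.cumul_sub _ _
    have hlt4 : zInv P.θ ul * exp (-∫ y in ((j : ℝ) * P.dx)..x4, P.b y) <
        wInv P.θ ul * exp (-∫ y in ((j : ℝ) * P.dx)..x4, P.b y) :=
      mul_lt_mul_of_pos_right hzw (exp_pos _)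
    refine ⟨Or.inr ?_, fun x hx _ => ?_⟩
    · rw [huS]
      refine ⟨ofZW_fst_pos hθ hlt4, ?_, ?_⟩
      · rw [zInv_ofZW hθ hlt4, hzx4]
      · rw [wInv_ofZW hθ hlt4]
        have h1 : wInv P.θ ul * exp (-∫ y in ((j : ℝ) * P.dx)..x4, P.b y) ≤ 0 :=
          mul_nonpos_of_nonpos_of_nonneg (by linarith) (exp_pos _).le
        exact h1.trans (h.upper_pos _).le
    · have hltx : zInv P.θ ul * exp (-∫ y in ((j : ℝ) * P.dx)..x, P.b y) <
          wInv P.θ ul * exp (-∫ y in ((j : ℝ) * P.dx)..x, P.b y) :=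
        mul_lt_mul_of_pos_right hzw (exp_pos _)
      refine LeftLimitIn.congr ((h.fracStepVac_leftLimit hK (x := x)
        (u := ofZW P.θ (zInv P.θ ul * exp (-∫ y in ((j : ℝ) * P.dx)..x, P.b y))
          (wInv P.θ ul * exp (-∫ y in ((j : ℝ) * P.dx)..x, P.b y))) ?_ ?_ ?_).mono
        (by linarith) (by linarith)) (Eventually.of_forall fun τ => hW x τ)
      · rw [zInv_ofZW hθ hltx, wInv_ofZW hθ hltx]; exact hltx
      · rw [zInv_ofZW hθ hltx, hint]
        have h1 := mul_le_mul_of_nonneg_right hul.lower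
          (exp_pos (-(P.cumul x - P.cumul (j * P.dx)))).le
        refine le_trans (le_of_eq ?_) h1
        unfold Scheme.lower
        rw [mul_assoc, ← Real.exp_add]; ring_nf
      · rw [wInv_ofZW hθ hltx, hint]
        have h1 := (abs_le.mp (h.abs_cumul_sub_le_dx hx (h.invCell_left j))).2
        have h2 := Real.add_one_le_exp (-(P.cumul x - P.cumul (j * P.dx)))
        have h3 : 2 * (b₁ * P.dx) ≤ 1 := by
          have h4 := mul_le_mul_of_nonneg_right k3 hd.le
          linarith [h.dx_small]
        have h4 : 1 / 2 ≤ exp (-(P.cumul x - P.cumul (j * P.dx))) := by linarith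
        have h5 := mul_le_mul_of_nonneg_right hwneg
          (exp_pos (-(P.cumul x - P.cumul (j * P.dx)))).le
        nlinarith

end Regime

/-! ### Assembly of a cell near the vacuum. -/

lemma IsMiddleDensity.flip {γ θ r : ℝ} {ul ur : State} (h : IsMiddleDensity γ θ ul ur r) :
    IsMiddleDensity γ θ (flipState ur) (flipState ul) r := by
  rcases h with ⟨h1, h2, h3, h4⟩ | ⟨h1, h2⟩
  · refine Or.inl ⟨h2, h1, h3, ?_⟩
    rw [flipState_flipState]; linarith
  · refine Or.inr ⟨h1, ?_⟩
    rcases h2 with h2 | h2 | h2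
    · exact Or.inr (Or.inl h2)
    · exact Or.inl h2
    · refine Or.inr (Or.inr ?_)
      rw [wInv_flipState, zInv_flipState]; linarith

namespace Regime

variable {γ M B b₁ K : ℝ} {P : Scheme}

lemma vacuumCell_inBox (h : Regime γ M B b₁ K P) (hK : vacThreshold γ M B b₁ ≤ K)
    {j : ℤ} {ul ur uS : State} {r c : ℝ} {W : ℝ → ℝ → State}
    (hl : ul = (0, 0) ∨ NodeData P (j * P.dx) ul)
    (hr : 0 < ur.1 → P.lower (((j : ℝ) + 1) * P.dx) ≤ zInv P.θ ur)
    (hm : IsMiddleDensity P.γ P.θ ul ur r)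
    (h1 : (0 < ul.1 ∧ r ≤ ul.1) → P.VacuumSide j ul uS c W)
    (h2 : ¬(0 < ul.1 ∧ r ≤ ul.1) → uS = ul) :
    InBox P.θ (P.lower (((j : ℝ) + 1) * P.dx)) (P.upper (j * P.dx)) uS := by
  rcases hl with rfl | hl
  · rw [h2 (fun g => lt_irrefl _ g.1)]
    exact Or.inl rfl
  by_cases hc : r ≤ ul.1
  · exact (h.vacuumSide_props hK hl (h1 ⟨hl.pos, hc⟩)).1
  · rw [h2 (fun g => hc g.2)]
    push Not at hc
    refine Or.inr ⟨hl.pos, ?_, hl.upper⟩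
    -- An unmodified side carries a shock, across which z falls to a value not less than z(ur). The
    -- bound of ur at the right end of the cell thus passes to ul.
    rcases hm with ⟨-, g2, g3, g4⟩ | ⟨g1, -⟩
    · have k1 := waveVel_ge_of_mid h.γ_eq' h.θ_pos g2 g4
      have k2 := hr g2
      rw [waveVel_of_lt hl.pos hc] at k1
      have k3 := jumpVel_nonneg P.γ r ul.1
      have k4 := div_le_div_of_nonneg_right (Real.rpow_le_rpow hl.pos.le hc.le h.θ_pos.le)
        h.θ_pos.le
      unfold zInv at k1 k2 ⊢
      linarith
    · linarith [hl.pos]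


/-- One time step in a cell near the vacuum. -/
lemma vacuumCell_leftLimit (h : Regime γ M B b₁ K P) (hK : vacThreshold γ M B b₁ ≤ K)
    {j : ℤ} {ul ur : State} {r : ℝ} {V : ℝ → ℝ → State}
    (hl : ul = (0, 0) ∨ NodeData P (j * P.dx) ul)
    (hr : ur = (0, 0) ∨ NodeData P (((j : ℝ) + 1) * P.dx) ur)
    (hm : IsMiddleDensity P.γ P.θ ul ur r) (hV : P.VacuumCell j ul ur r V) {x : ℝ}
    (hx1 : (j : ℝ) * P.dx ≤ x) (hx2 : x < ((j : ℝ) + 1) * P.dx) :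
    LeftLimitIn P.θ P.dt (P.lower x - 2 * (fanConst γ M B * exp B) * P.errSize)
      (P.upper x + 2 * (fanConst γ M B * exp B) * P.errSize) (V x) := by
  obtain ⟨ulS, urS, cl, cr, r', Wl, Wr, hl1, hl2, hr1, hr2, hm', hVeq⟩ := hV
  have hx : P.InCell j x := ⟨hx1, hx2.le⟩
  have herr : 0 ≤ 2 * (fanConst γ M B * exp B) * P.errSize :=
    mul_nonneg (mul_nonneg zero_le_two (mul_nonneg h.fanConst_nonneg (exp_pos _).le))
      h.errSize_pos.le
  have hlnode : 0 < ul.1 → NodeData P (j * P.dx) ul := by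
    rintro g
    rcases hl with rfl | hl
    exacts [absurd g (lt_irrefl _), hl]
  have hrnode : 0 < ur.1 → NodeData P (((j : ℝ) + 1) * P.dx) ur := by
    rintro g
    rcases hr with rfl | hr
    exacts [absurd g (lt_irrefl _), hr]
  have hboxl := h.vacuumCell_inBox hK hl (fun g => (hrnode g).lower) hm hl1 hl2
  have e1 : (((-j - 1 : ℤ) : ℝ) + 1) * P.flip.dx = -(j * P.dx) := by
    simp only [Scheme.flip]; push_cast; ring
  have e2 : ((-j - 1 : ℤ) : ℝ) * P.flip.dx = -(((j : ℝ) + 1) * P.dx) := by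
    simp only [Scheme.flip]; push_cast; ring
  have hboxr : InBox P.θ (P.lower (((j : ℝ) + 1) * P.dx)) (P.upper (j * P.dx)) urS := by
    have := h.flip.vacuumCell_inBox hK (j := -j - 1) (ul := flipState ur) (ur := flipState ul)
      (uS := flipState urS) (r := r) (c := cr) (W := Wr) ?_ ?_ hm.flip hr1 ?_
    · have := this.flip
      rw [e1, e2, lower_flip, upper_flip, neg_neg, neg_neg, neg_neg, neg_neg,
        flipState_flipState] at this
      exact this
    · rcases hr with rfl | hr
      · left; simp [flipState]
      · right; exact hr.flip
    · intro g
      rw [e1, lower_flip, neg_neg]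
      change _ ≤ zInv P.θ (flipState ul)
      rw [zInv_flipState]
      linarith [(hlnode g).upper]
    · intro g
      rw [hr2 g]
  have hRP : LeftLimitIn P.θ P.dt (P.lower x - 2 * (fanConst γ M B * exp B) * P.errSize)
      (P.upper x + 2 * (fanConst γ M B * exp B) * P.errSize)
      (fun τ => riemannSol P.γ P.θ ulS urS r' (x - P.mid j) τ) := by
    have hlo := h.lower_le (((j : ℝ) + 1) * P.dx)
    have := mul_pos h.M_pos (exp_pos (-B))
    refine (riemannSol_leftLimit h.γ_eq' h.θ_pos h.dt_pos hboxl hboxr (by linarith)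
      (h.upper_pos _).le hm').mono ?_ ?_
    · linarith [h.lower_mono hx2.le]
    · linarith [h.upper_mono hx1]
  have hτev := eventually_mem_Ioo h.dt_pos
  have hA : (∀ᶠ τ in 𝓝[<] P.dt, (0 < ul.1 ∧ r ≤ ul.1) ∧ x - P.mid j ≤ cl * τ) ∨
      (∀ᶠ τ in 𝓝[<] P.dt, ¬((0 < ul.1 ∧ r ≤ ul.1) ∧ x - P.mid j ≤ cl * τ)) := by
    by_cases g : 0 < ul.1 ∧ r ≤ ul.1
    · simpa only [g, true_and] using eventually_le_mul_or (x - P.mid j) cl P.dt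
    · exact Or.inr (Eventually.of_forall fun τ g' => g g'.1)
  have hB : (∀ᶠ τ in 𝓝[<] P.dt, (0 < ur.1 ∧ r ≤ ur.1) ∧ -(x - P.mid j) ≤ cr * τ) ∨
      (∀ᶠ τ in 𝓝[<] P.dt, ¬((0 < ur.1 ∧ r ≤ ur.1) ∧ -(x - P.mid j) ≤ cr * τ)) := by
    by_cases g : 0 < ur.1 ∧ r ≤ ur.1
    · simpa only [g, true_and] using eventually_le_mul_or (-(x - P.mid j)) cr P.dt
    · exact Or.inr (Eventually.of_forall fun τ g' => g g'.1)
  rcases hA with hA | hA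
  · have hne : (0 < ul.1 ∧ r ≤ ul.1) := by
      obtain ⟨τ, hτ⟩ := hA.exists
      exact hτ.1
    have := (h.vacuumSide_props hK (hlnode hne.1) (hl1 hne)).2 x hx
      (hA.mono fun τ hτ => hτ.2)
    refine this.congr ?_
    filter_upwards [hA, hτev] with τ g1 g2
    rw [hVeq x τ hx1 hx2 g2.1.le g2.2, if_pos g1]
  · rcases hB with hB | hB
    · have hne : (0 < ur.1 ∧ r ≤ ur.1) := by
        obtain ⟨τ, hτ⟩ := hB.exists
        exact hτ.1
      have := (h.flip.vacuumSide_props hK (hrnode hne.1).flip (hr1 hne)).2 (-x) (invCell_flip hx)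
        (hB.mono fun τ hτ => by rw [mid_flip]; linarith [hτ.2])
      refine (leftLimit_of_flip this).congr ?_
      filter_upwards [hA, hB, hτev] with τ g0 g1 g2
      rw [hVeq x τ hx1 hx2 g2.1.le g2.2, if_neg g0, if_pos g1]
    · refine hRP.congr ?_
      filter_upwards [hA, hB, hτev] with τ g0 g1 g2
      rw [hVeq x τ hx1 hx2 g2.1.le g2.2, if_neg g0, if_neg g1]

/-- One time step in a cell. -/
lemma cellSolution_leftLimit (h : Regime γ M B b₁ K P) (hK : vacThreshold γ M B b₁ ≤ K)
    (hK' : regThreshold γ M B b₁ ≤ K) {j : ℤ} {ul ur : State} {V : ℝ → ℝ → State}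
    (hl : ul = (0, 0) ∨ NodeData P (j * P.dx) ul)
    (hr : ur = (0, 0) ∨ NodeData P (((j : ℝ) + 1) * P.dx) ur)
    (hV : P.CellSolution j ul ur V) {x : ℝ}
    (hx1 : (j : ℝ) * P.dx ≤ x) (hx2 : x < ((j : ℝ) + 1) * P.dx) :
    LeftLimitIn P.θ P.dt (P.lower x - regErrConst γ M B b₁ * P.errSize)
      (P.upper x + regErrConst γ M B b₁ * P.errSize) (V x) := by
  obtain ⟨r, hm, hreg, hvac⟩ := hV
  rcases lt_or_ge (P.dx ^ P.β) r with hlt | hle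
  · have hr0 : 0 < r := (Real.rpow_pos_of_pos h.dx_pos _).trans hlt
    rcases hm with ⟨g1, g2, -, g4⟩ | ⟨g1, -⟩
    · rcases hl with rfl | hl
      · exact absurd g1 (lt_irrefl _)
      rcases hr with rfl | hr
      · exact absurd g2 (lt_irrefl _)
      exact h.regularCell_leftLimit hK' (h.vacThreshold_le hK).2.1 hl hr hlt g4 (hreg hlt) hx1 hx2
    · exact absurd g1 hr0.ne'
  · have : 2 * (fanConst γ M B * exp B) * P.errSize ≤ regErrConst γ M B b₁ * P.errSize := by
      have hme : 0 ≤ midErrConst γ M B b₁ * exp (2 * B) :=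
        mul_nonneg h.midErrConst_nonneg (exp_pos _).le
      exact mul_le_mul_of_nonneg_right (by unfold regErrConst; linarith) h.errSize_pos.le
    exact (h.vacuumCell_leftLimit hK hl hr hm (hvac hle) hx1 hx2).mono (by linarith) (by linarith)

end Regime

/-! ### From left limits to traces and averages. -/

lemma Physical.zInv_le_wInv {θ : ℝ} (hθ : 0 < θ) {u : State} (h : Physical u) :
    zInv θ u ≤ wInv θ u := by
  have := div_nonneg (Real.rpow_nonneg h.1 θ) hθ.le
  unfold zInv wInv; linarith

lemma Physical.eq_ofZW {θ : ℝ} (hθ : 0 < θ) {u : State} (h : Physical u) :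
    u = ofZW θ (zInv θ u) (wInv θ u) := by
  have h1 : (θ * (wInv θ u - zInv θ u) / 2) ^ (1 / θ) = u.1 := by
    rw [← rpow_eq hθ.ne', ← Real.rpow_mul h.1, mul_one_div_cancel hθ.ne', Real.rpow_one]
  rw [ofZW, h1, ← vel_eq]
  refine Prod.ext rfl ?_
  by_cases h0 : u.1 = 0
  · simp [h.2 h0, h0]
  · simp only [vel]; field_simp

/-- The state is a continuous function of its invariants, also where they coincide, so its own left
limit exists and is the trace. The weaker bounds on m/ρ, in product form, are linear in (ρ, m) and
meaningful at the vacuum. -/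
lemma LeftLimitIn.limUnder_bounds {θ T lo hi : ℝ} (hθ : 0 < θ) {f : ℝ → State}
    (h : LeftLimitIn θ T lo hi f) :
    0 ≤ (limUnder (𝓝[<] T) f).1 ∧
      lo * (limUnder (𝓝[<] T) f).1 ≤ (limUnder (𝓝[<] T) f).2 ∧
      (limUnder (𝓝[<] T) f).2 ≤ hi * (limUnder (𝓝[<] T) f).1 := by
  obtain ⟨⟨zl, wl, h1, h2, h3, h4⟩, h5⟩ := h
  have hle : zl ≤ wl := le_of_tendsto_of_tendsto h1 h2 (by
    filter_upwards [h5] with τ hτ using hτ.zInv_le_wInv hθ)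
  have hρ : Tendsto (fun τ => (θ * (wInv θ (f τ) - zInv θ (f τ)) / 2) ^ (1 / θ)) (𝓝[<] T)
      (𝓝 ((θ * (wl - zl) / 2) ^ (1 / θ))) :=
    (((h2.sub h1).const_mul θ).div_const 2).rpow_const (Or.inr (by positivity))
  have hlim : Tendsto f (𝓝[<] T) (𝓝 (NozzleFlow.ofZW θ zl wl)) := by
    refine Tendsto.congr' ?_ (hρ.prodMk_nhds (hρ.mul ((h2.add h1).div_const 2)))
    filter_upwards [h5] with τ hτ using (hτ.eq_ofZW hθ).symm
  rw [hlim.limUnder_eq]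
  have h6 : 0 ≤ (NozzleFlow.ofZW θ zl wl).1 :=
    Real.rpow_nonneg (by have := mul_nonneg hθ.le (sub_nonneg.mpr hle); linarith) _
  have e : (NozzleFlow.ofZW θ zl wl).2 = ((wl + zl) / 2) * (NozzleFlow.ofZW θ zl wl).1 := mul_comm _ _
  rw [e]
  refine ⟨h6, ?_, ?_⟩
  · exact mul_le_mul_of_nonneg_right (by linarith) h6
  · exact mul_le_mul_of_nonneg_right (by linarith) h6

lemma LeftLimitIn.translate {θ T s lo hi : ℝ} {f : ℝ → State}
    (h : LeftLimitIn θ T lo hi (fun τ => f (s + τ))) : LeftLimitIn θ (s + T) lo hi f := by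
  have hm : Tendsto (fun t => t - s) (𝓝[<] (s + T)) (𝓝[<] T) := by
    refine tendsto_nhdsWithin_iff.mpr ⟨?_, ?_⟩
    · have : Tendsto (fun t : ℝ => t - s) (𝓝 (s + T)) (𝓝 (s + T - s)) :=
        (continuous_id.sub continuous_const).tendsto _
      rw [add_sub_cancel_left] at this
      exact this.mono_left nhdsWithin_le_nhds
    · filter_upwards [self_mem_nhdsWithin] with t ht
      have : t < s + T := ht
      exact Set.mem_Iio.mpr (by linarith)
  obtain ⟨⟨zl, wl, h1, h2, h3, h4⟩, h5⟩ := h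
  refine ⟨⟨zl, wl, ?_, ?_, h3, h4⟩, ?_⟩
  · simpa [Function.comp_def] using h1.comp hm
  · simpa [Function.comp_def] using h2.comp hm
  · simpa using hm.eventually h5

/-- Bounds of a quotient of integrals; a function that is not integrable has integral zero. -/
lemma integral_bounds {ρ m : ℝ → ℝ} {a b lo hi : ℝ} (hab : a ≤ b) (hlo : lo ≤ 0) (hhi : 0 ≤ hi)
    (hpos : 0 < ∫ x in a..b, ρ x)
    (h : ∀ᵐ x, x ∈ Set.Icc a b → lo * ρ x ≤ m x ∧ m x ≤ hi * ρ x) :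
    lo * (∫ x in a..b, ρ x) ≤ ∫ x in a..b, m x ∧
      ∫ x in a..b, m x ≤ hi * ∫ x in a..b, ρ x := by
  have hρ : IntervalIntegrable ρ volume a b := by
    by_contra hn
    rw [intervalIntegral.integral_undef hn] at hpos
    exact lt_irrefl _ hpos
  by_cases hm : IntervalIntegrable m volume a b
  · rw [← intervalIntegral.integral_const_mul, ← intervalIntegral.integral_const_mul]
    have h' := (ae_restrict_iff' measurableSet_Icc).mpr h
    constructor
    · refine intervalIntegral.integral_mono_ae_restrict hab (hρ.const_mul lo) hm ?_
      filter_upwards [h'] with x hx using hx.1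
    · refine intervalIntegral.integral_mono_ae_restrict hab hm (hρ.const_mul hi) ?_
      filter_upwards [h'] with x hx using hx.2
  · rw [intervalIntegral.integral_undef hm]
    exact ⟨mul_nonpos_of_nonpos_of_nonneg hlo hpos.le, mul_nonneg hhi hpos.le⟩

namespace Regime

variable {γ M B b₁ K : ℝ} {P : Scheme}

/-! ### The nodes of the scheme -/

/-- The state `u` satisfies the bounds of the invariant region at `x` up to `e`. -/
def TraceBound (P : Scheme) (e x : ℝ) (u : State) : Prop :=
  0 ≤ u.1 ∧ (P.lower x - e) * u.1 ≤ u.2 ∧ u.2 ≤ (P.upper x + e) * u.1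

/-- Threshold for the mesh in the analysis of the cell averages. -/
def nodeThreshold (γ M B b₁ : ℝ) : ℝ :=
  b₁ + dispConst M B b₁ + regErrConst γ M B b₁ + 1 / (2 * (M * exp (-B)))

lemma regErrConst_nonneg (h : Regime γ M B b₁ K P) : 0 ≤ regErrConst γ M B b₁ := by
  have := mul_nonneg h.fanConst_nonneg (exp_pos B).le
  have := mul_nonneg h.midErrConst_nonneg (exp_pos (2 * B)).le
  unfold regErrConst
  linarith

/-- The average has velocity between the bounds at the node up to O(dx), and either vanishes by the
cut-off or has ρ^θ ≥ dx^(δθ). As δθ < 1/2, this dominates O(dx), and truncating z and w leaves a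
gap. -/
lemma nodeState_data (h : Regime γ M B b₁ K P) (hK : nodeThreshold γ M B b₁ ≤ K)
    {u₀ : ℝ → State} {u : ℝ → ℝ → State} {n : ℕ}
    (ht : ∀ᵐ x, TraceBound P (regErrConst γ M B b₁ * P.errSize) x (P.trace u₀ u n x)) (j : ℤ) :
    P.nodeState u₀ u n j = (0, 0) ∨ NodeData P (j * P.dx) (P.nodeState u₀ u n j) := by
  have hd := h.dx_pos
  have hθ := h.θ_pos
  have hD := h.dispConst_nonneg
  have hC := h.regErrConst_nonneg
  have hm0 : 0 < M * exp (-B) := mul_pos h.M_pos (exp_pos _)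
  have hm1 : 0 < 1 / (2 * (M * exp (-B))) := by positivity
  have hb := h.b₁_nonneg
  have hδ0 : 0 < P.dx ^ (P.δ * P.θ) := Real.rpow_pos_of_pos hd _
  unfold nodeThreshold at hK
  by_cases hav : (P.average u₀ u n j).1 < P.dx ^ P.δ
  · left; rw [Scheme.nodeState, if_pos hav]
  right
  have hav' := not_lt.mp hav
  have hE0 : 0 < (P.average u₀ u n j).1 := (Real.rpow_pos_of_pos hd _).trans_le hav'
  have hEθ : P.dx ^ (P.δ * P.θ) ≤ (P.average u₀ u n j).1 ^ P.θ := by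
    rw [Real.rpow_mul hd.le]
    exact Real.rpow_le_rpow (Real.rpow_nonneg hd.le _) hav' hθ.le
  -- The factor 3 is 1/θ ≥ 3, which leaves room for the error e.
  have hEθ' : 3 * P.dx ^ (P.δ * P.θ) ≤ (P.average u₀ u n j).1 ^ P.θ / P.θ := by
    rw [le_div_iff₀ hθ]
    have := mul_le_mul_of_nonneg_left h.θ_le hδ0.le
    linarith
  set L := P.lower (j * P.dx) with hL
  set U := P.upper (j * P.dx) with hU
  set E := P.average u₀ u n j with hE
  have hLneg : L ≤ -(M * exp (-B)) := h.lower_le _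
  have hUpos : M * exp (-B) ≤ U := h.le_upper _
  set e := (dispConst M B b₁ + regErrConst γ M B b₁) * P.dx with he
  have he0 : 0 ≤ e := mul_nonneg (by linarith) hd.le
  have hvel : L - e ≤ vel E ∧ vel E ≤ U + e := by
    have hpos : 0 < ∫ x in (((j : ℝ) - 1 / 2) * P.dx)..(((j : ℝ) + 1 / 2) * P.dx),
        (P.trace u₀ u n x).1 := by
      have h1 : E.1 = 1 / P.dx * ∫ x in (((j : ℝ) - 1 / 2) * P.dx)..(((j : ℝ) + 1 / 2) * P.dx),
        (P.trace u₀ u n x).1 := rfl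
      rw [h1] at hE0
      exact pos_of_mul_pos_right hE0 (by positivity)
    have hb' := integral_bounds (lo := L - e) (hi := U + e)
      (m := fun x => (P.trace u₀ u n x).2)
      (by nlinarith : ((j : ℝ) - 1 / 2) * P.dx ≤ ((j : ℝ) + 1 / 2) * P.dx)
      (by linarith) (by linarith) hpos (by
        filter_upwards [ht] with x hx hxI
        obtain ⟨g1, g2, g3⟩ := hx
        have hdist : |x - j * P.dx| ≤ P.dx := by
          rw [abs_le]; constructor <;> linarith [hxI.1, hxI.2]
        have hcum : |P.cumul x - P.cumul (j * P.dx)| ≤ b₁ * P.dx :=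
          (h.abs_cumul_sub_le _ _).trans (mul_le_mul_of_nonneg_left hdist hb)
        have hcum' : |-(P.cumul x - P.cumul (j * P.dx))| ≤ b₁ * P.dx := by rwa [abs_neg]
        have hUb : |U| ≤ invBound M B := by
          rw [abs_le]; constructor <;>
            linarith [h.upper_le (j * P.dx), h.invBound_ge, h.invBound_pos]
        have hLb : |L| ≤ invBound M B := by
          rw [abs_le]; constructor <;>
            linarith [h.le_lower (j * P.dx), h.invBound_ge, h.invBound_pos]
        have k1 := (abs_le.mp (h.abs_mul_exp_sub_le (by linarith) hcum hUb)).2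
        have k2 := (abs_le.mp (h.abs_mul_exp_sub_le (by linarith) hcum' hLb)).1
        have k3 : U * exp (P.cumul x - P.cumul (j * P.dx)) = P.upper x := by
          rw [hU]; unfold Scheme.upper
          rw [mul_assoc, ← Real.exp_add]; ring_nf
        have k4 : L * exp (-(P.cumul x - P.cumul (j * P.dx))) = P.lower x := by
          rw [hL]; unfold Scheme.lower
          rw [mul_assoc, ← Real.exp_add]; ring_nf
        have k5 : 2 * invBound M B * b₁ * P.dx = dispConst M B b₁ * P.dx := rfl
        have k6 := mul_le_mul_of_nonneg_left h.errSize_le hC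
        rw [k3, k5] at k1
        rw [k4, k5] at k2
        constructor
        · refine le_trans (mul_le_mul_of_nonneg_right ?_ g1) g2
          rw [he]; linarith
        · refine g3.trans (mul_le_mul_of_nonneg_right ?_ g1)
          rw [he]; linarith)
    have e1 : vel E = (∫ x in (((j : ℝ) - 1 / 2) * P.dx)..(((j : ℝ) + 1 / 2) * P.dx),
        (P.trace u₀ u n x).2) / ∫ x in (((j : ℝ) - 1 / 2) * P.dx)..(((j : ℝ) + 1 / 2) * P.dx),
        (P.trace u₀ u n x).1 := by
      rw [hE]; simp only [vel, Scheme.average]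
      rw [mul_div_mul_left]
      positivity
    rw [e1, le_div_iff₀ hpos, div_le_iff₀ hpos]
    exact hb'
  have heδ : e ≤ P.dx ^ (P.δ * P.θ) := by
    refine le_trans (mul_le_mul_of_nonneg_right ?_ hd.le) h.dx_δ
    linarith
  have hδ1 : P.dx ^ (P.δ * P.θ) ≤ 2 * (M * exp (-B)) := by
    have k : 1 / (2 * (M * exp (-B))) ≤ K := by linarith
    rw [div_le_iff₀ (by positivity)] at k
    have k2 := mul_le_mul_of_nonneg_right k hδ0.le
    have k3 := mul_le_mul_of_nonneg_left h.small_δ (show 0 ≤ 2 * (M * exp (-B)) by positivity)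
    linarith
  -- Each pairing of w or U with z or L is checked: the density gives the gap in three cases, the
  -- distance between the fixed bounds in the last.
  have hgap : P.dx ^ (P.δ * P.θ) ≤ min (wInv P.θ E) U - max (zInv P.θ E) L := by
    rw [le_sub_iff_add_le]
    refine le_min ?_ ?_
    · rw [← le_sub_iff_add_le']
      refine max_le ?_ ?_ <;> unfold wInv <;> [unfold zInv; skip] <;> linarith
    · rw [← le_sub_iff_add_le']
      refine max_le ?_ ?_ <;> [unfold zInv; skip] <;> linarith
  have hns : P.nodeState u₀ u n j = ofZW P.θ (max (zInv P.θ E) L) (min (wInv P.θ E) U) := by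
    rw [Scheme.nodeState, if_neg hav]
    rfl
  have hlt : max (zInv P.θ E) L < min (wInv P.θ E) U := by linarith
  rw [hns]
  refine ⟨ofZW_fst_pos hθ hlt, ?_, ?_, ?_⟩
  · rw [zInv_ofZW hθ hlt]; exact le_max_right _ _
  · rw [wInv_ofZW hθ hlt]; exact min_le_right _ _
  · rw [zInv_ofZW hθ hlt, wInv_ofZW hθ hlt]; exact hgap

/-! ### Induction over the time steps -/

lemma step_leftLimit (h : Regime γ M B b₁ K P) (hK : vacThreshold γ M B b₁ ≤ K)
    (hK' : regThreshold γ M B b₁ ≤ K) (hK'' : nodeThreshold γ M B b₁ ≤ K)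
    {u₀ : ℝ → State} {u : ℝ → ℝ → State} (hu : P.IsApproxSolution u₀ u) {n : ℕ}
    (ht : ∀ᵐ x, TraceBound P (regErrConst γ M B b₁ * P.errSize) x (P.trace u₀ u n x)) (x : ℝ) :
    LeftLimitIn P.θ (((n : ℝ) + 1) * P.dt) (P.lower x - regErrConst γ M B b₁ * P.errSize)
      (P.upper x + regErrConst γ M B b₁ * P.errSize) (u x) := by
  have hd := h.dx_pos
  have h1 := Int.floor_le (x / P.dx)
  have h2 := Int.lt_floor_add_one (x / P.dx)
  rw [le_div_iff₀ hd] at h1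
  rw [div_lt_iff₀ hd] at h2
  have hr := h.nodeState_data hK'' ht (⌊x / P.dx⌋ + 1)
  push_cast at hr
  have := h.cellSolution_leftLimit hK hK' (h.nodeState_data hK'' ht ⌊x / P.dx⌋) hr
    (hu n ⌊x / P.dx⌋) h1 h2
  have := this.translate
  rwa [add_one_mul]

/-- The error is the same for all n: the bound at time n only serves to make the node values
admissible, and these satisfy the exact bounds again. -/
lemma trace_bound (h : Regime γ M B b₁ K P) (hK : vacThreshold γ M B b₁ ≤ K)
    (hK' : regThreshold γ M B b₁ ≤ K) (hK'' : nodeThreshold γ M B b₁ ≤ K)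
    {u₀ : ℝ → State} (hu₀ : AdmissibleData P.θ P.M P.b u₀)
    {u : ℝ → ℝ → State} (hu : P.IsApproxSolution u₀ u) (n : ℕ) :
    ∀ᵐ x, TraceBound P (regErrConst γ M B b₁ * P.errSize) x (P.trace u₀ u n x) := by
  induction n with
  | zero =>
    filter_upwards [hu₀.2] with x hx
    obtain ⟨h1, h2, h3, h4⟩ := hx
    have he := mul_nonneg h.regErrConst_nonneg h.errSize_pos.le
    have e : P.trace u₀ u 0 x = u₀ x := by simp [Scheme.trace]
    have hzw := Physical.zInv_le_wInv h.θ_pos (u := u₀ x) ⟨h1, h2⟩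
    have hm : (u₀ x).2 = vel (u₀ x) * (u₀ x).1 := by
      by_cases h0 : (u₀ x).1 = 0
      · rw [h2 h0, h0, mul_zero]
      · rw [vel, div_mul_cancel₀ _ h0]
    have h3' : P.lower x ≤ zInv P.θ (u₀ x) := h3
    have h4' : wInv P.θ (u₀ x) ≤ P.upper x := h4
    have hv := vel_eq P.θ (u₀ x)
    rw [e]
    refine ⟨h1, ?_, ?_⟩
    · rw [hm]; exact mul_le_mul_of_nonneg_right (by linarith) h1
    · rw [hm]; exact mul_le_mul_of_nonneg_right (by linarith) h1
  | succ n ih =>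
    refine Eventually.of_forall fun x => ?_
    have := (h.step_leftLimit hK hK' hK'' hu ih x).limUnder_bounds h.θ_pos
    rw [Scheme.trace, if_neg (Nat.succ_ne_zero n)]
    push_cast
    exact this

end Regime

/-! ### The data of the scheme for small mesh lengths -/

lemma eventually_const_mul_rpow_le (K : ℝ) {p q : ℝ} (h : q < p) :
    ∀ᶠ t in 𝓝[>] (0 : ℝ), K * t ^ p ≤ t ^ q := by
  have h1 : Tendsto (fun t : ℝ => K * t ^ (p - q)) (𝓝[>] 0) (𝓝 (K * (0 : ℝ) ^ (p - q))) :=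
    (((Real.continuous_rpow_const (sub_pos.mpr h).le).tendsto 0).mono_left
      nhdsWithin_le_nhds).const_mul K
  rw [Real.zero_rpow (sub_pos.mpr h).ne', mul_zero] at h1
  filter_upwards [h1.eventually (gt_mem_nhds zero_lt_one), self_mem_nhdsWithin] with t ht ht0
  have ht0' : 0 < t := ht0
  calc K * t ^ p = K * t ^ (p - q) * t ^ q := by
        rw [mul_assoc, ← Real.rpow_add ht0', sub_add_cancel]
    _ ≤ 1 * t ^ q := mul_le_mul_of_nonneg_right ht.le (Real.rpow_nonneg ht0'.le _)
    _ = _ := one_mul _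

/-- On an interval of fixed length next to x, b is at least b(x) - 1, so its integral limits b(x).
-/
lemma exists_bound_of_uniformContinuous {b : ℝ → ℝ} (hb0 : ∀ x, 0 ≤ b x) (hi : Integrable b)
    (hu : UniformContinuous b) : ∃ C, ∀ x, b x ≤ C := by
  obtain ⟨d, hd, h⟩ := Metric.uniformContinuous_iff.mp hu 1 one_pos
  refine ⟨1 + (∫ x, b x) / (d / 2), fun x => ?_⟩
  have h1 : ∫ _y in x..(x + d / 2), (b x - 1) ≤ ∫ y in x..(x + d / 2), b y := by
    refine intervalIntegral.integral_mono_on (by linarith) intervalIntegrable_const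
      hi.intervalIntegrable fun y hy => ?_
    have h2 : dist x y < d := by
      rw [Real.dist_eq, abs_lt]; constructor <;> linarith [hy.1, hy.2]
    have h3 := h h2
    rw [Real.dist_eq, abs_lt] at h3
    linarith [h3.2]
  have h2 : ∫ y in x..(x + d / 2), b y ≤ ∫ y, b y := by
    rw [intervalIntegral.integral_of_le (by linarith)]
    exact setIntegral_le_integral hi (Eventually.of_forall hb0)
  rw [intervalIntegral.integral_const, smul_eq_mul, add_sub_cancel_left] at h1
  have h3 : b x - 1 ≤ (∫ y, b y) / (d / 2) := by
    rw [le_div_iff₀ (by linarith)]; linarith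
  linarith

lemma abs_integral_le_halfMass {b : ℝ → ℝ} (hb0 : ∀ x, 0 ≤ b x) (hi : Integrable b) (x : ℝ) :
    |∫ y in (0 : ℝ)..x, b y| ≤ halfMass b := by
  rcases le_total 0 x with hx | hx
  · rw [intervalIntegral.integral_of_le hx, abs_of_nonneg (setIntegral_nonneg measurableSet_Ioc
      fun y _ => hb0 y)]
    refine (setIntegral_mono_set hi.integrableOn (Eventually.of_forall hb0)
      (Set.Ioc_subset_Ioi_self.eventuallyLE)).trans (le_max_left _ _)
  · rw [intervalIntegral.integral_of_ge hx, abs_neg, abs_of_nonneg (setIntegral_nonneg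
      measurableSet_Ioc fun y _ => hb0 y)]
    refine (setIntegral_mono_set hi.integrableOn (Eventually.of_forall hb0)
      (Set.Ioc_subset_Iic_self.eventuallyLE)).trans (le_max_right _ _)

lemma exp_mul_sigmaConst_le {θ B : ℝ} (h0 : 0 < θ) (h1 : θ < 1)
    (hB : B ≤ 1 / 2 * Real.log (1 / sigmaConst θ)) : exp (2 * B) * sigmaConst θ ≤ 1 := by
  have hσ := sigmaConst_pos h0 h1
  have : exp (2 * B) ≤ 1 / sigmaConst θ := by
    rw [← Real.exp_log (one_div_pos.mpr hσ)]
    exact exp_le_exp.mpr (by linarith)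
  rwa [le_div_iff₀ hσ] at this

lemma isLittleO_errSize (C : ℝ) {β : ℝ} (hβ : 0 < β) :
    (fun t : ℝ => C * t ^ (1 + β / 3)) =o[𝓝[>] (0 : ℝ)] (fun t : ℝ => t) := by
  refine IsLittleO.const_mul_left ?_ C
  have h1 : Tendsto (fun t : ℝ => t ^ (β / 3)) (𝓝[>] 0) (𝓝 0) := by
    have := ((Real.continuous_rpow_const (show 0 ≤ β / 3 by positivity)).tendsto 0).mono_left
      (nhdsWithin_le_nhds (s := Set.Ioi (0 : ℝ)))
    rwa [Real.zero_rpow (by positivity)] at this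
  rw [isLittleO_iff_tendsto' (by
    filter_upwards [self_mem_nhdsWithin] with t ht h0
    exact absurd h0 (ne_of_gt ht))]
  refine h1.congr' ?_
  filter_upwards [self_mem_nhdsWithin] with t ht
  have ht' : (0 : ℝ) < t := ht
  rw [Real.rpow_add ht', Real.rpow_one, mul_div_cancel_left₀ _ ht'.ne']

end

end NozzleFlow

theorem theorem4p1
    -- adiabatic exponent
    (γ : ℝ) (hγ : 1 < γ) (hγ' : γ ≤ 5 / 3)
    -- the nozzle: `a = -A'/A`
    (A : ℝ → ℝ) (hA : ContDiff ℝ 2 A) (hApos : ∀ x, 0 < A x)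
    (X : ℝ) (hX : 0 < X)
    (hA_right : ∀ x y, X < x → X < y → A x = A y)
    (hA_left : ∀ x y, x < -X → y < -X → A x = A y)
    -- the function `b`
    (b : ℝ → ℝ) (hb : ContDiff ℝ 1 b) (hb0 : ∀ x, 0 ≤ b x)
    (hb_int : MeasureTheory.Integrable b) (hb_uc : UniformContinuous b)
    (hab : ∀ x, |-(deriv A x) / A x| ≤ muConst ((γ - 1) / 2) * b x)
    (hmass : halfMass b ≤ 1 / 2 * Real.log (1 / sigmaConst ((γ - 1) / 2)))
    (M : ℝ) (hM : 0 ≤ M)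
    -- exponents of the scheme
    (α β δ : ℝ) (hδ : 1 < δ) (hδ' : δ < 1 / (2 * ((γ - 1) / 2)))
    (hα : 1 / 2 < α) (hα' : α < 1) (hβ : 0 < β) (hβα : β < α)
    (hαβ : 1 / 2 + β / 2 < α) (hαβ' : α < 1 - 2 * β)
    (hβγ : β < 2 / (γ + 5)) (hβγ' : (9 - 3 * γ) * β / 2 < α) :
    ∃ err : ℝ → ℝ, err =o[𝓝[>] (0 : ℝ)] (fun h : ℝ => h) ∧
      ∀ᶠ dx in 𝓝[>] (0 : ℝ), ∀ dt : ℝ, 0 < dt → dx / dt = 2 * M * Real.exp (halfMass b) →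
        ∀ u₀ : ℝ → State, AdmissibleData ((γ - 1) / 2) M b u₀ →
        ∀ u : ℝ → ℝ → State,
          Scheme.IsApproxSolution
            { γ := γ, a := fun x => -(deriv A x) / A x, b := b, M := M,
              α := α, β := β, δ := δ, dx := dx, dt := dt } u₀ u →
          ∀ (n : ℕ) (x : ℝ), ∃ zl wl : ℝ,
            Tendsto (fun t => zInv ((γ - 1) / 2) (u x t)) (𝓝[<] (((n : ℝ) + 1) * dt)) (𝓝 zl) ∧
            Tendsto (fun t => wInv ((γ - 1) / 2) (u x t)) (𝓝[<] (((n : ℝ) + 1) * dt)) (𝓝 wl) ∧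
            -M * Real.exp (-∫ y in (0 : ℝ)..x, b y) - err dx ≤ zl ∧
            wl ≤ M * Real.exp (∫ y in (0 : ℝ)..x, b y) + err dx := by
  have hθ : 0 < (γ - 1) / 2 := by linarith
  have hθ3 : (γ - 1) / 2 ≤ 1 / 3 := by linarith
  obtain ⟨b₁, hb₁⟩ := exists_bound_of_uniformContinuous hb0 hb_int hb_uc
  have hb₁0 : 0 ≤ b₁ := (hb0 0).trans (hb₁ 0)
  set B := halfMass b with hB
  have hδθ : δ * ((γ - 1) / 2) < 1 / 2 := by
    rw [lt_div_iff₀ (by linarith)] at hδ'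
    linarith
  -- From 1/2 + β/2 < α < 1 - 2β.
  have hβ5 : β < 1 / 5 := by linarith
  have hβθ : β * ((γ - 1) / 2) < 1 / 2 := by nlinarith
  have hβθα : β * ((γ - 1) / 2) < α := by linarith
  -- The moduli make K exceed each threshold without any knowledge of their signs.
  set K := 1 + |Regime.vacThreshold γ M B b₁| + |Regime.regThreshold γ M B b₁| +
    |Regime.nodeThreshold γ M B b₁| with hK
  refine ⟨fun h => Regime.regErrConst γ M B b₁ * h ^ (1 + β / 3), isLittleO_errSize _ hβ, ?_⟩
  have hle1 : ∀ᶠ t in 𝓝[>] (0 : ℝ), t ≤ 1 :=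
    nhdsWithin_le_nhds ((gt_mem_nhds zero_lt_one).mono fun t ht => le_of_lt ht)
  filter_upwards [self_mem_nhdsWithin, hle1,
    eventually_const_mul_rpow_le K hα', eventually_const_mul_rpow_le K hδθ,
    eventually_const_mul_rpow_le K hβθα, eventually_const_mul_rpow_le K hβθ,
    eventually_const_mul_rpow_le K (mul_pos (zero_lt_one.trans hδ) hθ),
    eventually_const_mul_rpow_le K (mul_pos hβ hθ)] with dx hdx hdx1 e1 e2 e3 e4 e5 e6
  intro dt hdt hcfl u₀ hu₀ u hu n x
  have hdx' : 0 < dx := hdx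
  -- For M = 0 the mesh relation would force dx/dt = 0, so there is no mesh to consider.
  have hM' : 0 < M := by
    refine lt_of_le_of_ne hM fun h0 => ?_
    rw [← h0, mul_zero, zero_mul] at hcfl
    exact (div_pos hdx' hdt).ne' hcfl
  rw [Real.rpow_one] at e1
  rw [Real.rpow_zero] at e5 e6
  have hR : Regime γ M B b₁ K
      { γ := γ, a := fun x => -(deriv A x) / A x, b := b, M := M,
        α := α, β := β, δ := δ, dx := dx, dt := dt } :=
    { γ_eq := rfl
      M_eq := rfl
      one_lt_γ := hγ
      γ_le := hγ'
      M_pos := hM'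
      b_cont := hb.continuous
      b_nonneg := hb0
      b_le := hb₁
      a_le := hab
      mass := abs_integral_le_halfMass hb0 hb_int
      sigma := exp_mul_sigmaConst_le (θ := (γ - 1) / 2) hθ (by linarith) hmass
      dx_pos := hdx'
      dt_pos := hdt
      cfl := by rw [div_eq_iff hdt.ne'] at hcfl; simp only; linarith
      α_gt := hαβ
      α_lt := hα'
      β_pos := hβ
      β_lt := hβ5
      δ_pos := zero_lt_one.trans hδ
      one_le_K := by
        have := abs_nonneg (Regime.vacThreshold γ M B b₁)
        have := abs_nonneg (Regime.regThreshold γ M B b₁)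
        have := abs_nonneg (Regime.nodeThreshold γ M B b₁)
        linarith
      dx_le := hdx1
      small_dx := e1
      small_sqrt := e2
      small_α := e3
      small_sqrt' := e4
      small_δ := e5
      small_β := e6 }
  have hn1 := abs_nonneg (Regime.vacThreshold γ M B b₁)
  have hn2 := abs_nonneg (Regime.regThreshold γ M B b₁)
  have hn3 := abs_nonneg (Regime.nodeThreshold γ M B b₁)
  have hK1 : Regime.vacThreshold γ M B b₁ ≤ K := by
    linarith [le_abs_self (Regime.vacThreshold γ M B b₁)]
  have hK2 : Regime.regThreshold γ M B b₁ ≤ K := by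
    linarith [le_abs_self (Regime.regThreshold γ M B b₁)]
  have hK3 : Regime.nodeThreshold γ M B b₁ ≤ K := by
    linarith [le_abs_self (Regime.nodeThreshold γ M B b₁)]
  obtain ⟨zl, wl, h1, h2, h3, h4⟩ := (hR.step_leftLimit hK1 hK2 hK3 hu
    (hR.trace_bound hK1 hK2 hK3 hu₀ hu n) x).1
  exact ⟨zl, wl, h1, h2, h3, h4⟩
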